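/- Let $\|\cdot\|$ be a norm on $\mathbb{R}^d$ with dual norm $\|z\|_*=\sup\{\langle u,z\rangle:\|u\|\le 1\}$, and let $\Psi_1=\sup_{x\ne 0}\|x\|/\|x\|_2$, $\Psi_2=\sup_{x\neq 0}\|x\|_2/\|x\|$. Let $\mathcal X,\mathcal Y\subset\mathbb{R}^d$ be nonempty and compact. Let $\mathcal F$, $\mathcal F'$ be the sets of real functions on $\mathcal X$, $\mathcal Y$ that are Lipschitz with respect to $\|\cdot\|$, let $\|g\|_{\mathcal F}$, $\|g\|_{\mathcal F'}$ be the Lipschitz constants, and for probability distributions $P,P'$ on $\mathcal X$ put $$\gamma_{\mathcal F}(P,P')=\sup_{g\in\mathcal F,\ \|g\|_{\mathcal F}\le 1}\bigl|\mathbb{E}_{x\sim P}g(x)-\mathbb{E}_{x\sim P'}g(x)\bigr|;$$ define $\gamma_{\mathcal F'}$ in the same way on $\mathcal Y$. Let $D=\max\{\sup_{P,P'}\gamma_{\mathcal F}(P,P'),\sup_{Q,Q'}\gamma_{\mathcal F'}(Q,Q')\}$, where the suprema are over all probability distributions on $\mathcal X$ and on $\mathcal Y$. Let $f$ be a real function of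 $(x,y)$ with $\|f(\cdot,y)\|_{\mathcal F}\le G$ for all $y\in\mathcal Y$ and $\|f(x,\cdot)\|_{\mathcal F'}\le G$ for all $x\in\mathcal X$. Suppose that $f$ is also defined, and has a partial gradient $\nabla_x f$ relative to $\operatorname{conv}\mathcal X$, on $\operatorname{conv}\mathcal X\times\mathcal Y$, that it is defined and has a partial gradient $\nabla_y f$ relative to $\operatorname{conv}\mathcal Y$ on $\mathcal X\times\operatorname{conv}\mathcal Y$, and that for some $L\ge 0$ $$\|\nabla_x f(x,y)-\nabla_x f(x',y')\|_*\le L\|x-x'\|+L\|y-y'\|\qquad (x,x'\in\operatorname{conv}\mathcal X,\ y,y'\in\mathcal Y),$$ $$\|\nabla_y f(x,y)-\nabla_y f(x',y')\|_*\le L\|x-x'\|+L\|y-y'\|\qquad (x,x'\in\mathcal X,\ y,y'\in\operatorname{conv}\mathcal Y).$$ (For convex $\mathcal X,\mathcal Y$ these are conditions on $\mathcal X\times\mathcal Y$ only.) For distributions $P,Q$ write $f(P,y)=\mathbb{E}_{x\sim P}f(x,y)$ and $f(x,Q)=\mathbb{E}_{y\sim Q}f(x,y)$. Let $P^1,P^2$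 be probability distributions on $\mathcal F$ and $\mathcal F'$ (the laws of the random perturbation functions) such that for every $g\in\mathcal F$ the problem $\min_{x\in\mathcal X}g(x)-\sigma(x)$ has almost surely a unique minimizer for $\sigma\sim P^1$, and for every $g\in\mathcal F'$ the problem $\max_{y\in\mathcal Y}g(y)+\sigma(y)$ has almost surely a unique maximizer for $\sigma\sim P^2$. Let $\mu_g$ and $\nu_g$ be the distributions of these optimizers. Suppose that $\mathbb{E}_{\sigma\sim P^1}\|\sigma\|_{\mathcal F}=\mathbb{E}_{\sigma\sim P^2}\|\sigma\|_{\mathcal F'}=\eta<\infty$ and that, for a constant $C\ge0$, the predictions are $C\eta^{-1}$-stable: $$\gamma_{\mathcal F}(\mu_g,\mu_h)\le C\eta^{-1}\|g-h\|_{\mathcal F}\ \ (g,h\in\mathcal F),\qquad \gamma_{\mathcal F'}(\nu_g,\nu_h)\le C\eta^{-1}\|g-h\|_{\mathcal F'}\ \ (g,h\in\mathcal F').$$ Suppose $\eta>\sqrt3\,CL$, and let $m,T\ge1$ be integers. Both players use optimistic follow-the-perturbed-leader (OFTPL) with $m$ samples. In each round $t=1,\dots,T$ they take for $j=1,\dots,m$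 $$\tilde x_{t-1,j}\in\operatorname*{argmin}_{x\in\mathcal X}\sum_{i=1}^{t-1}f(x,Q_i)-\sigma'^{1}_{t,j}(x),\qquad \tilde y_{t-1,j}\in\operatorname*{argmax}_{y\in\mathcal Y}\sum_{i=1}^{t-1}f(P_i,y)+\sigma'^{2}_{t,j}(y),$$ with empirical distributions $\tilde P_{t-1},\tilde Q_{t-1}$, and then $$x_{t,j}\in\operatorname*{argmin}_{x\in\mathcal X}\sum_{i=1}^{t-1}f(x,Q_i)+f(x,\tilde Q_{t-1})-\sigma^{1}_{t,j}(x),\qquad y_{t,j}\in\operatorname*{argmax}_{y\in\mathcal Y}\sum_{i=1}^{t-1}f(P_i,y)+f(\tilde P_{t-1},y)+\sigma^{2}_{t,j}(y),$$ with empirical distributions $P_t,Q_t$, which they play. All $\sigma^1_{t,j},\sigma'^1_{t,j}\sim P^1$ and $\sigma^2_{t,j},\sigma'^2_{t,j}\sim P^2$ are independent. Then $$\sup_{x\in\mathcal X,\,y\in\mathcal Y}\mathbb{E}\Bigl[f\Bigl(\tfrac1T\sum_{t=1}^TP_t,\,y\Bigr)-f\Bigl(x,\,\tfrac1T\sum_{t=1}^TQ_t\Bigr)\Bigr]\le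 K\left(\frac{\eta D}{T}+\frac{CD^2L^2}{\eta m}+\min\left\{\frac{dC\Psi_1^2\Psi_2^2G^2\log(2m)}{\eta m},\ \frac{CD^2L^2}{\eta}\right\}\right),$$ where $K>0$ is a universal constant. -/

import Mathlib

open MeasureTheory ProbabilityTheory
open scoped ENNReal

/-- The space `ℝ^d` with its Euclidean structure; `‖·‖` is the Euclidean norm `‖·‖₂`.
A general norm on it is a `Seminorm` that is definite. -/
abbrev Vec (d : ℕ) := EuclideanSpace ℝ (Fin d)

/-- The dual norm `‖z‖_* = sup {⟨u, z⟩ : ‖u‖ ≤ 1}` of the norm `N`. -/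
noncomputable def dualNorm {d : ℕ} (N : Seminorm ℝ (Vec d)) (z : Vec d) : ℝ :=
  ⨆ u : {u : Vec d // N u ≤ 1}, inner ℝ u.1 z

/-- The norm compatibility constant `Ψ₁ = sup_{x ≠ 0} ‖x‖ / ‖x‖₂`. -/
noncomputable def compatConst₁ {d : ℕ} (N : Seminorm ℝ (Vec d)) : ℝ :=
  ⨆ x : {x : Vec d // x ≠ 0}, N x.1 / ‖x.1‖

/-- The norm compatibility constant `Ψ₂ = sup_{x ≠ 0} ‖x‖₂ / ‖x‖`. -/
noncomputable def compatConst₂ {d : ℕ} (N : Seminorm ℝ (Vec d)) : ℝ :=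
  ⨆ x : {x : Vec d // x ≠ 0}, ‖x.1‖ / N x.1

/-- The class of real functions on `X` that are Lipschitz with respect to the norm `N`.
Its measurable structure (inherited from `X → ℝ`) is generated by the point evaluations. -/
def LipClass {d : ℕ} (N : Seminorm ℝ (Vec d)) (X : Set (Vec d)) : Submodule ℝ (X → ℝ) where
  carrier := {g | ∃ K : ℝ, ∀ x x' : X, |g x - g x'| ≤ K * N (x.1 - x'.1)}
  add_mem' := by
    rintro g h ⟨K, hK⟩ ⟨K', hK'⟩
    refine ⟨K + K', fun x x' => ?_⟩
    have e : (g + h) x - (g + h) x' = (g x - g x') + (h x - h x') := by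
      simp only [Pi.add_apply]; ring
    rw [e, add_mul]
    exact (abs_add_le _ _).trans (add_le_add (hK x x') (hK' x x'))
  zero_mem' := ⟨0, fun x x' => by simp⟩
  smul_mem' := by
    rintro c g ⟨K, hK⟩
    refine ⟨|c| * K, fun x x' => ?_⟩
    have e : (c • g) x - (c • g) x' = c * (g x - g x') := by
      simp only [Pi.smul_apply, smul_eq_mul]; ring
    rw [e, abs_mul, mul_assoc]
    exact mul_le_mul_of_nonneg_left (hK x x') (abs_nonneg c)

/-- The Lipschitz constant `sup_{x ≠ x'} |g x - g x'| / ‖x - x'‖`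
(the pairs with `x = x'` contribute `0 / 0 = 0`). -/
noncomputable def lipConst {d : ℕ} (N : Seminorm ℝ (Vec d)) {X : Set (Vec d)} (g : X → ℝ) : ℝ :=
  ⨆ p : X × X, |g p.1 - g p.2| / N (p.1.1 - p.2.1)

/-- The integral probability metric
`γ(P, Q) = sup {|E_P g - E_Q g| : g Lipschitz with constant at most 1}`. -/
noncomputable def ipm {d : ℕ} (N : Seminorm ℝ (Vec d)) {X : Set (Vec d)} (P Q : Measure X) : ℝ :=
  ⨆ g : {g : LipClass N X // lipConst N g.1 ≤ 1}, |∫ x, g.1.1 x ∂P - ∫ x, g.1.1 x ∂Q|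

/-- The diameter, in the metric `ipm N`, of the set of all probability distributions on `X`. -/
noncomputable def ipmDiam {d : ℕ} (N : Seminorm ℝ (Vec d)) (X : Set (Vec d)) : ℝ :=
  ⨆ R : ProbabilityMeasure X × ProbabilityMeasure X, ipm N (R.1 : Measure X) (R.2 : Measure X)

/-- `x ∈ argmin_{X} (g - σ)`. -/
def IsPerturbedMin {α : Type*} (g σ : α → ℝ) (x : α) : Prop :=
  ∀ x', g x - σ x ≤ g x' - σ x'

/-- `y ∈ argmax_{Y} (g + σ)`. -/
def IsPerturbedMax {α : Type*} (g σ : α → ℝ) (y : α) : Prop :=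
  ∀ y', g y' + σ y' ≤ g y + σ y

/-- The distribution of the perturbed best response `argmin (g - σ)`, for `σ` with law `P`. -/
noncomputable def minLaw {d : ℕ} {N : Seminorm ℝ (Vec d)} {X : Set (Vec d)} [Nonempty X]
    (P : Measure (LipClass N X)) (g : LipClass N X) : Measure X :=
  P.map fun σ => Classical.epsilon (IsPerturbedMin g.1 σ.1)

/-- The distribution of the perturbed best response `argmax (g + σ)`, for `σ` with law `P`. -/
noncomputable def maxLaw {d : ℕ} {N : Seminorm ℝ (Vec d)} {X : Set (Vec d)} [Nonempty X]
    (P : Measure (LipClass N X)) (g : LipClass N X) : Measure X :=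
  P.map fun σ => Classical.epsilon (IsPerturbedMax g.1 σ.1)

/-- Predictions distributed as `law g`, when the cumulative loss is `g`, are `β`-stable. -/
def IsStablePrediction {d : ℕ} (N : Seminorm ℝ (Vec d)) {X : Set (Vec d)}
    (law : LipClass N X → Measure X) (β : ℝ) : Prop :=
  ∀ g h : LipClass N X, ipm N (law g) (law h) ≤ β * lipConst N (g - h).1

/-- `f(·, b)` has a gradient `∇₁ f(a, b)` relative to `A` at every `a ∈ A`, for every `b ∈ B`, and
`‖∇₁ f(a, b) - ∇₁ f(a', b')‖_* ≤ L ‖a - a'‖ + L ‖b - b'‖` on `A × B`. -/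
def HasLipPartialGradient {d : ℕ} (N : Seminorm ℝ (Vec d)) (A B : Set (Vec d)) (L : ℝ)
    (f : Vec d → Vec d → ℝ) : Prop :=
  ∃ D₁ : Vec d → Vec d → Vec d,
    (∀ a ∈ A, ∀ b ∈ B, HasGradientWithinAt (fun u => f u b) (D₁ a b) A a) ∧
    ∀ a ∈ A, ∀ a' ∈ A, ∀ b ∈ B, ∀ b' ∈ B,
      dualNorm N (D₁ a b - D₁ a' b') ≤ L * N (a - a') + L * N (b - b')

/-- The mixture `(1/n) ∑ P_i`. -/
noncomputable def mixture {α : Type*} [MeasurableSpace α] {n : ℕ} (P : Fin n → Measure α) :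
    Measure α :=
  (n : ℝ≥0∞)⁻¹ • ∑ i, P i

/-- The empirical distribution of `x_1, …, x_n`. -/
noncomputable def empirical {α : Type*} [MeasurableSpace α] {n : ℕ} (x : Fin n → α) : Measure α :=
  mixture fun j => Measure.dirac (x j)

/-- A run, over `T` rounds and with `m` samples, of optimistic FTPL by both players of the game
`min_x max_y f(x, y)`, on a probability space `(Ω, μ)`. All perturbations are drawn independently,
those of the first player from `P₁` and those of the second from `P₂`. The perturbations with index
`false` serve to compute the guesses, those with index `true` to compute the actions. -/
structure OFTPLGameRun {d : ℕ} {N : Seminorm ℝ (Vec d)} {X Y : Set (Vec d)}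
    (f : Vec d → Vec d → ℝ) (P₁ : Measure (LipClass N X)) (P₂ : Measure (LipClass N Y))
    (m T : ℕ) {Ω : Type*} [MeasurableSpace Ω] (μ : Measure Ω) where
  σ₁ : Bool → Fin T → Fin m → Ω → LipClass N X
  σ₂ : Bool → Fin T → Fin m → Ω → LipClass N Y
  /-- The samples whose empirical distributions are the predictions for the guess `0`
  (in round `t`: the points written `x̃_{t-1,j}`, `ỹ_{t-1,j}`). -/
  xg : Fin T → Fin m → Ω → X
  yg : Fin T → Fin m → Ω → Y
  /-- The samples whose empirical distributions are the actions `P_t`, `Q_t`. -/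
  x : Fin T → Fin m → Ω → X
  y : Fin T → Fin m → Ω → Y
  measurable_σ₁ : ∀ b t j, Measurable (σ₁ b t j)
  measurable_σ₂ : ∀ b t j, Measurable (σ₂ b t j)
  measurable_xg : ∀ t j, Measurable (xg t j)
  measurable_yg : ∀ t j, Measurable (yg t j)
  measurable_x : ∀ t j, Measurable (x t j)
  measurable_y : ∀ t j, Measurable (y t j)
  law_σ₁ : ∀ b t j, μ.map (σ₁ b t j) = P₁
  law_σ₂ : ∀ b t j, μ.map (σ₂ b t j) = P₂
  indep_σ₁ : iIndepFun (fun i : Bool × Fin T × Fin m => σ₁ i.1 i.2.1 i.2.2) μ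
  indep_σ₂ : iIndepFun (fun i : Bool × Fin T × Fin m => σ₂ i.1 i.2.1 i.2.2) μ
  indep_σ₁_σ₂ : IndepFun
    (fun ω (i : Bool × Fin T × Fin m) => σ₁ i.1 i.2.1 i.2.2 ω)
    (fun ω (i : Bool × Fin T × Fin m) => σ₂ i.1 i.2.1 i.2.2 ω) μ
  /-- `x̃_{t-1,j} ∈ argmin_x ∑_{i<t} f(x, Q_i) - σ(x)`. -/
  guess_x : ∀ t j, ∀ᵐ ω ∂μ, IsPerturbedMin
    (fun u : X => ∑ i ∈ Finset.Iio t, ∫ v : Y, f u v ∂(empirical fun k => y i k ω))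
    (σ₁ false t j ω).1 (xg t j ω)
  /-- `ỹ_{t-1,j} ∈ argmax_y ∑_{i<t} f(P_i, y) + σ(y)`. -/
  guess_y : ∀ t j, ∀ᵐ ω ∂μ, IsPerturbedMax
    (fun v : Y => ∑ i ∈ Finset.Iio t, ∫ u : X, f u v ∂(empirical fun k => x i k ω))
    (σ₂ false t j ω).1 (yg t j ω)
  /-- `x_{t,j} ∈ argmin_x ∑_{i<t} f(x, Q_i) + f(x, Q̃_{t-1}) - σ(x)`. -/
  play_x : ∀ t j, ∀ᵐ ω ∂μ, IsPerturbedMin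
    (fun u : X => (∑ i ∈ Finset.Iio t, ∫ v : Y, f u v ∂(empirical fun k => y i k ω))
      + ∫ v : Y, f u v ∂(empirical fun k => yg t k ω))
    (σ₁ true t j ω).1 (x t j ω)
  /-- `y_{t,j} ∈ argmax_y ∑_{i<t} f(P_i, y) + f(P̃_{t-1}, y) + σ(y)`. -/
  play_y : ∀ t j, ∀ᵐ ω ∂μ, IsPerturbedMax
    (fun v : Y => (∑ i ∈ Finset.Iio t, ∫ u : X, f u v ∂(empirical fun k => x i k ω))
      + ∫ u : X, f u v ∂(empirical fun k => xg t k ω))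
    (σ₂ true t j ω).1 (y t j ω)

/-- The first player's action `P_t` in round `t`. -/
noncomputable def OFTPLGameRun.P {d : ℕ} {N : Seminorm ℝ (Vec d)} {X Y : Set (Vec d)}
    {f : Vec d → Vec d → ℝ} {P₁ : Measure (LipClass N X)} {P₂ : Measure (LipClass N Y)}
    {m T : ℕ} {Ω : Type*} [MeasurableSpace Ω] {μ : Measure Ω}
    (r : OFTPLGameRun f P₁ P₂ m T μ) (t : Fin T) (ω : Ω) : Measure X :=
  empirical fun j => r.x t j ω

/-- The second player's action `Q_t` in round `t`. -/
noncomputable def OFTPLGameRun.Q {d : ℕ} {N : Seminorm ℝ (Vec d)} {X Y : Set (Vec d)}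
    {f : Vec d → Vec d → ℝ} {P₁ : Measure (LipClass N X)} {P₂ : Measure (LipClass N Y)}
    {m T : ℕ} {Ω : Type*} [MeasurableSpace Ω] {μ : Measure Ω}
    (r : OFTPLGameRun f P₁ P₂ m T μ) (t : Fin T) (ω : Ω) : Measure Y :=
  empirical fun j => r.y t j ω

/-- `f((1/T) ∑ P_t, y) - f(x, (1/T) ∑ Q_t)`, as a function of the randomness. -/
noncomputable def OFTPLGameRun.gap {d : ℕ} {N : Seminorm ℝ (Vec d)} {X Y : Set (Vec d)}
    {f : Vec d → Vec d → ℝ} {P₁ : Measure (LipClass N X)} {P₂ : Measure (LipClass N Y)}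
    {m T : ℕ} {Ω : Type*} [MeasurableSpace Ω] {μ : Measure Ω}
    (r : OFTPLGameRun f P₁ P₂ m T μ) (x : X) (y : Y) (ω : Ω) : ℝ :=
  (∫ u : X, f u y ∂(mixture fun t => r.P t ω)) - (∫ v : Y, f x v ∂(mixture fun t => r.Q t ω))

/-! ### Norms on `ℝ^d` -/

section Norms

variable {d : ℕ} {N : Seminorm ℝ (Vec d)}

/-! For one player let Φ(g) be the expected perturbed minimum `potential`. It is an average of
minima of affine functionals of g, hence concave, and the law of the best response, `minLaw P g`, is
a supergradient at g (`potential_le`). Stability says that this supergradient is Lipschitz with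
constant β = C/η, from the Lipschitz seminorm to the metric γ. Like any smooth concave function, Φ
then has a quadratic lower bound (`potential_add_ge`) and a supergradient inequality sharpened by
γ²/(3β) (`potential_le_sub_ipm_sq`). Applied to an optimistic round with loss F_t and guess G_t and
telescoped, these bound the regret by ηD + ∑ (¾β‖F_t − G_t‖² − γ_t²/(3β)), where γ_t is the distance
between the laws of the player's action and guess samples (`sum_integral_minLaw_sub_le`).

In the game, ‖F_t − G_t‖ is at most L times the distance between the laws of the opponent's action
and guess samples, plus two sampling errors. Because η > √3·CL, the first contribution is absorbed
by the negative term in the opponent's regret. When the two regrets are added, the movement terms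
cancel in both directions and only sampling errors survive (`OFTPLGameRun.regret_le`,
`OFTPLGameRun.integral_gap_le`).

A sampling error is a supremum of deviations of empirical means of difference quotients. It is
trivially at most LD. Otherwise Hoeffding's inequality and a union bound over a finite net of pairs
of points control it, smoothness making the net fine enough
(`SmoothGame.exists_bound_sampling_error`).

Passing from the samples to their laws needs probability: since optimizers are almost surely unique,
every action is almost surely a measurable function of the noise drawn so far, and fresh noise is
independent of the loss it meets (`OFTPLGameRun.aemeasurableFor_upTo`,
`OFTPLGameRun.integral_roundLoss_x`). The expected regret of the empirical play is therefore that of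
the laws. -/

theorem Seminorm.exists_le_mul_norm (N : Seminorm ℝ (Vec d)) : ∃ c : ℝ, 0 < c ∧ ∀ x, N x ≤ c * ‖x‖ := by
  refine ⟨(∑ i, N (EuclideanSpace.basisFun (Fin d) ℝ i)) + 1, ?_, fun x => ?_⟩
  · exact add_pos_of_nonneg_of_pos (Finset.sum_nonneg fun i _ => apply_nonneg _ _) one_pos
  · conv_lhs => rw [← (EuclideanSpace.basisFun (Fin d) ℝ).sum_repr x]
    refine (Finset.le_sum_of_subadditive N (map_zero N).le (map_add_le_add N) _ _).trans ?_
    rw [add_mul, Finset.sum_mul]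
    refine le_add_of_le_of_nonneg (Finset.sum_le_sum fun i _ => ?_) (by positivity)
    rw [map_smul_eq_mul, mul_comm]
    refine mul_le_mul_of_nonneg_left ?_ (apply_nonneg _ _)
    simpa using PiLp.norm_apply_le x i

theorem Seminorm.continuous_vec (N : Seminorm ℝ (Vec d)) : Continuous N := by
  obtain ⟨c, hc, h⟩ := N.exists_le_mul_norm
  refine (LipschitzWith.of_dist_le_mul (K := c.toNNReal) fun x y => ?_).continuous
  rw [Real.dist_eq, dist_eq_norm, Real.coe_toNNReal _ hc.le]
  exact (abs_sub_map_le_sub N x y).trans (h _)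

theorem Seminorm.exists_norm_le_mul (hN : ∀ z, N z = 0 → z = 0) :
    ∃ c : ℝ, 0 < c ∧ ∀ x, ‖x‖ ≤ c * N x := by
  rcases (Metric.sphere (0 : Vec d) 1).eq_empty_or_nonempty with h0 | h0
  · refine ⟨1, one_pos, fun x => ?_⟩
    by_cases hx : x = 0
    · simp [hx]
    · exfalso
      have : (‖x‖⁻¹ • x) ∈ Metric.sphere (0 : Vec d) 1 := by
        simp [norm_smul, hx]
      simp [h0] at this
  · obtain ⟨z, hz, hmin⟩ := (isCompact_sphere (0 : Vec d) 1).exists_isMinOn h0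
      N.continuous_vec.continuousOn
    have hz1 : ‖z‖ = 1 := by simpa using hz
    have hpos : 0 < N z := lt_of_le_of_ne (apply_nonneg _ _) fun h => by
      rw [hN z h.symm] at hz1; simp at hz1
    refine ⟨(N z)⁻¹, by positivity, fun x => ?_⟩
    by_cases hx : x = 0
    · simp [hx]
    have hxp : 0 < ‖x‖ := norm_pos_iff.2 hx
    have hm : (‖x‖⁻¹ • x) ∈ Metric.sphere (0 : Vec d) 1 := by
      simp [norm_smul, hx]
    have := hmin hm
    simp only [Set.mem_ofPred_eq, map_smul_eq_mul, norm_inv, norm_norm] at this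
    rw [inv_mul_eq_div, le_div_iff₀ hpos]
    rw [inv_mul_eq_div, le_div_iff₀ hxp] at this
    linarith

theorem inner_le_mul_dualNorm (hN : ∀ z, N z = 0 → z = 0) (u z : Vec d) :
    inner ℝ u z ≤ N u * dualNorm N z := by
  by_cases hu : N u = 0
  · simp [hN u hu]
  have hpos : 0 < N u := lt_of_le_of_ne (apply_nonneg _ _) (Ne.symm hu)
  obtain ⟨c, hc, h⟩ := Seminorm.exists_norm_le_mul hN
  have hb : BddAbove (Set.range fun u : {u : Vec d // N u ≤ 1} => inner ℝ u.1 z) := by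
    refine ⟨c * ‖z‖, ?_⟩
    rintro _ ⟨u, rfl⟩
    refine (real_inner_le_norm _ _).trans (mul_le_mul_of_nonneg_right ?_ (norm_nonneg _))
    exact (h _).trans (by nlinarith [u.2])
  have h1 : N ((N u)⁻¹ • u) ≤ 1 := by
    rw [map_smul_eq_mul, Real.norm_eq_abs, abs_of_pos (inv_pos.2 hpos), inv_mul_cancel₀ hu]
  have := le_ciSup hb ⟨(N u)⁻¹ • u, h1⟩
  simp only [real_inner_smul_left] at this
  change _ ≤ dualNorm N z at this
  rwa [inv_mul_le_iff₀ hpos] at this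

theorem abs_inner_le_mul_dualNorm (hN : ∀ z, N z = 0 → z = 0) (u z : Vec d) :
    |inner ℝ u z| ≤ N u * dualNorm N z := by
  refine abs_le'.2 ⟨inner_le_mul_dualNorm hN u z, ?_⟩
  have := inner_le_mul_dualNorm hN (-u) z
  rwa [inner_neg_left, map_neg_eq_map] at this

/-- The sampling estimate is proved without the compatibility constants; this allows them to be
inserted at the end. One nonzero vector contributes reciprocal ratios to the two suprema. For `d =
0` both suprema are empty, with value 0, hence the hypothesis. -/
theorem one_le_compatConst_mul (hN : ∀ z, N z = 0 → z = 0) (hd : 0 < d) :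
    1 ≤ compatConst₁ N * compatConst₂ N := by
  obtain ⟨c, hc, h⟩ := Seminorm.exists_norm_le_mul hN
  obtain ⟨c', hc', h'⟩ := N.exists_le_mul_norm
  let e : Vec d := EuclideanSpace.single ⟨0, hd⟩ 1
  have he : e ≠ 0 := by
    intro h0
    have : ‖e‖ = 1 := by simp [e]
    simp [h0] at this
  have hp : 0 < ‖e‖ := norm_pos_iff.2 he
  have hNp : 0 < N e := lt_of_le_of_ne (apply_nonneg _ _) fun h => he (hN e h.symm)
  have h1 : N e / ‖e‖ ≤ compatConst₁ N := by
    refine le_ciSup (f := fun x : {x : Vec d // x ≠ 0} => N x.1 / ‖x.1‖) ⟨c', ?_⟩ ⟨e, he⟩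
    rintro _ ⟨x, rfl⟩
    exact div_le_of_le_mul₀ (norm_nonneg _) hc'.le (h' _)
  have h2 : ‖e‖ / N e ≤ compatConst₂ N := by
    refine le_ciSup (f := fun x : {x : Vec d // x ≠ 0} => ‖x.1‖ / N x.1) ⟨c, ?_⟩ ⟨e, he⟩
    rintro _ ⟨x, rfl⟩
    exact div_le_of_le_mul₀ (apply_nonneg _ _) hc.le (h _)
  calc (1 : ℝ) = (N e / ‖e‖) * (‖e‖ / N e) := by field_simp
    _ ≤ _ := mul_le_mul h1 h2 (by positivity) ((by positivity : (0:ℝ) ≤ N e / ‖e‖).trans h1)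

end Norms

/-! ### Lipschitz functions -/

section Lipschitz

variable {d : ℕ} {N : Seminorm ℝ (Vec d)} {X : Set (Vec d)}

theorem lipConst_nonneg (g : X → ℝ) : 0 ≤ lipConst N g :=
  Real.iSup_nonneg fun _ => div_nonneg (abs_nonneg _) (apply_nonneg _ _)

theorem bddAbove_lipConst {g : X → ℝ} (hg : g ∈ LipClass N X) :
    BddAbove (Set.range fun p : X × X => |g p.1 - g p.2| / N (p.1.1 - p.2.1)) := by
  obtain ⟨K, hK⟩ := hg
  refine ⟨max K 0, ?_⟩
  rintro _ ⟨p, rfl⟩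
  exact div_le_of_le_mul₀ (apply_nonneg _ _) (le_max_right _ _)
    ((hK _ _).trans (mul_le_mul_of_nonneg_right (le_max_left _ _) (apply_nonneg _ _)))

theorem abs_sub_le_lipConst {g : X → ℝ} (hg : g ∈ LipClass N X) (x x' : X) :
    |g x - g x'| ≤ lipConst N g * N (x.1 - x'.1) := by
  rcases (apply_nonneg N (x.1 - x'.1)).eq_or_lt with h | h
  · obtain ⟨K, hK⟩ := hg
    have := hK x x'
    rw [← h] at this ⊢
    simpa using this
  · rw [← div_le_iff₀ h]
    exact le_ciSup (bddAbove_lipConst hg) (x, x')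

theorem lipConst_le {g : X → ℝ} {K : ℝ} (hK : 0 ≤ K)
    (h : ∀ x x' : X, |g x - g x'| ≤ K * N (x.1 - x'.1)) : lipConst N g ≤ K :=
  Real.iSup_le (fun p => div_le_of_le_mul₀ (apply_nonneg _ _) hK (h p.1 p.2)) hK

theorem lipConst_add_le {g h : X → ℝ} (hg : g ∈ LipClass N X) (hh : h ∈ LipClass N X) :
    lipConst N (g + h) ≤ lipConst N g + lipConst N h := by
  refine lipConst_le (add_nonneg (lipConst_nonneg _) (lipConst_nonneg _)) fun x x' => ?_
  have e : (g + h) x - (g + h) x' = (g x - g x') + (h x - h x') := by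
    simp only [Pi.add_apply]; ring
  rw [e, add_mul]
  exact (abs_add_le _ _).trans (add_le_add (abs_sub_le_lipConst hg x x') (abs_sub_le_lipConst hh x x'))

theorem lipConst_smul_le (c : ℝ) {g : X → ℝ} (hg : g ∈ LipClass N X) :
    lipConst N (c • g) ≤ |c| * lipConst N g := by
  refine lipConst_le (mul_nonneg (abs_nonneg _) (lipConst_nonneg _)) fun x x' => ?_
  have e : (c • g) x - (c • g) x' = c * (g x - g x') := by
    simp only [Pi.smul_apply, smul_eq_mul]; ring
  rw [e, abs_mul, mul_assoc]
  exact mul_le_mul_of_nonneg_left (abs_sub_le_lipConst hg x x') (abs_nonneg c)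

theorem lipConst_neg (g : X → ℝ) : lipConst N (-g) = lipConst N g := by
  unfold lipConst
  congr 1 with p
  rw [Pi.neg_apply, Pi.neg_apply, neg_sub_neg, abs_sub_comm]

theorem continuous_of_abs_sub_le {g : X → ℝ} {K : ℝ}
    (h : ∀ x x' : X, |g x - g x'| ≤ K * N (x.1 - x'.1)) : Continuous g := by
  obtain ⟨c, hc, hN⟩ := N.exists_le_mul_norm
  refine (LipschitzWith.of_dist_le_mul (K := (max K 0 * c).toNNReal) fun x y => ?_).continuous
  rw [Real.dist_eq, Subtype.dist_eq, dist_eq_norm]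
  calc _ ≤ K * N (x.1 - y.1) := h x y
    _ ≤ max K 0 * N (x.1 - y.1) := mul_le_mul_of_nonneg_right (le_max_left _ _) (apply_nonneg _ _)
    _ ≤ max K 0 * (c * ‖x.1 - y.1‖) := mul_le_mul_of_nonneg_left (hN _) (le_max_right _ _)
    _ = _ := by rw [Real.coe_toNNReal _ (by positivity), mul_assoc]

theorem continuous_lipClass (g : LipClass N X) : Continuous g.1 := by
  obtain ⟨K, hK⟩ := g.2
  exact continuous_of_abs_sub_le hK

theorem measurable_lipClass_iff {Ω : Type*} [MeasurableSpace Ω] {φ : Ω → LipClass N X} :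
    Measurable φ ↔ ∀ x, Measurable fun ω => (φ ω).1 x := by
  rw [← measurable_pi_iff]
  exact ⟨fun h => measurable_subtype_coe.comp h, fun h => Measurable.subtype_mk h⟩

theorem measurable_lipClass_eval (x : X) : Measurable fun g : LipClass N X => g.1 x :=
  measurable_lipClass_iff.1 measurable_id x

theorem measurable_lipClass_eval₂ :
    Measurable fun p : LipClass N X × X => p.1.1 p.2 := by
  have := measurable_uncurry_of_continuous_of_measurable (u := fun (x : X) (g : LipClass N X) => g.1 x)
    (fun g => continuous_lipClass g) measurable_lipClass_eval
  exact this.comp measurable_swap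

theorem measurable_lipClass_sub :
    Measurable fun p : LipClass N X × LipClass N X => p.1 - p.2 :=
  measurable_lipClass_iff.2 fun x =>
    ((measurable_lipClass_eval x).comp measurable_fst).sub
      ((measurable_lipClass_eval x).comp measurable_snd)

theorem Continuous.integrable_of_compactSpace {α : Type*} [TopologicalSpace α] [CompactSpace α]
    [MeasurableSpace α] [OpensMeasurableSpace α] {g : α → ℝ} (hg : Continuous g) (P : Measure α)
    [IsFiniteMeasure P] : Integrable g P :=
  hg.integrable_of_hasCompactSupport (HasCompactSupport.of_compactSpace g)

end Lipschitz

/-! ### The integral probability metric -/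

section Ipm

variable {d : ℕ} {N : Seminorm ℝ (Vec d)} {X : Set (Vec d)}

theorem abs_integral_sub_const_le {α : Type*} [MeasurableSpace α] {P : Measure α}
    [IsProbabilityMeasure P] {k : α → ℝ} (hk : Integrable k P) {c R : ℝ}
    (h : ∀ x, |k x - c| ≤ R) : |∫ x, k x ∂P - c| ≤ R := by
  have e : ∫ x, k x ∂P - c = ∫ x, (k x - c) ∂P := by
    rw [integral_sub hk (integrable_const _)]; simp
  rw [e]
  have := norm_integral_le_of_norm_le_const (μ := P) (f := fun x => k x - c) (C := R)
    (Filter.Eventually.of_forall h)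
  simpa using this

theorem abs_integral_sub_integral_le {α : Type*} [Nonempty α] [MeasurableSpace α] {P Q : Measure α}
    [IsProbabilityMeasure P] [IsProbabilityMeasure Q] {k : α → ℝ} (hP : Integrable k P)
    (hQ : Integrable k Q) {R : ℝ} (h : ∀ x x', |k x - k x'| ≤ R) :
    |∫ x, k x ∂P - ∫ x, k x ∂Q| ≤ 2 * R := by
  obtain ⟨x₀⟩ := ‹Nonempty α›
  have h1 := abs_integral_sub_const_le hP (c := k x₀) fun x => h x x₀
  have h2 := abs_integral_sub_const_le hQ (c := k x₀) fun x => h x x₀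
  rw [abs_le] at *
  constructor <;> linarith

theorem exists_forall_seminorm_sub_le (N : Seminorm ℝ (Vec d)) (X : Set (Vec d)) [CompactSpace X] :
    ∃ R : ℝ, 0 ≤ R ∧ ∀ x x' : X, N (x.1 - x'.1) ≤ R := by
  have hc : Continuous fun p : X × X => N (p.1.1 - p.2.1) :=
    N.continuous_vec.comp (by fun_prop)
  obtain ⟨R, hR⟩ := (isCompact_range hc).bddAbove
  exact ⟨max R 0, le_max_right _ _, fun x x' =>
    (hR ⟨(x, x'), rfl⟩).trans (le_max_left _ _)⟩

theorem ipm_nonneg (P Q : Measure X) : 0 ≤ ipm N P Q := Real.iSup_nonneg fun _ => abs_nonneg _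

theorem ipmDiam_nonneg : 0 ≤ ipmDiam N X := Real.iSup_nonneg fun _ => ipm_nonneg _ _

variable [CompactSpace X]

theorem abs_integral_sub_integral_le_of_lipConst_le_one {P Q : Measure X} [IsProbabilityMeasure P]
    [IsProbabilityMeasure Q] {R : ℝ} (hR : ∀ x x' : X, N (x.1 - x'.1) ≤ R)
    (g : {g : LipClass N X // lipConst N g.1 ≤ 1}) :
    |∫ x, g.1.1 x ∂P - ∫ x, g.1.1 x ∂Q| ≤ 2 * R := by
  have : Nonempty X := nonempty_of_isProbabilityMeasure P
  refine abs_integral_sub_integral_le ((continuous_lipClass g.1).integrable_of_compactSpace _)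
    ((continuous_lipClass g.1).integrable_of_compactSpace _) fun x x' => ?_
  calc _ ≤ lipConst N g.1.1 * N (x.1 - x'.1) := abs_sub_le_lipConst g.1.2 x x'
    _ ≤ 1 * N (x.1 - x'.1) := mul_le_mul_of_nonneg_right g.2 (apply_nonneg _ _)
    _ ≤ R := by rw [one_mul]; exact hR x x'

theorem bddAbove_ipm (P Q : Measure X) [IsProbabilityMeasure P] [IsProbabilityMeasure Q] :
    BddAbove (Set.range fun g : {g : LipClass N X // lipConst N g.1 ≤ 1} =>
      |∫ x, g.1.1 x ∂P - ∫ x, g.1.1 x ∂Q|) := by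
  obtain ⟨R, -, hR⟩ := exists_forall_seminorm_sub_le N X
  refine ⟨2 * R, ?_⟩
  rintro _ ⟨g, rfl⟩
  exact abs_integral_sub_integral_le_of_lipConst_le_one hR g

theorem ipm_le_ipmDiam (P Q : Measure X) [IsProbabilityMeasure P] [IsProbabilityMeasure Q] :
    ipm N P Q ≤ ipmDiam N X := by
  obtain ⟨R, hR0, hR⟩ := exists_forall_seminorm_sub_le N X
  refine le_ciSup (f := fun R : ProbabilityMeasure X × ProbabilityMeasure X =>
    ipm N (R.1 : Measure X) (R.2 : Measure X)) ⟨2 * R, ?_⟩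
    ((⟨P, inferInstance⟩ : ProbabilityMeasure X), (⟨Q, inferInstance⟩ : ProbabilityMeasure X))
  rintro _ ⟨R, rfl⟩
  exact Real.iSup_le (fun g => abs_integral_sub_integral_le_of_lipConst_le_one hR g) (by positivity)

theorem abs_integral_sub_integral_le_ipm {P Q : Measure X} [IsProbabilityMeasure P]
    [IsProbabilityMeasure Q] {k : X → ℝ} {κ : ℝ} (hκ : 0 ≤ κ)
    (hk : ∀ x x' : X, |k x - k x'| ≤ κ * N (x.1 - x'.1)) :
    |∫ x, k x ∂P - ∫ x, k x ∂Q| ≤ κ * ipm N P Q := by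
  -- Dividing by κ itself would fail for κ = 0, so the function is normalised by a larger κ', which
  -- then decreases to κ.
  have hmain : ∀ κ' : ℝ, κ < κ' → |∫ x, k x ∂P - ∫ x, k x ∂Q| ≤ κ' * ipm N P Q := by
    intro κ' hκ'
    have hpos : 0 < κ' := hκ.trans_lt hκ'
    have hb : ∀ x x' : X, |(κ'⁻¹ • k) x - (κ'⁻¹ • k) x'| ≤ 1 * N (x.1 - x'.1) := fun x x' => by
      have e : (κ'⁻¹ • k) x - (κ'⁻¹ • k) x' = κ'⁻¹ * (k x - k x') := by
        simp only [Pi.smul_apply, smul_eq_mul]; ring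
      rw [e, abs_mul, abs_of_pos (inv_pos.2 hpos), inv_mul_le_iff₀ hpos, one_mul]
      exact (hk x x').trans (mul_le_mul_of_nonneg_right hκ'.le (apply_nonneg _ _))
    have := le_ciSup (bddAbove_ipm (N := N) P Q) ⟨⟨κ'⁻¹ • k, 1, hb⟩, lipConst_le zero_le_one hb⟩
    change _ ≤ ipm N P Q at this
    simp only [Pi.smul_apply, smul_eq_mul, integral_const_mul] at this
    rwa [← mul_sub, abs_mul, abs_of_pos (inv_pos.2 hpos), inv_mul_le_iff₀ hpos] at this
  refine le_of_forall_pos_le_add fun δ hδ => ?_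
  have h := ipm_nonneg (N := N) P Q
  have hp : 0 < ipm N P Q + 1 := by linarith
  refine (hmain (κ + δ / (ipm N P Q + 1)) (by linarith [div_pos hδ hp])).trans ?_
  rw [add_mul, div_mul_eq_mul_div]
  gcongr
  rw [div_le_iff₀ hp]
  nlinarith

theorem abs_integral_sub_integral_le_lipConst_mul_ipm {P Q : Measure X} [IsProbabilityMeasure P]
    [IsProbabilityMeasure Q] (k : LipClass N X) :
    |∫ x, k.1 x ∂P - ∫ x, k.1 x ∂Q| ≤ lipConst N k.1 * ipm N P Q :=
  abs_integral_sub_integral_le_ipm (lipConst_nonneg _) (abs_sub_le_lipConst k.2)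

/-- Two Dirac masses, tested against the distance to one of the two points, are already this far
apart. Thus D also bounds the diameter of the set. -/
theorem seminorm_sub_le_ipmDiam (x x' : X) : N (x.1 - x'.1) ≤ ipmDiam N X := by
  refine le_trans ?_ (ipm_le_ipmDiam (N := N) (Measure.dirac x) (Measure.dirac x'))
  have := abs_integral_sub_integral_le_ipm (N := N) (P := Measure.dirac x) (Q := Measure.dirac x')
    (k := fun z => N (z.1 - x'.1)) zero_le_one fun z z' => by
      rw [one_mul]
      refine (abs_sub_map_le_sub N _ _).trans ?_
      rw [sub_sub_sub_cancel_right]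
  simpa [integral_dirac, abs_of_nonneg (apply_nonneg N _)] using this

end Ipm

/-! ### Measurable selection of unique minimizers -/

section Argmin

open Filter Topology

/-- The indices of a dense sequence at which `h` is minimal along the sequence up to
`1 / (j + 1)`. -/
def nearMin {α : Type*} (q : ℕ → α) (h : α → ℝ) (j n : ℕ) : Prop :=
  ∀ i, h (q n) ≤ h (q i) + 1 / (j + 1)

theorem nearMin_of_dist {α : Type*} {q : ℕ → α} {h : α → ℝ} {x : α} (hx : ∀ x', h x ≤ h x') {j n : ℕ}
    (hn : |h (q n) - h x| < 1 / (j + 1)) : nearMin q h j n := fun i => by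
  have := hx (q i)
  have := (abs_lt.1 hn).2
  linarith

variable {α : Type*} [MetricSpace α] {q : ℕ → α}

theorem exists_nearMin_dist_lt (hq : DenseRange q) {h : α → ℝ} (hc : Continuous h) {x : α}
    (hx : ∀ x', h x ≤ h x') (j : ℕ) {δ : ℝ} (hδ : 0 < δ) :
    ∃ n, nearMin q h j n ∧ dist (q n) x < δ := by
  have h1 : ∀ᶠ y in 𝓝 x, |h y - h x| < 1 / ((j : ℝ) + 1) :=
    (Metric.tendsto_nhds.1 hc.continuousAt) _ (by positivity)
  have h2 : ∀ᶠ y in 𝓝 x, dist y x < δ := Metric.ball_mem_nhds x hδ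
  obtain ⟨n, hn⟩ := hq.exists_mem_open isOpen_interior
    ⟨x, mem_interior_iff_mem_nhds.2 (h1.and h2)⟩
  have hn' := interior_subset hn
  exact ⟨n, nearMin_of_dist hx hn'.1, hn'.2⟩

/-- Near-minimality is tested only along the sequence, to be a countable and hence measurable
condition; density and continuity extend it to all points. -/
theorem le_add_of_nearMin (hq : DenseRange q) {h : α → ℝ} (hc : Continuous h) {j n : ℕ}
    (hn : nearMin q h j n) (y : α) : h (q n) ≤ h y + 1 / (j + 1) := by
  have : IsClosed {y | h (q n) ≤ h y + 1 / ((j : ℝ) + 1)} :=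
    isClosed_le continuous_const (hc.add continuous_const)
  exact hq.induction_on (p := fun y => h (q n) ≤ h y + 1 / ((j : ℝ) + 1)) y this hn

/-- A minimizer is the limit of the first near-minimal points of a dense sequence, provided that the
sets of near-minimal points shrink to diameter 0. This condition is measurable and, by compactness,
holds when the minimizer is unique; elsewhere the selection is constant. -/
theorem exists_measurable_argmin [CompactSpace α] [Nonempty α] [MeasurableSpace α] [BorelSpace α] {Λ : Type*}
    [MeasurableSpace Λ] (ev : Λ → α → ℝ) (hc : ∀ l, Continuous (ev l))
    (hm : ∀ x, Measurable fun l => ev l x) :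
    ∃ (s : Λ → α) (U : Set Λ), Measurable s ∧ MeasurableSet U ∧
      (∀ l, (∃! x, ∀ x', ev l x ≤ ev l x') → l ∈ U) ∧
      ∀ l ∈ U, ∀ x, (∀ x', ev l x ≤ ev l x') ↔ x = s l := by
  classical
  set q : ℕ → α := TopologicalSpace.denseSeq α
  have hq : DenseRange q := TopologicalSpace.denseRange_denseSeq α
  have hmin : ∀ l, ∃ x, ∀ x', ev l x ≤ ev l x' := fun l => by
    obtain ⟨x, hx⟩ := (hc l).exists_forall_le_of_isBounded (Classical.arbitrary α)
      ((isCompact_univ.isBounded).subset (Set.subset_univ _))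
    exact ⟨x, hx⟩
  choose z hz using hmin
  have hnear : ∀ j n, MeasurableSet {l | nearMin q (ev l) j n} := fun j n => by
    simp only [nearMin, Set.ofPred_forall]
    exact MeasurableSet.iInter fun i =>
      measurableSet_le (hm _) ((hm _).add measurable_const)
  have hex : ∀ j l, ∃ n, nearMin q (ev l) j n := fun j l =>
    (exists_nearMin_dist_lt hq (hc l) (hz l) j one_pos).imp fun _ h => h.1
  let a : ℕ → Λ → ℕ := fun j l => Nat.find (hex j l)
  have ha : ∀ j, Measurable (a j) := fun j => measurable_find (hex j) (hnear j)
  have ha' : ∀ j l, nearMin q (ev l) j (a j l) := fun j l => Nat.find_spec (hex j l)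
  let U : Set Λ := {l | ∀ k : ℕ, ∃ j, ∀ n n', nearMin q (ev l) j n → nearMin q (ev l) j n' →
    dist (q n) (q n') ≤ 1 / ((k : ℝ) + 1)}
  have hU : MeasurableSet U := by
    simp only [U, Set.ofPred_forall, Set.ofPred_exists]
    refine MeasurableSet.iInter fun k => MeasurableSet.iUnion fun j =>
      MeasurableSet.iInter fun n => MeasurableSet.iInter fun n' => ?_
    exact (hnear j n).imp ((hnear j n').imp (MeasurableSet.const _))
  have hconv : ∀ l ∈ U, ∀ x, (∀ x', ev l x ≤ ev l x') →
      Tendsto (fun j => q (a j l)) atTop (𝓝 x) := by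
    intro l hl x hx
    refine Metric.tendsto_atTop.2 fun ε hε => ?_
    obtain ⟨k, hk⟩ := exists_nat_one_div_lt (half_pos hε)
    obtain ⟨j, hj⟩ := hl k
    refine ⟨j, fun i hi => ?_⟩
    obtain ⟨n, hn, hnx⟩ := exists_nearMin_dist_lt hq (hc l) hx j (half_pos hε)
    -- The tolerance decreases with the index, so near-minimality at stage i implies it at the
    -- earlier stage j.
    have hi' : nearMin q (ev l) j (a i l) := fun i' => by
      refine (ha' i l i').trans ?_
      gcongr
    linarith [dist_triangle (q (a i l)) (q n) x, hj _ _ hi' hn]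
  refine ⟨fun l => if l ∈ U then z l else Classical.arbitrary α, U, ?_, hU, ?_, ?_⟩
  · refine measurable_of_tendsto_metrizable
      (f := fun j l => if l ∈ U then q (a j l) else Classical.arbitrary α) (fun j => ?_) ?_
    · exact Measurable.ite hU ((measurable_from_nat (f := q)).comp (ha j)) measurable_const
    · refine tendsto_pi_nhds.2 fun l => ?_
      by_cases hl : l ∈ U
      · simpa [hl] using hconv l hl _ (hz l)
      · simp [hl]
  · rintro l ⟨x, hx, huniq⟩ k
    have hδ : (0 : ℝ) < 1 / ((k : ℝ) + 1) / 2 := by positivity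
    set δ : ℝ := 1 / ((k : ℝ) + 1) / 2 with hδdef
    -- Off the ball the minimum over a compact set exceeds the global minimum by uniqueness; a
    -- tolerance below this gap forces near-minimal points into the ball.
    have hj : ∃ j, ∀ n, nearMin q (ev l) j n → dist (q n) x < δ := by
      rcases (Metric.ball x δ)ᶜ.eq_empty_or_nonempty with h0 | h0
      · refine ⟨0, fun n _ => ?_⟩
        have : q n ∈ Metric.ball x δ := by
          rw [Set.compl_empty_iff.1 h0]; trivial
        exact this
      · obtain ⟨y, hy, hymin⟩ := (Metric.isOpen_ball.isClosed_compl.isCompact).exists_isMinOn h0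
          (hc l).continuousOn
        have hlt : ev l x < ev l y := by
          refine lt_of_le_of_ne (hx y) fun h => ?_
          have : y = x := huniq y fun x' => h ▸ hx x'
          exact hy (this ▸ Metric.mem_ball_self hδ)
        obtain ⟨j, hj⟩ := exists_nat_one_div_lt (sub_pos.2 hlt)
        refine ⟨j, fun n hn => ?_⟩
        by_contra hcon
        have h1 : ev l y ≤ ev l (q n) := hymin (show q n ∈ (Metric.ball x δ)ᶜ from hcon)
        have h2 := le_add_of_nearMin hq (hc l) hn x
        linarith
    obtain ⟨j, hj⟩ := hj
    refine ⟨j, fun n n' hn hn' => ?_⟩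
    have := dist_triangle_right (q n) (q n') x
    linarith [hj n hn, hj n' hn']
  · intro l hl x
    simp only [hl, if_true]
    refine ⟨fun hx => tendsto_nhds_unique (hconv l hl x hx) (hconv l hl _ (hz l)), ?_⟩
    rintro rfl
    exact hz l

end Argmin

/-! ### Minimizers of perturbed Lipschitz functions -/

section Selection

variable {d : ℕ} {N : Seminorm ℝ (Vec d)} {X : Set (Vec d)}

theorem measurable_sub_left (g : LipClass N X) : Measurable fun σ : LipClass N X => g - σ :=
  measurable_lipClass_sub.comp (measurable_const.prodMk measurable_id)

variable [CompactSpace X] [Nonempty X]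

theorem exists_measurable_argmin_lipClass (N : Seminorm ℝ (Vec d)) (X : Set (Vec d))
    [CompactSpace X] [Nonempty X] :
    ∃ (s : LipClass N X → X) (U : Set (LipClass N X)), Measurable s ∧ MeasurableSet U ∧
      (∀ l : LipClass N X, (∃! x, ∀ x', l.1 x ≤ l.1 x') → l ∈ U) ∧
      ∀ l ∈ U, ∀ x, (∀ x', l.1 x ≤ l.1 x') ↔ x = s l :=
  exists_measurable_argmin (fun l : LipClass N X => l.1) continuous_lipClass measurable_lipClass_eval

/-- A measurable function that maps a Lipschitz function with a unique minimizer to it. -/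
noncomputable def argminSel (g : LipClass N X) : X :=
  (exists_measurable_argmin_lipClass N X).choose g

/-- The Lipschitz functions that have a unique minimizer. -/
def uniqueMin (N : Seminorm ℝ (Vec d)) (X : Set (Vec d)) [CompactSpace X] [Nonempty X] :
    Set (LipClass N X) :=
  (exists_measurable_argmin_lipClass N X).choose_spec.choose

theorem measurable_argminSel : Measurable (argminSel : LipClass N X → X) :=
  (exists_measurable_argmin_lipClass N X).choose_spec.choose_spec.1

theorem measurableSet_uniqueMin : MeasurableSet (uniqueMin N X) :=
  (exists_measurable_argmin_lipClass N X).choose_spec.choose_spec.2.1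

theorem isPerturbedMin_iff {g σ : LipClass N X} (h : g - σ ∈ uniqueMin N X) (x : X) :
    IsPerturbedMin g.1 σ.1 x ↔ x = argminSel (g - σ) :=
  (exists_measurable_argmin_lipClass N X).choose_spec.choose_spec.2.2.2 _ h x

theorem sub_mem_uniqueMin {g σ : LipClass N X} (h : ∃! x, IsPerturbedMin g.1 σ.1 x) :
    g - σ ∈ uniqueMin N X :=
  (exists_measurable_argmin_lipClass N X).choose_spec.choose_spec.2.2.1 _ h

/-- For every Lipschitz function `g`, the perturbed problem `min (g - σ)` has almost surely a
unique solution. -/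
class HasUniqueMin (P : Measure (LipClass N X)) : Prop where
  ae_mem : ∀ g : LipClass N X, ∀ᵐ σ ∂P, g - σ ∈ uniqueMin N X

/-- The choice made by `Classical.epsilon` need not be measurable, but almost surely there is only
one minimizer to choose, so it may be replaced by the measurable selection. -/
theorem minLaw_eq_map {P : Measure (LipClass N X)} (hP : HasUniqueMin P) (g : LipClass N X) :
    minLaw P g = P.map fun σ => argminSel (g - σ) := by
  refine Measure.map_congr ?_
  filter_upwards [hP.ae_mem g] with σ hσ
  have hex : ∃ x, IsPerturbedMin g.1 σ.1 x := ⟨_, (isPerturbedMin_iff hσ _).2 rfl⟩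
  exact (isPerturbedMin_iff hσ _).1 (Classical.epsilon_spec hex)

instance isProbabilityMeasure_minLaw {P : Measure (LipClass N X)} [IsProbabilityMeasure P]
    [hP : HasUniqueMin P] (g : LipClass N X) : IsProbabilityMeasure (minLaw P g) := by
  rw [minLaw_eq_map hP]
  exact Measure.isProbabilityMeasure_map
    (measurable_argminSel.comp (measurable_sub_left g)).aemeasurable

theorem integral_minLaw {P : Measure (LipClass N X)} (hP : HasUniqueMin P) (g : LipClass N X)
    {k : X → ℝ} (hk : Continuous k) :
    ∫ x, k x ∂minLaw P g = ∫ σ, k (argminSel (g - σ)) ∂P := by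
  rw [minLaw_eq_map hP]
  exact integral_map (measurable_argminSel.comp (measurable_sub_left g)).aemeasurable
    hk.aestronglyMeasurable

end Selection

/-! ### The potential of the perturbed leader -/

section Potential

variable {d : ℕ} {N : Seminorm ℝ (Vec d)} {X : Set (Vec d)} [CompactSpace X] [Nonempty X]

/-- The expected minimum of `g - σ`, with `σ` normalised to vanish at `x₀`. -/
noncomputable def potential (P : Measure (LipClass N X)) (x₀ : X) (g : LipClass N X) : ℝ :=
  ∫ σ, (g.1 (argminSel (g - σ)) - σ.1 (argminSel (g - σ)) + σ.1 x₀) ∂P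

variable {P : Measure (LipClass N X)}

theorem measurable_apply_argminSel (g h : LipClass N X) :
    Measurable fun σ : LipClass N X => h.1 (argminSel (g - σ)) :=
  (continuous_lipClass h).measurable.comp (measurable_argminSel.comp (measurable_sub_left g))

omit [Nonempty X] in
theorem exists_abs_le_lipClass (h : LipClass N X) : ∃ R, ∀ x, |h.1 x| ≤ R := by
  obtain ⟨R, hR⟩ := (isCompact_range (continuous_lipClass h).abs).bddAbove
  exact ⟨R, fun x => hR ⟨x, rfl⟩⟩

theorem integrable_apply_argminSel [IsFiniteMeasure P] (g h : LipClass N X) :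
    Integrable (fun σ : LipClass N X => h.1 (argminSel (g - σ))) P := by
  obtain ⟨R, hR⟩ := exists_abs_le_lipClass h
  exact Integrable.of_bound (measurable_apply_argminSel g h).aestronglyMeasurable R
    (Filter.Eventually.of_forall fun σ => hR _)

theorem integrable_potential [IsFiniteMeasure P]
    (hint : Integrable (fun σ : LipClass N X => lipConst N σ.1) P) (x₀ : X) (g : LipClass N X) :
    Integrable (fun σ : LipClass N X =>
      g.1 (argminSel (g - σ)) - σ.1 (argminSel (g - σ)) + σ.1 x₀) P := by
  have hm : Measurable fun σ : LipClass N X => σ.1 (argminSel (g - σ)) :=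
    measurable_lipClass_eval₂.comp
      (measurable_id.prodMk (measurable_argminSel.comp (measurable_sub_left g)))
  have h2 : Integrable (fun σ : LipClass N X => σ.1 x₀ - σ.1 (argminSel (g - σ))) P := by
    refine (hint.mul_const (ipmDiam N X)).mono'
      ((measurable_lipClass_eval x₀).sub hm).aestronglyMeasurable
      (Filter.Eventually.of_forall fun σ => ?_)
    exact (abs_sub_le_lipConst σ.2 _ _).trans
      (mul_le_mul_of_nonneg_left (seminorm_sub_le_ipmDiam _ _) (lipConst_nonneg _))
  refine ((integrable_apply_argminSel g g).add h2).congr (Filter.Eventually.of_forall fun σ => ?_)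
  simp only [Pi.add_apply]
  ring

/-- The minimizer for g − σ is a competitor in the problem h − σ; averaging over σ gives the
supergradient inequality. -/
theorem potential_le [IsFiniteMeasure P] (hP : HasUniqueMin P)
    (hint : Integrable (fun σ : LipClass N X => lipConst N σ.1) P) (x₀ : X) (g h : LipClass N X) :
    potential P x₀ h ≤ potential P x₀ g + ∫ x, (h - g).1 x ∂minLaw P g := by
  rw [integral_minLaw hP g (continuous_lipClass _), potential, potential,
    ← integral_add (integrable_potential hint x₀ g) (integrable_apply_argminSel g _)]
  refine integral_mono_ae (integrable_potential hint x₀ h)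
    ((integrable_potential hint x₀ g).add (integrable_apply_argminSel g _)) ?_
  filter_upwards [hP.ae_mem h] with σ hσ
  have h1 := (isPerturbedMin_iff hσ _).2 rfl (argminSel (g - σ))
  have h2 : (h - g).1 (argminSel (g - σ)) = h.1 (argminSel (g - σ)) - g.1 (argminSel (g - σ)) := rfl
  rw [h2]
  linarith

theorem potential_le_integral [IsProbabilityMeasure P] (hP : HasUniqueMin P)
    (hint : Integrable (fun σ : LipClass N X => lipConst N σ.1) P) (x₀ : X) (g : LipClass N X) :
    potential P x₀ g ≤ g.1 x₀ := by
  have : g.1 x₀ = ∫ _, g.1 x₀ ∂P := by simp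
  rw [this]
  refine integral_mono_ae (integrable_potential hint x₀ g) (integrable_const _) ?_
  filter_upwards [hP.ae_mem g] with σ hσ
  have h1 := (isPerturbedMin_iff hσ _).2 rfl x₀
  linarith

/-- With zero loss, the normalised minimum is the difference of σ at two points, at least −‖σ‖ times
the diameter. This is the source of the term ηD in the regret. -/
theorem neg_le_potential_zero [IsProbabilityMeasure P]
    (hint : Integrable (fun σ : LipClass N X => lipConst N σ.1) P) (x₀ : X) :
    -((∫ σ : LipClass N X, lipConst N σ.1 ∂P) * ipmDiam N X) ≤ potential P x₀ 0 := by
  rw [← integral_mul_const, ← integral_neg]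
  refine integral_mono (hint.mul_const _).neg (integrable_potential hint x₀ 0) fun σ => ?_
  have h1 := (abs_le.1 (abs_sub_le_lipConst σ.2 x₀ (argminSel (0 - σ)))).1
  have h2 := mul_le_mul_of_nonneg_left (seminorm_sub_le_ipmDiam (N := N) x₀ (argminSel (0 - σ)))
    (lipConst_nonneg (N := N) σ.1)
  have h3 : (0 : LipClass N X).1 (argminSel (0 - σ)) = 0 := rfl
  simp only [h3]
  linarith

variable [IsProbabilityMeasure P]

theorem integral_minLaw_ge {β : ℝ} (hP : HasUniqueMin P)
    (hstab : IsStablePrediction N (minLaw P) β) (g h k : LipClass N X) :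
    ∫ x, k.1 x ∂minLaw P h - β * lipConst N (g - h).1 * lipConst N k.1 ≤ ∫ x, k.1 x ∂minLaw P g := by
  have h1 := (abs_le.1 (abs_integral_sub_integral_le_lipConst_mul_ipm
    (P := minLaw P g) (Q := minLaw P h) k)).1
  have h2 := mul_le_mul_of_nonneg_left (hstab g h) (lipConst_nonneg (N := N) k.1)
  linarith

/-- The step k is split into two halves, each estimated by the supergradient at its far end;
stability compares these supergradients with the one at h. The losses ½β‖k‖² and ¼β‖k‖² add up to
the constant 3/4. Integrating along the segment would give 1/2, but two steps suffice and need no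
calculus. -/
theorem potential_add_ge {β : ℝ} (hβ : 0 ≤ β) (hP : HasUniqueMin P)
    (hint : Integrable (fun σ : LipClass N X => lipConst N σ.1) P)
    (hstab : IsStablePrediction N (minLaw P) β) (x₀ : X) (h k : LipClass N X) :
    potential P x₀ h + ∫ x, k.1 x ∂minLaw P h - 3 / 4 * β * lipConst N k.1 ^ 2
      ≤ potential P x₀ (h + k) := by
  set l : LipClass N X := (1 / 2 : ℝ) • k with hl
  have hk : k = l + l := by rw [hl, ← add_smul]; norm_num
  have hlip : lipConst N l.1 ≤ lipConst N k.1 / 2 := by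
    refine (lipConst_smul_le (1 / 2 : ℝ) k.2).trans (le_of_eq ?_)
    rw [abs_of_pos (by norm_num)]; ring
  have hkl : ∫ x, k.1 x ∂minLaw P h = 2 * ∫ x, l.1 x ∂minLaw P h := by
    rw [← integral_const_mul]
    refine integral_congr_ae (Filter.Eventually.of_forall fun x => ?_)
    change k.1 x = 2 * ((1 / 2 : ℝ) * k.1 x)
    ring
  have hneg : ∀ g, ∫ x, (-l).1 x ∂minLaw P g = - ∫ x, l.1 x ∂minLaw P g := fun g =>
    integral_neg (f := l.1)
  have e1 : h + l - (h + k) = -l := by rw [hk]; abel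
  have e2 : h - (h + l) = -l := by abel
  have h1 := potential_le hP hint x₀ (h + k) (h + l)
  have h2 := potential_le hP hint x₀ (h + l) h
  rw [e1, hneg] at h1
  rw [e2, hneg] at h2
  have h3 := integral_minLaw_ge hP hstab (h + k) h l
  have h4 := integral_minLaw_ge hP hstab (h + l) h l
  rw [add_sub_cancel_left] at h3 h4
  have h0 := lipConst_nonneg (N := N) l.1
  have h5 : β * lipConst N k.1 * lipConst N l.1 ≤ β * lipConst N k.1 * (lipConst N k.1 / 2) :=
    mul_le_mul_of_nonneg_left hlip (mul_nonneg hβ (lipConst_nonneg _))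
  have h6 : β * lipConst N l.1 * lipConst N l.1 ≤ β * (lipConst N k.1 / 2) * (lipConst N k.1 / 2) := by
    rw [mul_assoc, mul_assoc]
    exact mul_le_mul_of_nonneg_left (mul_le_mul hlip hlip h0 (h0.trans hlip)) hβ
  rw [hkl]
  nlinarith

/-- Φ(h + s•k) is bounded below by the quadratic bound at h and above by the supergradient at g. If
k nearly attains the metric distance of the two laws, comparing the bounds shows that the plain
supergradient inequality has this much slack. -/
theorem potential_le_sub_ipm_sq {β : ℝ} (hβ : 0 ≤ β) (hP : HasUniqueMin P)
    (hint : Integrable (fun σ : LipClass N X => lipConst N σ.1) P)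
    (hstab : IsStablePrediction N (minLaw P) β) (x₀ : X) (g h : LipClass N X) :
    potential P x₀ h ≤ potential P x₀ g + ∫ x, (h - g).1 x ∂minLaw P g
      - ipm N (minLaw P g) (minLaw P h) ^ 2 / (3 * β) := by
  -- For β = 0 the quotient is 0 by convention and the plain inequality suffices.
  rcases hβ.eq_or_lt with rfl | hβ
  · simpa using potential_le hP hint x₀ g h
  set γ := ipm N (minLaw P g) (minLaw P h) with hγ
  have hγ0 : 0 ≤ γ := ipm_nonneg _ _
  -- This s maximises sγ − ¾βs², with maximum γ²/(3β).
  set s : ℝ := 2 * γ / (3 * β) with hs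
  have hs0 : 0 ≤ s := by positivity
  set A := potential P x₀ g + ∫ x, (h - g).1 x ∂minLaw P g - potential P x₀ h with hA
  -- the descent inequality in the direction `k`
  have key : ∀ k : LipClass N X, lipConst N k.1 ≤ 1 →
      s * (∫ x, k.1 x ∂minLaw P h - ∫ x, k.1 x ∂minLaw P g) ≤ A + 3 / 4 * β * s ^ 2 := by
    intro k hk
    have h1 := potential_add_ge hβ.le hP hint hstab x₀ h (s • k)
    have h2 := potential_le hP hint x₀ g (h + s • k)
    have e : ∫ x, (h + s • k - g).1 x ∂minLaw P g
        = ∫ x, (h - g).1 x ∂minLaw P g + s * ∫ x, k.1 x ∂minLaw P g := by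
      rw [← integral_const_mul, ← integral_add
        ((continuous_lipClass (h - g)).integrable_of_compactSpace _)
        (((continuous_lipClass k).integrable_of_compactSpace _).const_mul _)]
      refine integral_congr_ae (Filter.Eventually.of_forall fun x => ?_)
      change h.1 x + s * k.1 x - g.1 x = h.1 x - g.1 x + s * k.1 x
      ring
    have e' : ∫ x, (s • k).1 x ∂minLaw P h = s * ∫ x, k.1 x ∂minLaw P h :=
      integral_const_mul s k.1
    have h3 : lipConst N (s • k).1 ≤ s := by
      refine (lipConst_smul_le s k.2).trans ?_
      rw [abs_of_nonneg hs0]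
      exact mul_le_of_le_one_right hs0 hk
    have h4 : 3 / 4 * β * lipConst N (s • k).1 ^ 2 ≤ 3 / 4 * β * s ^ 2 := by
      have := lipConst_nonneg (N := N) (s • k).1
      gcongr
    rw [e] at h2
    rw [e'] at h1
    linarith
  have hsup : s * γ ≤ A + 3 / 4 * β * s ^ 2 := by
    rw [hγ, ipm, Real.mul_iSup_of_nonneg hs0]
    have : Nonempty {g : LipClass N X // lipConst N g.1 ≤ 1} :=
      ⟨⟨0, lipConst_le zero_le_one fun x x' => by
        simp⟩⟩
    refine ciSup_le fun k => ?_
    rcases abs_cases (∫ x, k.1.1 x ∂minLaw P g - ∫ x, k.1.1 x ∂minLaw P h) with ⟨h1, -⟩ | ⟨h1, -⟩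
    · have := key (-k.1) (by
        have := k.2
        rwa [← lipConst_neg] at this)
      have e : ∀ g, ∫ x, (-k.1).1 x ∂minLaw P g = - ∫ x, k.1.1 x ∂minLaw P g := fun g =>
        integral_neg (f := k.1.1)
      rw [e, e] at this
      rw [h1]
      linarith
    · rw [h1, neg_sub]
      exact key k.1 k.2
  have e1 : s * γ - 3 / 4 * β * s ^ 2 = γ ^ 2 / (3 * β) := by
    rw [hs]; field_simp; ring
  linarith

/-- One round of optimistic follow-the-perturbed-leader, with cumulative loss `S`, guess `G` and
loss `F`. -/
theorem integral_minLaw_le_potential_sub {β : ℝ} (hβ : 0 ≤ β) (hP : HasUniqueMin P)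
    (hint : Integrable (fun σ : LipClass N X => lipConst N σ.1) P)
    (hstab : IsStablePrediction N (minLaw P) β) (x₀ : X) (S G F : LipClass N X) :
    ∫ x, F.1 x ∂minLaw P (S + G) ≤ potential P x₀ (S + F) - potential P x₀ S
      + 3 / 4 * β * lipConst N (F - G).1 ^ 2
      - ipm N (minLaw P (S + G)) (minLaw P S) ^ 2 / (3 * β) := by
  have h1 := potential_add_ge hβ hP hint hstab x₀ (S + G) (F - G)
  have h2 := potential_le_sub_ipm_sq hβ hP hint hstab x₀ (S + G) S
  have e0 : S + G + (F - G) = S + F := by abel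
  have e1 : ∫ x, (F - G).1 x ∂minLaw P (S + G)
      = ∫ x, F.1 x ∂minLaw P (S + G) - ∫ x, G.1 x ∂minLaw P (S + G) :=
    integral_sub ((continuous_lipClass F).integrable_of_compactSpace _)
      ((continuous_lipClass G).integrable_of_compactSpace _)
  have e2 : ∫ x, (S - (S + G)).1 x ∂minLaw P (S + G) = - ∫ x, G.1 x ∂minLaw P (S + G) := by
    rw [sub_add_cancel_left]
    exact integral_neg (f := G.1)
  rw [e0, e1] at h1
  rw [e2] at h2
  linarith

/-- The regret of optimistic follow-the-perturbed-leader against a fixed sequence of losses. -/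
theorem sum_integral_minLaw_sub_le {β : ℝ} (hβ : 0 ≤ β) (hP : HasUniqueMin P)
    (hint : Integrable (fun σ : LipClass N X => lipConst N σ.1) P)
    (hstab : IsStablePrediction N (minLaw P) β) (x : X) {T : ℕ} (F G : Fin T → LipClass N X) :
    ∑ t, (∫ u, (F t).1 u ∂minLaw P (∑ i ∈ Finset.Iio t, F i + G t) - (F t).1 x)
      ≤ (∫ σ : LipClass N X, lipConst N σ.1 ∂P) * ipmDiam N X
        + ∑ t, (3 / 4 * β * lipConst N (F t - G t).1 ^ 2
          - ipm N (minLaw P (∑ i ∈ Finset.Iio t, F i + G t))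
              (minLaw P (∑ i ∈ Finset.Iio t, F i)) ^ 2 / (3 * β)) := by
  -- The potential is normalised at the comparator `x`, so its final value is at most the
  -- comparator's total loss.
  have hstep := fun t => integral_minLaw_le_potential_sub hβ hP hint hstab x
    (∑ i ∈ Finset.Iio t, F i) (G t) (F t)
  have hIic : ∀ t : Fin T, ∑ i ∈ Finset.Iio t, F i + F t = ∑ i ∈ Finset.Iic t, F i := fun t => by
    rw [← Finset.Iio_insert, Finset.sum_insert (by simp), add_comm]
  -- the partial sums telescope
  let Φ : ℕ → ℝ := fun n => potential P x (∑ i ∈ Finset.univ.filter (fun i : Fin T => i.1 < n), F i)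
  have hΦ : ∀ t : Fin T, potential P x (∑ i ∈ Finset.Iio t, F i + F t)
      - potential P x (∑ i ∈ Finset.Iio t, F i) = Φ (t.1 + 1) - Φ t.1 := fun t => by
    rw [hIic]
    have a1 : Finset.Iic t = Finset.univ.filter (fun i : Fin T => i.1 < t.1 + 1) := by
      ext i
      simp only [Finset.mem_Iic, Finset.mem_filter, Finset.mem_univ, true_and, Fin.le_iff_val_le_val]
      exact Nat.lt_succ_iff.symm
    have a2 : Finset.Iio t = Finset.univ.filter (fun i : Fin T => i.1 < t.1) := by
      ext i
      simp only [Finset.mem_Iio, Finset.mem_filter, Finset.mem_univ, true_and]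
      exact Iff.rfl
    rw [a1, a2]
  have htel : ∑ t : Fin T, (Φ (t.1 + 1) - Φ t.1) = Φ T - Φ 0 := by
    rw [Fin.sum_univ_eq_sum_range (fun n => Φ (n + 1) - Φ n), Finset.sum_range_sub]
  have h0 : Φ 0 = potential P x 0 := by simp [Φ]
  have hT : Φ T ≤ ∑ t, (F t).1 x := by
    have e : Finset.univ.filter (fun i : Fin T => i.1 < T) = Finset.univ := by
      ext i; simp
    refine (potential_le_integral hP hint x _).trans (le_of_eq ?_)
    rw [e, Submodule.coe_sum, Finset.sum_apply]
  have hneg := neg_le_potential_zero hint x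
  calc _ ≤ ∑ t : Fin T, ((Φ (t.1 + 1) - Φ t.1) + (3 / 4 * β * lipConst N (F t - G t).1 ^ 2
          - ipm N (minLaw P (∑ i ∈ Finset.Iio t, F i + G t))
              (minLaw P (∑ i ∈ Finset.Iio t, F i)) ^ 2 / (3 * β)) - (F t).1 x) := by
        refine Finset.sum_le_sum fun t _ => ?_
        have := hstep t
        have := hΦ t
        linarith
    _ ≤ _ := by
        rw [Finset.sum_sub_distrib, Finset.sum_add_distrib, htel, h0]
        linarith

end Potential

/-! ### Covering numbers -/

section Covering

open Metric Module

/-- Volume comparison: the balls of radius 1/2 around the points are disjoint and lie in a ball of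
radius R + 1/2. -/
theorem card_le_pow_finrank_of_separated {E : Type*} [NormedAddCommGroup E] [NormedSpace ℝ E]
    [FiniteDimensional ℝ E] (s : Finset E) {R : ℝ} (hR : 0 ≤ R) (hs : ∀ c ∈ s, ‖c‖ ≤ R)
    (h : ∀ c ∈ s, ∀ d ∈ s, c ≠ d → 1 ≤ ‖c - d‖) :
    (s.card : ℝ) ≤ (2 * R + 1) ^ finrank ℝ E := by
  borelize E
  let μ : Measure E := Measure.addHaar
  have hρ : (0 : ℝ) < R + 1 / 2 := by positivity
  have hδ : (0 : ℝ) < 1 / 2 := by norm_num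
  have hdisj : Set.Pairwise (s : Set E) (Function.onFun Disjoint fun c => ball (c : E) (1 / 2)) := by
    rintro c hc e he hce
    refine ball_disjoint_ball ?_
    rw [dist_eq_norm]
    linarith [h c hc e he hce]
  have hsub : (⋃ c ∈ s, ball (c : E) (1 / 2)) ⊆ ball (0 : E) (R + 1 / 2) := by
    refine Set.iUnion₂_subset fun x hx => ball_subset_ball' ?_
    rw [dist_zero_right]
    linarith [hs x hx]
  have hvol : (s.card : ℝ≥0∞) * ENNReal.ofReal ((1 / 2) ^ finrank ℝ E) * μ (ball 0 1) ≤
      ENNReal.ofReal ((R + 1 / 2) ^ finrank ℝ E) * μ (ball 0 1) := by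
    calc _ = μ (⋃ c ∈ s, ball (c : E) (1 / 2)) := by
          rw [measure_biUnion_finset hdisj fun c _ => measurableSet_ball]
          simp only [μ.addHaar_ball_of_pos _ hδ, Finset.sum_const, nsmul_eq_mul, mul_assoc]
      _ ≤ μ (ball (0 : E) (R + 1 / 2)) := measure_mono hsub
      _ = _ := by rw [μ.addHaar_ball_of_pos _ hρ]
  have hvol' := (ENNReal.mul_le_mul_iff_left (measure_ball_pos μ _ zero_lt_one).ne'
    measure_ball_lt_top.ne).1 hvol
  have hreal := ENNReal.toReal_le_of_le_ofReal (by positivity) hvol'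
  rw [ENNReal.toReal_mul, ENNReal.toReal_ofReal (by positivity), ENNReal.toReal_natCast] at hreal
  have e : (R + 1 / 2) ^ finrank ℝ E = (2 * R + 1) ^ finrank ℝ E * (1 / 2) ^ finrank ℝ E := by
    rw [← mul_pow]; congr 1; ring
  rw [e] at hreal
  exact le_of_mul_le_mul_right hreal (by positivity)

theorem Seminorm.card_le_pow_finrank_of_separated {E : Type*} [AddCommGroup E] [Module ℝ E]
    [FiniteDimensional ℝ E] (p : Seminorm ℝ E) (hp : ∀ z, p z = 0 → z = 0) (s : Finset E) {R : ℝ}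
    (hR : 0 ≤ R) (hs : ∀ c ∈ s, p c ≤ R) (h : ∀ c ∈ s, ∀ d ∈ s, c ≠ d → 1 ≤ p (c - d)) :
    (s.card : ℝ) ≤ (2 * R + 1) ^ finrank ℝ E := by
  let q : AddGroupNorm E := { p.toAddGroupSeminorm with eq_zero_of_map_eq_zero' := hp }
  let _ : NormedAddCommGroup E := q.toNormedAddCommGroup
  let _ : NormedSpace ℝ E := ⟨fun a b => (map_smul_eq_mul p a b).le⟩
  exact _root_.card_le_pow_finrank_of_separated s hR hs h

/-- A separated family of indices of maximal cardinality is a net; the volume bound ensures that a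
maximum exists. The net consists of indices rather than points of `E`, so that below its members are
actual pairs of points of `X`. -/
theorem Seminorm.exists_finset_net {E ι : Type*} [AddCommGroup E] [Module ℝ E]
    [FiniteDimensional ℝ E] (p : Seminorm ℝ E) (hp : ∀ z, p z = 0 → z = 0) (code : ι → E) {R : ℝ}
    (hR : 0 ≤ R) (hcode : ∀ i, p (code i) ≤ R) :
    ∃ s : Finset ι, (s.card : ℝ) ≤ (2 * R + 1) ^ finrank ℝ E ∧
      ∀ i, ∃ j ∈ s, p (code i - code j) ≤ 1 := by
  classical
  let sep : Finset ι → Prop := fun s => ∀ i ∈ s, ∀ j ∈ s, i ≠ j → 1 ≤ p (code i - code j)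
  have hcard : ∀ s, sep s → (s.card : ℝ) ≤ (2 * R + 1) ^ finrank ℝ E := by
    intro s hs
    have hinj : Set.InjOn code s := by
      intro i hi j hj hij
      by_contra hne
      have := hs i hi j hj hne
      rw [hij, sub_self, map_zero] at this
      linarith
    rw [← Finset.card_image_of_injOn hinj]
    refine p.card_le_pow_finrank_of_separated hp _ hR ?_ ?_
    · simp only [Finset.mem_image]
      rintro _ ⟨i, -, rfl⟩
      exact hcode i
    · simp only [Finset.mem_image]
      rintro _ ⟨i, hi, rfl⟩ _ ⟨j, hj, rfl⟩ hij
      exact hs i hi j hj fun h => hij (h ▸ rfl)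
  let Q : ℕ → Prop := fun n => ∃ s, sep s ∧ s.card = n
  set b := ⌊(2 * R + 1) ^ finrank ℝ E⌋₊
  have hb : ∀ n, Q n → n ≤ b := by
    rintro _ ⟨s, hs, rfl⟩
    exact Nat.le_floor (hcard s hs)
  obtain ⟨s, hs, hsn⟩ : Q (Nat.findGreatest Q b) :=
    Nat.findGreatest_spec (P := Q) (m := 0) (Nat.zero_le _) ⟨∅, by simp [sep], rfl⟩
  refine ⟨s, hcard s hs, fun i => ?_⟩
  by_contra! hcon
  have hi : i ∉ s := fun hi => by
    have := hcon i hi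
    rw [sub_self, map_zero] at this
    linarith
  have hins : sep (insert i s) := by
    intro a ha c hc hac
    rcases Finset.mem_insert.1 ha with rfl | ha' <;> rcases Finset.mem_insert.1 hc with rfl | hc'
    · exact absurd rfl hac
    · exact (hcon c hc').le
    · rw [map_sub_rev]; exact (hcon a ha').le
    · exact hs a ha' c hc' hac
  have hQ : Q (s.card + 1) := ⟨_, hins, Finset.card_insert_of_notMem hi⟩
  have := Nat.le_findGreatest (hb _ hQ) hQ
  omega

variable {d : ℕ} {N : Seminorm ℝ (Vec d)} {X : Set (Vec d)}

/-- The unit vector, for the norm `N`, in the direction from `x'` to `x`. -/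
noncomputable def unitDir (N : Seminorm ℝ (Vec d)) (x x' : Vec d) : Vec d :=
  (N (x - x'))⁻¹ • (x - x')

theorem seminorm_unitDir_le (x x' : Vec d) : N (unitDir N x x') ≤ 1 := by
  rw [unitDir, map_smul_eq_mul, norm_inv, Real.norm_of_nonneg (apply_nonneg _ _)]
  exact inv_mul_le_one

/-- A net of pairs of distinct points, for the distance of the two points and of the directions. -/
theorem exists_net_of_pairs (hN : ∀ z, N z = 0 → z = 0) [CompactSpace X] [Nonempty X] {m : ℕ}
    (hm : 1 ≤ m) :
    ∃ s : Finset (X × X), (s.card : ℝ) ≤ (2 * m + 1) ^ (3 * d) ∧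
      ∀ x x' : X, x ≠ x' → ∃ p ∈ s, N (x.1 - p.1.1) ≤ ipmDiam N X / m ∧
        N (x'.1 - p.2.1) ≤ ipmDiam N X / m ∧
        N (unitDir N x.1 x'.1 - unitDir N p.1.1 p.2.1) ≤ 1 / m := by
  have hm' : (0 : ℝ) < m := by exact_mod_cast hm
  rcases (ipmDiam_nonneg (N := N) (X := X)).eq_or_lt with h0 | hD
  -- Diameter 0 leaves no pair of distinct points to approximate.
  · refine ⟨∅, by simp; positivity, fun x x' hxx' => absurd ?_ hxx'⟩
    have h1 := seminorm_sub_le_ipmDiam (N := N) x x'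
    rw [← h0] at h1
    exact Subtype.ext (sub_eq_zero.1 (hN _ (le_antisymm h1 (apply_nonneg _ _))))
  set D := ipmDiam N X
  obtain ⟨x₀⟩ := ‹Nonempty X›
  let V := Vec d
  let p : Seminorm ℝ (V × V × V) :=
    N.comp (LinearMap.fst ℝ V (V × V)) ⊔
      (N.comp ((LinearMap.fst ℝ V V).comp (LinearMap.snd ℝ V (V × V))) ⊔
        N.comp ((LinearMap.snd ℝ V V).comp (LinearMap.snd ℝ V (V × V))))
  have hpe : ∀ a b c : V, p (a, b, c) = max (N a) (max (N b) (N c)) := fun a b c => rfl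
  have hp : ∀ z, p z = 0 → z = 0 := by
    rintro ⟨a, b, c⟩ h
    rw [hpe] at h
    have ha := apply_nonneg N a
    have hb := apply_nonneg N b
    have hc := apply_nonneg N c
    have h1 : N a ≤ 0 := h ▸ le_max_left _ _
    have h2 : N b ≤ 0 := h ▸ (le_max_left _ _).trans (le_max_right _ _)
    have h3 : N c ≤ 0 := h ▸ (le_max_right _ _).trans (le_max_right _ _)
    rw [hN a (le_antisymm h1 ha), hN b (le_antisymm h2 hb), hN c (le_antisymm h3 hc)]
    rfl
  have hscale : ∀ (c : ℝ) (a : V), 0 ≤ c → N (c • a) = c * N a := fun c a hc => by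
    rw [map_smul_eq_mul, Real.norm_of_nonneg hc]
  have hmD : 0 < m / D := div_pos hm' hD
  -- Two positions and a direction, scaled to lie in the ball of radius `m`: a net of mesh 1 then
  -- has mesh D/m in the positions and 1/m in the direction. The three components give the exponent
  -- 3d.
  let code : X × X → V × V × V := fun q =>
    ((m / D) • (q.1.1 - x₀.1), (m / D) • (q.2.1 - x₀.1), (m : ℝ) • unitDir N q.1.1 q.2.1)
  have hpt : ∀ x : X, N ((m / D) • (x.1 - x₀.1)) ≤ m := fun x => by
    rw [hscale _ _ hmD.le, div_mul_eq_mul_div, div_le_iff₀ hD]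
    exact mul_le_mul_of_nonneg_left (seminorm_sub_le_ipmDiam _ _) hm'.le
  have hcode : ∀ q, p (code q) ≤ m := by
    intro q
    refine max_le (hpt _) (max_le (hpt _) ?_)
    change N ((m : ℝ) • unitDir N q.1.1 q.2.1) ≤ m
    rw [hscale _ _ hm'.le]
    exact mul_le_of_le_one_right hm'.le (seminorm_unitDir_le _ _)
  obtain ⟨s, hs, hnet⟩ := p.exists_finset_net hp code hm'.le hcode
  refine ⟨s, ?_, fun x x' _ => ?_⟩
  · convert hs using 2
    simp [V]; ring
  · obtain ⟨q, hq, hle⟩ := hnet (x, x')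
    have e : code (x, x') - code q = ((m / D) • (x.1 - q.1.1), (m / D) • (x'.1 - q.2.1),
        (m : ℝ) • (unitDir N x.1 x'.1 - unitDir N q.1.1 q.2.1)) := by
      simp only [code, Prod.mk_sub_mk, ← smul_sub, sub_sub_sub_cancel_right]
    rw [e, hpe, max_le_iff, max_le_iff, hscale _ _ hmD.le, hscale _ _ hmD.le,
      hscale _ _ hm'.le] at hle
    obtain ⟨h1, h2, h3⟩ := hle
    refine ⟨q, hq, ?_, ?_, ?_⟩
    · rw [le_div_iff₀ hm']; rw [div_mul_eq_mul_div, div_le_iff₀ hD] at h1; linarith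
    · rw [le_div_iff₀ hm']; rw [div_mul_eq_mul_div, div_le_iff₀ hD] at h2; linarith
    · rw [le_div_iff₀ hm']; linarith

end Covering

/-! ### Difference quotients of a smooth function -/

section Smooth

variable {d : ℕ} {N : Seminorm ℝ (Vec d)}

theorem hasDerivWithinAt_lineMap {A : Set (Vec d)} (hA : Convex ℝ A) {φ : Vec d → ℝ}
    {g : Vec d → Vec d} (hg : ∀ a ∈ A, HasGradientWithinAt φ (g a) A a) {a a' : Vec d}
    (ha : a ∈ A) (ha' : a' ∈ A) {s : ℝ} (hs : s ∈ Set.Icc (0 : ℝ) 1) :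
    HasDerivWithinAt (fun s : ℝ => φ (AffineMap.lineMap a' a s))
      (inner ℝ (g (AffineMap.lineMap a' a s)) (a - a')) (Set.Icc 0 1) s := by
  have hmaps : Set.MapsTo (fun s : ℝ => AffineMap.lineMap a' a s) (Set.Icc (0 : ℝ) 1) A :=
    fun s hs => hA.lineMap_mem ha' ha hs
  have h1 := (hg _ (hmaps hs)).hasFDerivWithinAt
  have h2 : HasDerivWithinAt (fun s : ℝ => AffineMap.lineMap a' a s) (a - a') (Set.Icc 0 1) s :=
    AffineMap.hasDerivWithinAt_lineMap
  have := h1.comp_hasDerivWithinAt s h2 hmaps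
  rw [InnerProductSpace.toDual_apply_apply] at this
  exact this

/-- The difference quotient of `f(·, y)` between `x` and `x'`. -/
noncomputable def diffQuot (N : Seminorm ℝ (Vec d)) (f : Vec d → Vec d → ℝ) (x x' y : Vec d) : ℝ :=
  (f x y - f x' y) / N (x - x')

/-- The mixed second differences of a smooth function. -/
theorem abs_mixed_difference_le (hN : ∀ z, N z = 0 → z = 0) {X Y : Set (Vec d)} {L : ℝ}
    {f : Vec d → Vec d → ℝ} (hf : HasLipPartialGradient N (convexHull ℝ X) Y L f)
    {x x' y y' : Vec d} (hx : x ∈ X) (hx' : x' ∈ X) (hy : y ∈ Y) (hy' : y' ∈ Y) :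
    |f x y - f x' y - (f x y' - f x' y')| ≤ L * N (x - x') * N (y - y') := by
  obtain ⟨g, hg, hLip⟩ := hf
  have hcx := subset_convexHull ℝ X hx
  have hcx' := subset_convexHull ℝ X hx'
  have hder := fun (b : Vec d) (hb : b ∈ Y) (s : ℝ) (hs : s ∈ Set.Icc (0 : ℝ) 1) =>
    hasDerivWithinAt_lineMap (convex_convexHull ℝ X) (fun a ha => hg a ha b hb) hcx hcx' hs
  have := (convex_Icc (0 : ℝ) 1).norm_image_sub_le_of_norm_hasDerivWithin_le
    (C := L * N (x - x') * N (y - y'))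
    (fun s hs => (hder y hy s hs).sub (hder y' hy' s hs)) (fun s hs => ?_)
    (Set.left_mem_Icc.2 zero_le_one) (Set.right_mem_Icc.2 zero_le_one)
  · simp only [Pi.sub_apply, AffineMap.lineMap_apply_one, AffineMap.lineMap_apply_zero, sub_zero,
      norm_one, mul_one, Real.norm_eq_abs] at this
    convert this using 2
    ring
  · have hmem := (convex_convexHull ℝ X).lineMap_mem hcx' hcx hs
    rw [← inner_sub_left, real_inner_comm, Real.norm_eq_abs]
    refine (abs_inner_le_mul_dualNorm hN _ _).trans ?_
    have h1 := hLip _ hmem _ hmem y hy y' hy'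
    rw [sub_self, map_zero, mul_zero, zero_add] at h1
    nlinarith [apply_nonneg N (x - x')]

/-- The difference quotients for two pairs of nearby points and directions are close to each
other, up to a function of `(x, x', z, z')`. -/
theorem abs_diffQuot_sub_le (hN : ∀ z, N z = 0 → z = 0) {X Y : Set (Vec d)} {L : ℝ} (hL : 0 ≤ L)
    {f : Vec d → Vec d → ℝ} (hf : HasLipPartialGradient N (convexHull ℝ X) Y L f)
    {x x' z z' y y' : Vec d} (hx : x ∈ X) (hx' : x' ∈ X) (hz : z ∈ X) (hz' : z' ∈ X)
    (hy : y ∈ Y) (hy' : y' ∈ Y) {δ : ℝ} (h1 : N (x - z) ≤ δ) (h2 : N (x' - z') ≤ δ) :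
    |diffQuot N f x x' y - diffQuot N f z z' y - (diffQuot N f x x' y' - diffQuot N f z z' y')|
      ≤ 2 * L * δ + L * N (y - y') * N (unitDir N x x' - unitDir N z z') := by
  obtain ⟨g, hg, hLip⟩ := hf
  have hc : ∀ {a}, a ∈ X → a ∈ convexHull ℝ X := fun h => subset_convexHull ℝ X h
  have hder := fun (b : Vec d) (hb : b ∈ Y) {a a' : Vec d} (ha : a ∈ X) (ha' : a' ∈ X) (s : ℝ)
    (hs : s ∈ Set.Icc (0 : ℝ) 1) =>
    (hasDerivWithinAt_lineMap (convex_convexHull ℝ X) (fun a ha => hg a ha b hb) (hc ha) (hc ha')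
      hs).const_mul (N (a - a'))⁻¹
  -- Both segments are run through with the same parameter, so that the mean value inequality
  -- applies to the whole combination of four quotients at once.
  have := (convex_Icc (0 : ℝ) 1).norm_image_sub_le_of_norm_hasDerivWithin_le
    (C := 2 * L * δ + L * N (y - y') * N (unitDir N x x' - unitDir N z z'))
    (fun s hs => ((hder y hy hx hx' s hs).sub (hder y hy hz hz' s hs)).sub
      ((hder y' hy' hx hx' s hs).sub (hder y' hy' hz hz' s hs))) (fun s hs => ?_)
    (Set.left_mem_Icc.2 zero_le_one) (Set.right_mem_Icc.2 zero_le_one)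
  · simp only [Pi.sub_apply, AffineMap.lineMap_apply_one, AffineMap.lineMap_apply_zero, sub_zero,
      norm_one, mul_one, Real.norm_eq_abs] at this
    convert this using 2
    simp only [diffQuot]
    ring
  · set p := AffineMap.lineMap x' x s with hp
    set q := AffineMap.lineMap z' z s with hq
    have hpm : p ∈ convexHull ℝ X := (convex_convexHull ℝ X).lineMap_mem (hc hx') (hc hx) hs
    have hqm : q ∈ convexHull ℝ X := (convex_convexHull ℝ X).lineMap_mem (hc hz') (hc hz) hs
    have hpq : N (p - q) ≤ δ := by
      have e : p - q = (1 - s) • (x' - z') + s • (x - z) := by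
        rw [hp, hq, AffineMap.lineMap_apply_module, AffineMap.lineMap_apply_module]
        module
      rw [e]
      refine (map_add_le_add N _ _).trans ?_
      rw [map_smul_eq_mul, map_smul_eq_mul, Real.norm_of_nonneg hs.1,
        Real.norm_of_nonneg (sub_nonneg.2 hs.2)]
      nlinarith [hs.1, hs.2]
    set u := unitDir N x x' with hu
    set w := unitDir N z z' with hw
    have e : ∀ b : Vec d, (N (x - x'))⁻¹ * inner ℝ (g p b) (x - x') = inner ℝ u (g p b) := fun b => by
      rw [hu, unitDir, real_inner_smul_left, real_inner_comm]
    have e' : ∀ b : Vec d, (N (z - z'))⁻¹ * inner ℝ (g q b) (z - z') = inner ℝ w (g q b) := fun b => by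
      rw [hw, unitDir, real_inner_smul_left, real_inner_comm]
    rw [e, e', e, e', Real.norm_eq_abs]
    -- The change of direction meets only the difference of the gradients at y and y', never a
    -- gradient itself; hence the bound involves L alone and not G.
    have e3 : inner ℝ u (g p y) - inner ℝ w (g q y) - (inner ℝ u (g p y') - inner ℝ w (g q y'))
        = inner ℝ u (g p y - g q y) - inner ℝ u (g p y' - g q y')
          + inner ℝ (u - w) (g q y - g q y') := by
      simp only [inner_sub_left, inner_sub_right]; ring
    have hclose : ∀ b ∈ Y, |inner ℝ u (g p b - g q b)| ≤ L * δ := fun b hb => by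
      refine (abs_inner_le_mul_dualNorm hN _ _).trans ?_
      have a1 := hLip p hpm q hqm b hb b hb
      rw [sub_self b, map_zero, mul_zero, add_zero] at a1
      have a2 : N u ≤ 1 := seminorm_unitDir_le _ _
      have a3 := apply_nonneg N u
      have a4 : 0 ≤ L * δ := mul_nonneg hL ((apply_nonneg _ _).trans hpq)
      calc _ ≤ N u * (L * δ) :=
            mul_le_mul_of_nonneg_left (a1.trans (mul_le_mul_of_nonneg_left hpq hL)) a3
        _ ≤ _ := mul_le_of_le_one_left a4 a2
    have hdir : |inner ℝ (u - w) (g q y - g q y')| ≤ L * N (y - y') * N (u - w) := by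
      refine (abs_inner_le_mul_dualNorm hN _ _).trans ?_
      have a1 := hLip q hqm q hqm y hy y' hy'
      rw [sub_self q, map_zero, mul_zero, zero_add] at a1
      rw [mul_comm]
      exact mul_le_mul_of_nonneg_right a1 (apply_nonneg _ _)
    rw [e3]
    have b1 := abs_le.1 (hclose y hy)
    have b2 := abs_le.1 (hclose y' hy')
    have b3 := abs_le.1 hdir
    exact abs_le.2 ⟨by linarith, by linarith⟩

end Smooth

/-! ### Mixtures and empirical distributions -/

section Mixture

variable {α : Type*} [MeasurableSpace α] {n : ℕ}

theorem integral_mixture {P : Fin n → Measure α} {k : α → ℝ} (hk : ∀ i, Integrable k (P i)) :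
    ∫ x, k x ∂mixture P = (∑ i, ∫ x, k x ∂P i) / n := by
  rw [mixture, integral_smul_measure, integral_finsetSum_measure fun i _ => hk i]
  simp [div_eq_inv_mul]

theorem integral_empirical [MeasurableSingletonClass α] (x : Fin n → α) (k : α → ℝ) :
    ∫ z, k z ∂empirical x = (∑ j, k (x j)) / n := by
  rw [empirical, integral_mixture fun j => integrable_dirac (by simp)]
  simp

instance isProbabilityMeasure_mixture [NeZero n] (P : Fin n → Measure α)
    [∀ i, IsProbabilityMeasure (P i)] : IsProbabilityMeasure (mixture P) := ⟨by
  simp [mixture, ENNReal.inv_mul_cancel (Nat.cast_ne_zero.2 (NeZero.ne n)) (ENNReal.natCast_ne_top n)]⟩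

instance isProbabilityMeasure_empirical [NeZero n] (x : Fin n → α) :
    IsProbabilityMeasure (empirical x) := by
  unfold empirical; infer_instance

end Mixture

/-! ### Smooth games -/

/-- The consequences of the Lipschitz continuity and of the smoothness of `f` that are used below.
They are invariant under exchanging the players. -/
structure SmoothGame {d : ℕ} (N : Seminorm ℝ (Vec d)) (X Y : Set (Vec d)) (f : Vec d → Vec d → ℝ)
    (G L : ℝ) : Prop where
  lip₁ : ∀ (x x' : X) (y : Y), |f x y - f x' y| ≤ G * N (x.1 - x'.1)
  lip₂ : ∀ (x : X) (y y' : Y), |f x y - f x y'| ≤ G * N (y.1 - y'.1)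
  mixed : ∀ (x x' : X) (y y' : Y),
    |f x y - f x' y - (f x y' - f x' y')| ≤ L * N (x.1 - x'.1) * N (y.1 - y'.1)
  quot₁ : ∀ (x x' z z' : X) (y y' : Y) (δ : ℝ), N (x.1 - z.1) ≤ δ → N (x'.1 - z'.1) ≤ δ →
    |diffQuot N f x x' y - diffQuot N f z z' y - (diffQuot N f x x' y' - diffQuot N f z z' y')|
      ≤ 2 * L * δ + L * N (y.1 - y'.1) * N (unitDir N x.1 x'.1 - unitDir N z.1 z'.1)
  quot₂ : ∀ (x x' z z' : Y) (y y' : X) (δ : ℝ), N (x.1 - z.1) ≤ δ → N (x'.1 - z'.1) ≤ δ →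
    |diffQuot N (fun b a => -f a b) x x' y - diffQuot N (fun b a => -f a b) z z' y
        - (diffQuot N (fun b a => -f a b) x x' y' - diffQuot N (fun b a => -f a b) z z' y')|
      ≤ 2 * L * δ + L * N (y.1 - y'.1) * N (unitDir N x.1 x'.1 - unitDir N z.1 z'.1)

namespace SmoothGame

variable {d : ℕ} {N : Seminorm ℝ (Vec d)} {X Y : Set (Vec d)} {f : Vec d → Vec d → ℝ} {G L : ℝ}

theorem swap (h : SmoothGame N X Y f G L) : SmoothGame N Y X (fun y x => -f x y) G L where
  lip₁ y y' x := by
    rw [neg_sub_neg, abs_sub_comm]; exact h.lip₂ x y y'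
  lip₂ y x x' := by
    rw [neg_sub_neg, abs_sub_comm]; exact h.lip₁ x x' y
  mixed y y' x x' := by
    have := h.mixed x x' y y'
    rw [mul_right_comm, ← abs_neg]
    convert this using 2
    ring
  quot₁ := h.quot₂
  quot₂ := by simpa using h.quot₁

theorem continuous_left (h : SmoothGame N X Y f G L) (y : Y) : Continuous fun x : X => f x y :=
  continuous_of_abs_sub_le fun x x' => h.lip₁ x x' y

theorem continuous_right (h : SmoothGame N X Y f G L) (x : X) : Continuous fun y : Y => f x y :=
  continuous_of_abs_sub_le fun y y' => h.lip₂ x y y'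

theorem exists_bound (h : SmoothGame N X Y f G L) [CompactSpace X] [CompactSpace Y] [Nonempty X]
    [Nonempty Y] : ∃ R, ∀ (x : X) (y : Y), |f x y| ≤ R := by
  obtain ⟨x₀⟩ := ‹Nonempty X›
  obtain ⟨y₀⟩ := ‹Nonempty Y›
  obtain ⟨R, hR⟩ := (isCompact_range (h.continuous_right x₀).abs).bddAbove
  refine ⟨|G| * ipmDiam N X + R, fun x y => ?_⟩
  have h1 := h.lip₁ x x₀ y
  have h2 : |f x₀ y| ≤ R := hR ⟨y, rfl⟩
  have h3 : G * N (x.1 - x₀.1) ≤ |G| * ipmDiam N X :=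
    mul_le_mul (le_abs_self _) (seminorm_sub_le_ipmDiam _ _) (apply_nonneg _ _) (abs_nonneg _)
  have := abs_sub_abs_le_abs_sub (f x y) (f x₀ y)
  linarith

theorem continuous_diffQuot (h : SmoothGame N X Y f G L) (x x' : X) :
    Continuous fun y : Y => diffQuot N f x x' y :=
  ((h.continuous_right x).sub (h.continuous_right x')).div_const _

theorem abs_diffQuot_le (h : SmoothGame N X Y f G L) (hG : 0 ≤ G) (x x' : X) (y : Y) :
    |diffQuot N f x x' y| ≤ G := by
  rw [diffQuot, abs_div, abs_of_nonneg (apply_nonneg N _)]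
  exact div_le_of_le_mul₀ (apply_nonneg _ _) hG (h.lip₁ x x' y)

variable [CompactSpace Y]

/-- The loss of the first player when the second player plays the distribution `Q`. -/
noncomputable def loss (h : SmoothGame N X Y f G L) (Q : Measure Y) [IsProbabilityMeasure Q] :
    LipClass N X :=
  ⟨fun u => ∫ v : Y, f u v ∂Q, G, fun x x' => by
    rw [← integral_sub ((h.continuous_right x).integrable_of_compactSpace _)
      ((h.continuous_right x').integrable_of_compactSpace _)]
    have := norm_integral_le_of_norm_le_const (μ := Q) (f := fun v : Y => f x v - f x' v)
      (Filter.Eventually.of_forall fun v => h.lip₁ x x' v)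
    simpa using this⟩

theorem loss_apply (h : SmoothGame N X Y f G L) (Q : Measure Y) [IsProbabilityMeasure Q] (u : X) :
    (h.loss Q).1 u = ∫ v : Y, f u v ∂Q := rfl

theorem integral_sub_eq (h : SmoothGame N X Y f G L) (Q : Measure Y) [IsProbabilityMeasure Q]
    (x x' : X) : (h.loss Q).1 x - (h.loss Q).1 x' = ∫ v : Y, (f x v - f x' v) ∂Q :=
  (integral_sub ((h.continuous_right x).integrable_of_compactSpace _)
      ((h.continuous_right x').integrable_of_compactSpace _)).symm

/-- By the bound on mixed differences, y ↦ f(x, y) − f(x', y) is Lipschitz with constant L‖x − x'‖,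
hence an admissible test function after scaling. -/
theorem lipConst_loss_sub_le_ipm (h : SmoothGame N X Y f G L) (hL : 0 ≤ L) (Q Q' : Measure Y)
    [IsProbabilityMeasure Q] [IsProbabilityMeasure Q'] :
    lipConst N (h.loss Q - h.loss Q').1 ≤ L * ipm N Q Q' := by
  refine lipConst_le (mul_nonneg hL (ipm_nonneg _ _)) fun x x' => ?_
  have e : (h.loss Q - h.loss Q').1 x - (h.loss Q - h.loss Q').1 x'
      = ∫ v : Y, (f x v - f x' v) ∂Q - ∫ v : Y, (f x v - f x' v) ∂Q' := by
    rw [← h.integral_sub_eq, ← h.integral_sub_eq]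
    change (h.loss Q).1 x - (h.loss Q').1 x - ((h.loss Q).1 x' - (h.loss Q').1 x') = _
    ring
  rw [e, mul_right_comm]
  exact abs_integral_sub_integral_le_ipm (mul_nonneg hL (apply_nonneg _ _)) fun y y' =>
    h.mixed x x' y y'

theorem integral_diffQuot (h : SmoothGame N X Y f G L) (Q : Measure Y) [IsProbabilityMeasure Q]
    (x x' : X) : ∫ y : Y, diffQuot N f x x' y ∂Q
      = ((h.loss Q).1 x - (h.loss Q).1 x') / N (x.1 - x'.1) := by
  rw [h.integral_sub_eq, ← integral_div]
  rfl

theorem lipConst_loss_sub_le_two_mul (h : SmoothGame N X Y f G L) (hG : 0 ≤ G) (Q Q' : Measure Y)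
    [IsProbabilityMeasure Q] [IsProbabilityMeasure Q'] :
    lipConst N (h.loss Q - h.loss Q').1 ≤ 2 * G := by
  have hQ : ∀ (Q : Measure Y) [IsProbabilityMeasure Q], lipConst N (h.loss Q).1 ≤ G := by
    intro Q _
    refine lipConst_le hG fun x x' => ?_
    rw [h.integral_sub_eq]
    have := norm_integral_le_of_norm_le_const (μ := Q) (f := fun v : Y => f x v - f x' v)
      (Filter.Eventually.of_forall fun v => h.lip₁ x x' v)
    simpa using this
  have e : (h.loss Q - h.loss Q').1 = (h.loss Q).1 + -(h.loss Q').1 := sub_eq_add_neg _ _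
  rw [e]
  refine (lipConst_add_le (h.loss Q).2 ((LipClass N X).neg_mem (h.loss Q').2)).trans ?_
  rw [lipConst_neg]
  linarith [hQ Q, hQ Q']

/-- Comparison of two loss functions by means of a net of pairs of points. -/
theorem lipConst_loss_sub_le_of_net (h : SmoothGame N X Y f G L) (hN : ∀ z, N z = 0 → z = 0)
    (hL : 0 ≤ L) {Q Q' : Measure Y} [IsProbabilityMeasure Q] [IsProbabilityMeasure Q']
    {m : ℕ} {D τ : ℝ} (hτ : 0 ≤ τ) (hX : ipmDiam N X ≤ D) (hY : ipmDiam N Y ≤ D)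
    (s : Finset (X × X))
    (hs : ∀ x x' : X, x ≠ x' → ∃ p ∈ s, N (x.1 - p.1.1) ≤ ipmDiam N X / m ∧
        N (x'.1 - p.2.1) ≤ ipmDiam N X / m ∧
        N (unitDir N x.1 x'.1 - unitDir N p.1.1 p.2.1) ≤ 1 / m)
    (hsτ : ∀ p ∈ s, |∫ y : Y, diffQuot N f p.1 p.2 y ∂Q - ∫ y : Y, diffQuot N f p.1 p.2 y ∂Q'| ≤ τ) :
    lipConst N (h.loss Q - h.loss Q').1 ≤ τ + 6 * (L * D / m) := by
  have hD : 0 ≤ D := ipmDiam_nonneg.trans hX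
  have hm : (0 : ℝ) ≤ m := Nat.cast_nonneg m
  have hYne : Nonempty Y := nonempty_of_isProbabilityMeasure Q
  refine lipConst_le (by positivity) fun x x' => ?_
  by_cases hxx' : x = x'
  · simp [hxx']
  have hpos : 0 < N (x.1 - x'.1) := lt_of_le_of_ne (apply_nonneg _ _) fun h0 =>
    hxx' (Subtype.ext (sub_eq_zero.1 (hN _ h0.symm)))
  obtain ⟨p, hp, h1, h2, h3⟩ := hs x x' hxx'
  -- Only the oscillation in y matters, since both measures have mass 1 and constants cancel. The
  -- positions contribute 2LD/m and the direction LD/m; integration against two measures doubles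
  -- this to 6LD/m.
  have hosc : ∀ y y' : Y, |diffQuot N f x x' y - diffQuot N f p.1 p.2 y
      - (diffQuot N f x x' y' - diffQuot N f p.1 p.2 y')| ≤ 3 * (L * D / m) := by
    intro y y'
    refine (h.quot₁ x x' p.1 p.2 y y' _ h1 h2).trans ?_
    have a1 : L * N (y.1 - y'.1) * N (unitDir N x.1 x'.1 - unitDir N p.1.1 p.2.1)
        ≤ L * D * (1 / m) :=
      mul_le_mul (mul_le_mul_of_nonneg_left ((seminorm_sub_le_ipmDiam y y').trans hY) hL) h3
        (apply_nonneg _ _) (mul_nonneg hL hD)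
    have a2 : 2 * L * (ipmDiam N X / m) ≤ 2 * L * (D / m) := by gcongr
    have a3 : 2 * L * (D / m) + L * D * (1 / m) = 3 * (L * D / m) := by ring
    linarith
  have i1 := fun (Q : Measure Y) [IsProbabilityMeasure Q] (x x' : X) =>
    (h.continuous_diffQuot x x').integrable_of_compactSpace Q
  have hclose := abs_integral_sub_integral_le ((i1 Q x x').sub (i1 Q p.1 p.2))
    ((i1 Q' x x').sub (i1 Q' p.1 p.2)) hosc
  rw [integral_sub' (i1 Q x x') (i1 Q p.1 p.2), integral_sub' (i1 Q' x x') (i1 Q' p.1 p.2)] at hclose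
  have hfin : |∫ y : Y, diffQuot N f x x' y ∂Q - ∫ y : Y, diffQuot N f x x' y ∂Q'|
      ≤ τ + 6 * (L * D / m) := by
    have b1 := abs_le.1 hclose
    have b2 := abs_le.1 (hsτ p hp)
    exact abs_le.2 ⟨by linarith, by linarith⟩
  rw [h.integral_diffQuot, h.integral_diffQuot, ← sub_div, abs_div, abs_of_pos hpos,
    div_le_iff₀ hpos] at hfin
  refine le_trans (le_of_eq (congrArg _ ?_)) hfin
  change (h.loss Q).1 x - (h.loss Q').1 x - ((h.loss Q).1 x' - (h.loss Q').1 x') = _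
  ring

end SmoothGame

/-! ### Concentration -/

section Hoeffding

theorem measureReal_pi_sum_ge_le {S : Type*} [MeasurableSpace S] {P : Measure S}
    [IsProbabilityMeasure P] {m : ℕ} {k : S → ℝ} (hk : Measurable k) {G : ℝ}
    (hG : 0 ≤ G) (hkG : ∀ s, |k s| ≤ G) {t : ℝ} (ht : 0 ≤ t) :
    (Measure.pi fun _ : Fin m => P).real {s | m * t ≤ ∑ j, (k (s j) - ∫ z, k z ∂P)}
      ≤ Real.exp (-(m * t ^ 2 / (2 * G ^ 2))) := by
  have hsub : ∀ j : Fin m, HasSubgaussianMGF (fun s : Fin m → S => k (s j) - ∫ z, k z ∂P)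
      ((‖G - -G‖₊ / 2) ^ 2) (Measure.pi fun _ : Fin m => P) := by
    intro j
    have := hasSubgaussianMGF_of_mem_Icc (μ := Measure.pi fun _ : Fin m => P)
      (X := fun s : Fin m → S => k (s j)) (a := -G) (b := G)
      (hk.comp (measurable_pi_apply j)).aemeasurable
      (Filter.Eventually.of_forall fun s => abs_le.1 (hkG _))
    have e : ∫ s : Fin m → S, k (s j) ∂(Measure.pi fun _ : Fin m => P) = ∫ z, k z ∂P := by
      have hmp := measurePreserving_eval (fun _ : Fin m => P) j
      exact (integral_map (measurable_pi_apply j).aemeasurable hk.aestronglyMeasurable).symm.trans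
        (by rw [hmp.map_eq])
    rwa [e] at this
  have hind : iIndepFun (fun (j : Fin m) (s : Fin m → S) => k (s j) - ∫ z, k z ∂P)
      (Measure.pi fun _ : Fin m => P) :=
    iIndepFun_pi (μ := fun _ : Fin m => P) (X := fun (_ : Fin m) (z : S) => k z - ∫ z, k z ∂P)
      fun _ => (hk.sub_const _).aemeasurable
  have := HasSubgaussianMGF.measure_sum_ge_le_of_iIndepFun hind (s := Finset.univ)
    (fun j _ => hsub j) (ε := m * t) (by positivity)
  refine this.trans (le_of_eq ?_)
  congr 1
  have e : (‖G - -G‖ / 2) ^ 2 = G ^ 2 := by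
    rw [sub_neg_eq_add, Real.norm_of_nonneg (by positivity)]; ring
  rcases Nat.eq_zero_or_pos m with rfl | hm
  · simp
  have hm' : (m : ℝ) ≠ 0 := by positivity
  simp only [Finset.sum_const, Finset.card_univ, Fintype.card_fin, nsmul_eq_mul, NNReal.coe_mul,
    NNReal.coe_natCast, NNReal.coe_pow, NNReal.coe_div, coe_nnnorm, NNReal.coe_ofNat, e]
  -- For G = 0 both exponents are quotients by zero, hence 0.
  rcases hG.eq_or_lt with rfl | hG
  · simp
  field_simp

theorem measureReal_pi_abs_avg_sub_ge_le {S : Type*} [MeasurableSpace S] {P : Measure S}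
    [IsProbabilityMeasure P] {m : ℕ} (hm : 1 ≤ m) {k : S → ℝ} (hk : Measurable k) {G : ℝ}
    (hG : 0 ≤ G) (hkG : ∀ s, |k s| ≤ G) {t : ℝ} (ht : 0 ≤ t) :
    (Measure.pi fun _ : Fin m => P).real {s | t ≤ |(∑ j, k (s j)) / m - ∫ z, k z ∂P|}
      ≤ 2 * Real.exp (-(m * t ^ 2 / (2 * G ^ 2))) := by
  have hm' : (0 : ℝ) < m := by exact_mod_cast hm
  have h1 := measureReal_pi_sum_ge_le (P := P) (m := m) hk hG hkG ht
  have h2 := measureReal_pi_sum_ge_le (P := P) (m := m) hk.neg hG (by simpa using hkG) ht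
  rw [two_mul]
  refine le_trans ?_ (add_le_add h1 h2)
  refine le_trans (measureReal_mono ?_) (measureReal_union_le _ _)
  intro s hs
  rcases le_abs'.1 hs.out with h | h
  · right
    change m * t ≤ ∑ j, (-k (s j) - ∫ z, -k z ∂P)
    rw [integral_neg, Finset.sum_sub_distrib, Finset.sum_neg_distrib]
    have : (∑ j, k (s j)) / m ≤ -t + ∫ z, k z ∂P := by linarith
    rw [div_le_iff₀ hm'] at this
    simp
    linarith
  · left
    change m * t ≤ ∑ j, (k (s j) - ∫ z, k z ∂P)
    rw [Finset.sum_sub_distrib]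
    have : t + ∫ z, k z ∂P ≤ (∑ j, k (s j)) / m := by linarith
    rw [le_div_iff₀ hm'] at this
    simp
    linarith

end Hoeffding

/-! ### Conditioning on an independent variable -/

section Independent

variable {Ω V S : Type*} [MeasurableSpace Ω] [MeasurableSpace V] [MeasurableSpace S]
  {μ : Measure Ω} [IsProbabilityMeasure μ] {ν : Measure S} [IsProbabilityMeasure ν]
  {v : Ω → V} {σ : Ω → S}

omit [IsProbabilityMeasure ν] in
theorem map_prodMk_eq_of_indepFun (hv : Measurable v) (hσ : Measurable σ) (hlaw : μ.map σ = ν)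
    (hind : IndepFun v σ μ) : μ.map (fun ω => (v ω, σ ω)) = (μ.map v).prod ν := by
  rw [(indepFun_iff_map_prod_eq_prod_map_map hv.aemeasurable hσ.aemeasurable).1 hind, hlaw]

/-- By independence the joint law is a product, so a bound for every frozen value of `v` integrates
to a bound for the random one. -/
theorem measureReal_le_of_indepFun (hv : Measurable v) (hσ : Measurable σ) (hlaw : μ.map σ = ν)
    (hind : IndepFun v σ μ) {A : Set (V × S)} (hA : MeasurableSet A) {c : ℝ}
    (hc : ∀ a, ν.real {s | (a, s) ∈ A} ≤ c) : μ.real {ω | (v ω, σ ω) ∈ A} ≤ c := by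
  have := Measure.isProbabilityMeasure_map (μ := μ) hv.aemeasurable
  have hc0 : 0 ≤ c := by
    obtain ⟨ω⟩ := nonempty_of_isProbabilityMeasure μ
    exact measureReal_nonneg.trans (hc (v ω))
  have e : μ {ω | (v ω, σ ω) ∈ A} = (μ.map v).prod ν A := by
    rw [← map_prodMk_eq_of_indepFun hv hσ hlaw hind, Measure.map_apply (hv.prodMk hσ) hA]
    rfl
  rw [measureReal_def, e, Measure.prod_apply hA]
  refine ENNReal.toReal_le_of_le_ofReal hc0 ?_
  calc _ ≤ ∫⁻ _, ENNReal.ofReal c ∂μ.map v := by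
        refine lintegral_mono fun a => ?_
        rw [← ofReal_measureReal]
        exact ENNReal.ofReal_le_ofReal (hc a)
    _ = _ := by simp

theorem integral_eq_of_indepFun (hv : Measurable v) (hσ : Measurable σ) (hlaw : μ.map σ = ν)
    (hind : IndepFun v σ μ) {H : V × S → ℝ} (hH : Measurable H) {R : ℝ} (hR : ∀ p, |H p| ≤ R) :
    Integrable (fun ω => ∫ s, H (v ω, s) ∂ν) μ ∧
      ∫ ω, H (v ω, σ ω) ∂μ = ∫ ω, ∫ s, H (v ω, s) ∂ν ∂μ := by
  have := Measure.isProbabilityMeasure_map (μ := μ) hv.aemeasurable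
  have hint : Integrable H ((μ.map v).prod ν) :=
    Integrable.of_bound hH.aestronglyMeasurable R (Filter.Eventually.of_forall hR)
  have hint' := hint.integral_prod_left
  refine ⟨hint'.comp_measurable hv, ?_⟩
  have e1 : ∫ ω, H (v ω, σ ω) ∂μ = ∫ p, H p ∂(μ.map v).prod ν := by
    rw [← map_prodMk_eq_of_indepFun hv hσ hlaw hind]
    exact (integral_map (hv.prodMk hσ).aemeasurable hH.aestronglyMeasurable).symm
  rw [e1, integral_prod _ hint]
  exact integral_map hv.aemeasurable hint'.aestronglyMeasurable

end Independent

/-! ### Sampling error of perturbed best responses -/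

section Samples

variable {d : ℕ} {N : Seminorm ℝ (Vec d)} {X Y : Set (Vec d)} [CompactSpace X] [Nonempty X]
  [CompactSpace Y] [Nonempty Y] {Ω : Type*} [MeasurableSpace Ω] {μ : Measure Ω}
  [IsProbabilityMeasure μ]

/-- Uniqueness is assumed almost surely for each fixed loss. Independence and Fubini carry it over
to a random loss, after which any minimizer must be the selected one. -/
theorem ae_eq_argminSel {P : Measure (LipClass N X)} [IsProbabilityMeasure P] (hP : HasUniqueMin P)
    {g σ : Ω → LipClass N X} (hg : Measurable g) (hσ : Measurable σ) (hlaw : μ.map σ = P)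
    (hind : IndepFun g σ μ) {x : Ω → X}
    (hx : ∀ᵐ ω ∂μ, IsPerturbedMin (g ω).1 (σ ω).1 (x ω)) :
    x =ᵐ[μ] fun ω => argminSel (g ω - σ ω) := by
  have hA : MeasurableSet {p : LipClass N X × LipClass N X | p.1 - p.2 ∈ uniqueMin N X} :=
    measurable_lipClass_sub measurableSet_uniqueMin
  have h1 : ∀ᵐ p ∂(μ.map g).prod P, p.1 - p.2 ∈ uniqueMin N X :=
    (Measure.ae_prod_iff_ae_ae hA).2 (Filter.Eventually.of_forall fun l => hP.ae_mem l)
  rw [← map_prodMk_eq_of_indepFun hg hσ hlaw hind] at h1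
  filter_upwards [ae_of_ae_map (hg.prodMk hσ).aemeasurable h1, hx] with ω hω hxω
  exact (isPerturbedMin_iff hω _).1 hxω

/-- From 2m + 1 ≤ (2m)² the logarithm is at most (1 + 6d) log(2m). -/
theorem log_net_le {d m : ℕ} (hd : 1 ≤ d) (hm : 1 ≤ m) :
    Real.log (2 * (2 * m + 1) ^ (3 * d) * m) ≤ 7 * (d * Real.log (2 * m)) := by
  have hm' : (1 : ℝ) ≤ m := by exact_mod_cast hm
  have hd' : (1 : ℝ) ≤ d := by exact_mod_cast hd
  have hlog : 0 ≤ Real.log (2 * m) := Real.log_nonneg (by linarith)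
  have h1 : Real.log (2 * m + 1) ≤ 2 * Real.log (2 * m) := by
    rw [← Nat.cast_two, ← Real.log_pow]
    refine Real.log_le_log (by positivity) ?_
    push_cast
    nlinarith
  have e : 2 * (2 * (m : ℝ) + 1) ^ (3 * d) * m = (2 * m) * (2 * m + 1) ^ (3 * d) := by ring
  rw [e, Real.log_mul (by positivity) (by positivity), Real.log_pow]
  push_cast
  have h2 : 3 * (d : ℝ) * Real.log (2 * m + 1) ≤ 3 * d * (2 * Real.log (2 * m)) :=
    mul_le_mul_of_nonneg_left h1 (by positivity)
  have h3 : Real.log (2 * m) ≤ d * Real.log (2 * m) := le_mul_of_one_le_left hlog hd'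
  linarith

/-- The error of an empirical distribution, with `m` samples, of perturbed best responses. -/
theorem SmoothGame.exists_bound_sampling_error {f : Vec d → Vec d → ℝ} {G L D : ℝ}
    (h : SmoothGame N X Y f G L) (hN : ∀ z, N z = 0 → z = 0) (hd : 1 ≤ d) (hG : 0 ≤ G) (hL : 0 ≤ L)
    (hX : ipmDiam N X ≤ D) (hY : ipmDiam N Y ≤ D) {m : ℕ} [NeZero m] {P : Measure (LipClass N Y)}
    [IsProbabilityMeasure P] [HasUniqueMin P] {g : Ω → LipClass N Y} (hg : Measurable g)
    {σ : Fin m → Ω → LipClass N Y} (hσ : ∀ j, Measurable (σ j))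
    (hlaw : μ.map (fun ω j => σ j ω) = Measure.pi fun _ => P)
    (hind : IndepFun g (fun ω j => σ j ω) μ) {y : Fin m → Ω → Y}
    (hy : ∀ j, y j =ᵐ[μ] fun ω => argminSel (g ω - σ j ω)) :
    ∃ B : Ω → ℝ, Integrable B μ ∧
      (∀ᵐ ω ∂μ, lipConst N
        (h.loss (empirical fun j => y j ω) - h.loss (minLaw P (g ω))).1 ^ 2 ≤ B ω) ∧
      ∫ ω, B ω ∂μ ≤ min (D ^ 2 * L ^ 2)
        (72 * (D ^ 2 * L ^ 2 / m) + 40 * (d * G ^ 2 * Real.log (2 * m) / m)) := by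
  have hm : 1 ≤ m := Nat.one_le_iff_ne_zero.2 (NeZero.ne m)
  have hm' : (1 : ℝ) ≤ m := by exact_mod_cast hm
  have hd' : (1 : ℝ) ≤ d := by exact_mod_cast hd
  have hD : 0 ≤ D := ipmDiam_nonneg.trans hX
  have hlog2 : (0.69 : ℝ) ≤ Real.log (2 * m) := by
    have := Real.log_two_gt_d9
    have := Real.log_le_log (by norm_num : (0 : ℝ) < 2) (by linarith : (2 : ℝ) ≤ 2 * m)
    linarith
  -- If the first entry of the minimum is the smaller, the deterministic Lipschitz bound LD suffices
  -- and no concentration is needed.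
  rcases le_total (D ^ 2 * L ^ 2)
    (72 * (D ^ 2 * L ^ 2 / m) + 40 * (d * G ^ 2 * Real.log (2 * m) / m)) with hmin | hmin
  · rw [min_eq_left hmin]
    refine ⟨fun _ => D ^ 2 * L ^ 2, integrable_const _, Filter.Eventually.of_forall fun ω => ?_, by simp⟩
    rw [← mul_pow]
    refine pow_le_pow_left₀ (lipConst_nonneg _) ?_ 2
    refine (h.lipConst_loss_sub_le_ipm hL _ _).trans ?_
    rw [mul_comm D]
    exact mul_le_mul_of_nonneg_left ((ipm_le_ipmDiam _ _).trans hY) hL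
  rw [min_eq_right hmin]
  obtain ⟨s, hs, hnet⟩ := exists_net_of_pairs (X := X) hN hm
  set M : ℝ := (2 * m + 1) ^ (3 * d) with hM
  have hM1 : 1 ≤ M := one_le_pow₀ (by linarith)
  -- The threshold is chosen so that Hoeffding's tail 2·exp(−mτ²/(2G²)), summed over at most M
  -- pairs, is 1/m.
  set τ : ℝ := √(2 * G ^ 2 * Real.log (2 * M * m) / m) with hτ
  have hlogM : 0 ≤ Real.log (2 * M * m) := Real.log_nonneg (by nlinarith)
  have hτ2 : τ ^ 2 = 2 * G ^ 2 * Real.log (2 * M * m) / m := Real.sq_sqrt (by positivity)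
  have hτ0 : 0 ≤ τ := Real.sqrt_nonneg _
  -- the event that the average of a difference quotient deviates from its mean
  let q : X × X → Y → ℝ := fun p z => diffQuot N f p.1 p.2 z
  have hq : ∀ p, Measurable (q p) := fun p => (h.continuous_diffQuot p.1 p.2).measurable
  let A : X × X → Set (LipClass N Y × (Fin m → LipClass N Y)) := fun p =>
    {r | τ ≤ |(∑ j, q p (argminSel (r.1 - r.2 j))) / m - ∫ z, q p (argminSel (r.1 - z)) ∂P|}
  have hA : ∀ p, MeasurableSet (A p) := fun p => by
    refine measurableSet_le measurable_const (Measurable.abs (Measurable.sub ?_ ?_))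
    · refine (Finset.measurable_sum _ fun j _ => ?_).div_const _
      exact (hq p).comp (measurable_argminSel.comp (measurable_lipClass_sub.comp
        (measurable_fst.prodMk ((measurable_pi_apply j).comp measurable_snd))))
    · have hm2 : Measurable fun r : LipClass N Y × LipClass N Y => q p (argminSel (r.1 - r.2)) :=
        (hq p).comp (measurable_argminSel.comp measurable_lipClass_sub)
      exact (hm2.stronglyMeasurable.integral_prod_right'.measurable).comp measurable_fst
  have hσm : Measurable fun ω j => σ j ω := measurable_pi_lambda _ hσ
  let E : X × X → Set Ω := fun p => {ω | (g ω, fun j => σ j ω) ∈ A p}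
  have hE : ∀ p, MeasurableSet (E p) := fun p => (hg.prodMk hσm) (hA p)
  have hprob : ∀ p, μ.real (E p) ≤ 2 * Real.exp (-(m * τ ^ 2 / (2 * G ^ 2))) := fun p =>
    measureReal_le_of_indepFun hg hσm hlaw hind (hA p) fun a =>
      measureReal_pi_abs_avg_sub_ge_le hm
        ((hq p).comp (measurable_argminSel.comp (measurable_sub_left a))) hG
        (fun z => h.abs_diffQuot_le hG _ _ _) hτ0
  let bad : Set Ω := ⋃ p ∈ s, E p
  have hbad : MeasurableSet bad := Finset.measurableSet_biUnion _ fun p _ => hE p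
  -- The factor 4G² is kept on both sides because for G = 0 the tail bound is void while the product
  -- vanishes.
  have hbadprob : 4 * G ^ 2 * μ.real bad ≤ 4 * G ^ 2 / m := by
    rcases hG.eq_or_lt with rfl | hGpos
    · simp
    rw [← mul_one_div]
    refine mul_le_mul_of_nonneg_left ?_ (by positivity)
    calc μ.real bad ≤ ∑ p ∈ s, μ.real (E p) := measureReal_biUnion_finset_le _ _
      _ ≤ ∑ p ∈ s, 2 * Real.exp (-(m * τ ^ 2 / (2 * G ^ 2))) := Finset.sum_le_sum fun p _ => hprob p
      _ = s.card * (2 * Real.exp (-Real.log (2 * M * m))) := by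
          rw [Finset.sum_const, nsmul_eq_mul, hτ2]
          congr 4
          field_simp
      _ ≤ M * (2 * Real.exp (-Real.log (2 * M * m))) :=
          mul_le_mul_of_nonneg_right hs (by positivity)
      _ = 1 / m := by
          rw [Real.exp_neg, Real.exp_log (by positivity)]
          field_simp
  -- Off the bad event (τ + 6LD/m)² ≤ 2τ² + 72(LD/m)²; on it the squared error is at most (2G)².
  refine ⟨fun ω => (2 * τ ^ 2 + 72 * (D ^ 2 * L ^ 2 / m)) + bad.indicator (fun _ => 4 * G ^ 2) ω,
    (integrable_const _).add ((integrable_const _).indicator hbad), ?_, ?_⟩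
  · have hy' : ∀ᵐ ω ∂μ, ∀ j, y j ω = argminSel (g ω - σ j ω) := ae_all_iff.2 hy
    filter_upwards [hy'] with ω hω
    by_cases hb : ω ∈ bad
    · rw [Set.indicator_of_mem hb]
      have h1 := pow_le_pow_left₀ (lipConst_nonneg _) (h.lipConst_loss_sub_le_two_mul hG
        (empirical fun j => y j ω) (minLaw P (g ω))) 2
      have h2 : 0 ≤ 2 * τ ^ 2 + 72 * (D ^ 2 * L ^ 2 / m) := by positivity
      nlinarith
    · rw [Set.indicator_of_notMem hb, add_zero]
      have hle := h.lipConst_loss_sub_le_of_net hN hL (Q := empirical fun j => y j ω)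
        (Q' := minLaw P (g ω)) hτ0 hX hY s hnet fun p hp => by
          have hnot : ω ∉ E p := fun hω => hb (Set.mem_biUnion hp hω)
          have : |(∑ j, q p (argminSel (g ω - σ j ω))) / m - ∫ z, q p (argminSel (g ω - z)) ∂P| ≤ τ :=
            (not_le.1 hnot).le
          rw [integral_empirical, integral_minLaw inferInstance _ (h.continuous_diffQuot p.1 p.2)]
          simpa only [hω] using this
      have h1 := pow_le_pow_left₀ (lipConst_nonneg _) hle 2
      have h2 : (L * D / m) ^ 2 ≤ D ^ 2 * L ^ 2 / m := by
        rw [div_pow, mul_pow, mul_comm (L ^ 2)]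
        gcongr
        nlinarith
      nlinarith [sq_nonneg (τ - 6 * (L * D / m))]
  · rw [integral_add (integrable_const _) ((integrable_const _).indicator hbad),
      integral_indicator_const _ hbad]
    simp only [integral_const, probReal_univ, smul_eq_mul, one_mul]
    rw [mul_comm (μ.real bad), hτ2]
    have h1 : 2 * (2 * G ^ 2 * Real.log (2 * M * m) / m)
        ≤ 28 * (d * G ^ 2 * Real.log (2 * m) / m) := by
      have := mul_le_mul_of_nonneg_left (log_net_le hd hm) (by positivity : 0 ≤ 4 * G ^ 2 / m)
      calc _ = 4 * G ^ 2 / m * Real.log (2 * M * m) := by ring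
        _ ≤ _ := this
        _ = _ := by ring
    have h2 : 4 * G ^ 2 / m ≤ 12 * (d * G ^ 2 * Real.log (2 * m) / m) := by
      -- The contribution of the bad event carries no logarithm; since log(2m) ≥ log 2 > 1/3, it is
      -- absorbed into the logarithmic term.
      have h3 : (1 : ℝ) ≤ 3 * (d * Real.log (2 * m)) := by
        have := le_mul_of_one_le_left (by linarith : 0 ≤ Real.log (2 * m)) hd'
        linarith
      have := mul_le_mul_of_nonneg_left h3 (by positivity : 0 ≤ 4 * G ^ 2 / m)
      calc _ = 4 * G ^ 2 / m * 1 := by ring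
        _ ≤ _ := this
        _ = _ := by ring
    linarith

end Samples

/-! ### Independence of the noise -/

section Independence

variable {Ω : Type*} {mΩ : MeasurableSpace Ω} {μ : Measure Ω}

theorem iIndep_sumElim {ι κ : Type*} {m₁ : ι → MeasurableSpace Ω} {m₂ : κ → MeasurableSpace Ω}
    (h₁ : iIndep m₁ μ) (h₂ : iIndep m₂ μ) (h : Indep (⨆ i, m₁ i) (⨆ j, m₂ j) μ) :
    iIndep (Sum.elim m₁ m₂) μ := by
  refine (iIndep_iff _ _).2 fun s A hA => ?_
  have e : ⋂ i ∈ s, A i = (⋂ i ∈ s.toLeft, A (Sum.inl i)) ∩ ⋂ j ∈ s.toRight, A (Sum.inr j) := by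
    ext ω
    simp [Finset.mem_toLeft, Finset.mem_toRight]
  have hA₁ : ∀ i ∈ s.toLeft, MeasurableSet[m₁ i] (A (Sum.inl i)) := fun i hi =>
    hA _ (Finset.mem_toLeft.1 hi)
  have hA₂ : ∀ j ∈ s.toRight, MeasurableSet[m₂ j] (A (Sum.inr j)) := fun j hj =>
    hA _ (Finset.mem_toRight.1 hj)
  rw [e, (Indep_iff _ _ _).1 h _ _
    (Finset.measurableSet_biInter _ fun i hi => le_iSup m₁ i _ (hA₁ i hi))
    (Finset.measurableSet_biInter _ fun j hj => le_iSup m₂ j _ (hA₂ j hj)),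
    (iIndep_iff _ _).1 h₁ _ hA₁, (iIndep_iff _ _).1 h₂ _ hA₂]
  conv_rhs => rw [← s.toLeft_disjSum_toRight, Finset.prod_disjSum]

/-- `φ` coincides almost surely with a function that is measurable for the sub-σ-algebra `m`. -/
def AEMeasurableFor {β : Type*} [MeasurableSpace β] (m : MeasurableSpace Ω)
    (μ : @Measure Ω mΩ) (φ : Ω → β) : Prop :=
  ∃ ψ : Ω → β, Measurable[m] ψ ∧ φ =ᵐ[μ] ψ

namespace AEMeasurableFor

variable {β γ : Type*} [MeasurableSpace β] [MeasurableSpace γ] {m m' : MeasurableSpace Ω}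
  {φ : Ω → β} {φ' : Ω → γ}

theorem mono (h : AEMeasurableFor m μ φ) (hm : m ≤ m') : AEMeasurableFor m' μ φ := by
  obtain ⟨ψ, hψ, h⟩ := h
  exact ⟨ψ, hψ.mono hm le_rfl, h⟩

theorem congr {ψ : Ω → β} (h : AEMeasurableFor m μ φ) (hψ : ψ =ᵐ[μ] φ) : AEMeasurableFor m μ ψ := by
  obtain ⟨ψ', hψ', h⟩ := h
  exact ⟨ψ', hψ', hψ.trans h⟩

theorem comp {F : β → γ} (hF : Measurable F) (h : AEMeasurableFor m μ φ) :
    AEMeasurableFor m μ fun ω => F (φ ω) := by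
  obtain ⟨ψ, hψ, h⟩ := h
  exact ⟨fun ω => F (ψ ω), hF.comp hψ, h.fun_comp F⟩

theorem prodMk (h : AEMeasurableFor m μ φ) (h' : AEMeasurableFor m μ φ') :
    AEMeasurableFor m μ fun ω => (φ ω, φ' ω) := by
  obtain ⟨ψ, hψ, h⟩ := h
  obtain ⟨ψ', hψ', h'⟩ := h'
  exact ⟨fun ω => (ψ ω, ψ' ω), hψ.prodMk hψ', h.prodMk h'⟩

theorem pi {ι : Type*} [Countable ι] {φ : ι → Ω → β} (h : ∀ i, AEMeasurableFor m μ (φ i)) :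
    AEMeasurableFor m μ fun ω i => φ i ω := by
  choose ψ hψ h using h
  refine ⟨fun ω i => ψ i ω, @measurable_pi_lambda _ _ _ m _ _ hψ, ?_⟩
  filter_upwards [ae_all_iff.2 h] with ω hω
  exact funext hω

theorem indepFun (hm : Indep m m' μ) (h : AEMeasurableFor m μ φ) (h' : AEMeasurableFor m' μ φ') :
    IndepFun φ φ' μ := by
  obtain ⟨ψ, hψ, h⟩ := h
  obtain ⟨ψ', hψ', h'⟩ := h'
  refine IndepFun.congr ?_ h.symm h'.symm
  exact (IndepFun_iff_Indep _ _ _).2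
    (indep_of_indep_of_le_left (indep_of_indep_of_le_right hm hψ'.comap_le) hψ.comap_le)

end AEMeasurableFor

theorem measurable_lipClass_sum {d : ℕ} {N : Seminorm ℝ (Vec d)} {X : Set (Vec d)} {ι : Type*}
    {m : MeasurableSpace Ω} (s : Finset ι) {φ : ι → Ω → LipClass N X}
    (h : ∀ i ∈ s, Measurable[m] (φ i)) : Measurable[m] fun ω => ∑ i ∈ s, φ i ω := by
  refine (@measurable_lipClass_iff _ _ _ _ m _).2 fun x => ?_
  have e : (fun ω => (∑ i ∈ s, φ i ω).1 x) = fun ω => ∑ i ∈ s, (φ i ω).1 x := by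
    funext ω
    rw [Submodule.coe_sum, Finset.sum_apply]
  rw [e]
  exact Finset.measurable_sum _ fun i hi => (@measurable_lipClass_iff _ _ _ _ m _).1 (h i hi) x

theorem AEMeasurableFor.sum {d : ℕ} {N : Seminorm ℝ (Vec d)} {X : Set (Vec d)} {ι : Type*}
    {m : MeasurableSpace Ω} (s : Finset ι) {φ : ι → Ω → LipClass N X}
    (h : ∀ i ∈ s, AEMeasurableFor m μ (φ i)) : AEMeasurableFor m μ fun ω => ∑ i ∈ s, φ i ω := by
  choose! ψ hψ h using h
  refine ⟨fun ω => ∑ i ∈ s, ψ i ω, measurable_lipClass_sum s hψ, ?_⟩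
  filter_upwards [(Filter.eventually_all_finset s).2 h] with ω hω
  exact Finset.sum_congr rfl hω

theorem measurable_lipClass_add {d : ℕ} {N : Seminorm ℝ (Vec d)} {X : Set (Vec d)} :
    Measurable fun p : LipClass N X × LipClass N X => p.1 + p.2 :=
  measurable_lipClass_iff.2 fun x =>
    ((measurable_lipClass_eval x).comp measurable_fst).add
      ((measurable_lipClass_eval x).comp measurable_snd)

end Independence

theorem SmoothGame.measurable_loss_empirical {d : ℕ} {N : Seminorm ℝ (Vec d)} {X Y : Set (Vec d)}
    [CompactSpace Y] {f : Vec d → Vec d → ℝ} {G L : ℝ} (h : SmoothGame N X Y f G L) {m : ℕ}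
    [NeZero m] : Measurable fun w : Fin m → Y => h.loss (empirical w) := by
  refine measurable_lipClass_iff.2 fun u => ?_
  simp only [loss_apply, integral_empirical]
  exact (Finset.measurable_sum _ fun j _ =>
    (h.continuous_right u).measurable.comp (measurable_pi_apply j)).div_const _

theorem isPerturbedMin_of_neg {α : Type*} {g g' σ : α → ℝ} (hg : ∀ v, g' v = -g v) {y : α}
    (h : IsPerturbedMax g σ y) : IsPerturbedMin g' σ y := fun y' => by
  have := h y'
  rw [hg, hg]
  linarith

/-! ### The game -/

namespace OFTPLGameRun

variable {d : ℕ} {N : Seminorm ℝ (Vec d)} {X Y : Set (Vec d)} {f : Vec d → Vec d → ℝ} {G L : ℝ}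
  {P₁ : Measure (LipClass N X)} {P₂ : Measure (LipClass N Y)} {m T : ℕ}
  {Ω : Type*} [MeasurableSpace Ω] {μ : Measure Ω}

/-- The run seen from the other player. -/
def swap (r : OFTPLGameRun f P₁ P₂ m T μ) : OFTPLGameRun (fun y x => -f x y) P₂ P₁ m T μ where
  σ₁ := r.σ₂
  σ₂ := r.σ₁
  xg := r.yg
  yg := r.xg
  x := r.y
  y := r.x
  measurable_σ₁ := r.measurable_σ₂
  measurable_σ₂ := r.measurable_σ₁
  measurable_xg := r.measurable_yg
  measurable_yg := r.measurable_xg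
  measurable_x := r.measurable_y
  measurable_y := r.measurable_x
  law_σ₁ := r.law_σ₂
  law_σ₂ := r.law_σ₁
  indep_σ₁ := r.indep_σ₂
  indep_σ₂ := r.indep_σ₁
  indep_σ₁_σ₂ := r.indep_σ₁_σ₂.symm
  guess_x t j := (r.guess_y t j).mono fun ω h => isPerturbedMin_of_neg (fun v => by
    simp only [integral_neg, Finset.sum_neg_distrib]) h
  guess_y t j := (r.guess_x t j).mono fun ω h v => by
    have := h v
    simp only [integral_neg, Finset.sum_neg_distrib] at this ⊢
    linarith
  play_x t j := (r.play_y t j).mono fun ω h => isPerturbedMin_of_neg (fun v => by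
    simp only [integral_neg, Finset.sum_neg_distrib, neg_add]) h
  play_y t j := (r.play_x t j).mono fun ω h v => by
    have := h v
    simp only [integral_neg, Finset.sum_neg_distrib] at this ⊢
    linarith

section Noise

/-- The σ-algebra generated by the perturbations with index in `S₁` of the first player and with
index in `S₂` of the second player. -/
abbrev noise (r : OFTPLGameRun f P₁ P₂ m T μ) (S₁ S₂ : Set (Bool × Fin T × Fin m)) :
    MeasurableSpace Ω :=
  (⨆ i ∈ S₁, MeasurableSpace.comap (r.σ₁ i.1 i.2.1 i.2.2) inferInstance) ⊔
    ⨆ i ∈ S₂, MeasurableSpace.comap (r.σ₂ i.1 i.2.1 i.2.2) inferInstance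

theorem noise_swap (r : OFTPLGameRun f P₁ P₂ m T μ) (S₁ S₂ : Set (Bool × Fin T × Fin m)) :
    r.swap.noise S₁ S₂ = r.noise S₂ S₁ := sup_comm _ _

theorem noise_mono (r : OFTPLGameRun f P₁ P₂ m T μ) {S₁ S₂ S₁' S₂' : Set (Bool × Fin T × Fin m)}
    (h₁ : S₁ ⊆ S₁') (h₂ : S₂ ⊆ S₂') : r.noise S₁ S₂ ≤ r.noise S₁' S₂' :=
  sup_le_sup (biSup_mono h₁) (biSup_mono h₂)

/-- The noises of the two players form one jointly independent family over the disjoint union of the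
index sets; disjoint blocks of it are independent. -/
theorem indep_noise (r : OFTPLGameRun f P₁ P₂ m T μ) {S₁ S₂ S₁' S₂' : Set (Bool × Fin T × Fin m)}
    (h₁ : Disjoint S₁ S₁') (h₂ : Disjoint S₂ S₂') : Indep (r.noise S₁ S₂) (r.noise S₁' S₂') μ := by
  set m₁ := fun i : Bool × Fin T × Fin m =>
    MeasurableSpace.comap (r.σ₁ i.1 i.2.1 i.2.2) inferInstance with hm₁
  set m₂ := fun i : Bool × Fin T × Fin m =>
    MeasurableSpace.comap (r.σ₂ i.1 i.2.1 i.2.2) inferInstance with hm₂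
  have hcross : Indep (⨆ i, m₁ i) (⨆ i, m₂ i) μ := by
    refine indep_of_indep_of_le_left (indep_of_indep_of_le_right
      ((IndepFun_iff_Indep _ _ _).1 r.indep_σ₁_σ₂) (iSup_le fun i => ?_)) (iSup_le fun i => ?_)
    · exact Measurable.comap_le ((measurable_pi_apply i).comp (comap_measurable
        (fun ω (i : Bool × Fin T × Fin m) => r.σ₂ i.1 i.2.1 i.2.2 ω)))
    · exact Measurable.comap_le ((measurable_pi_apply i).comp (comap_measurable
        (fun ω (i : Bool × Fin T × Fin m) => r.σ₁ i.1 i.2.1 i.2.2 ω)))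
  have hind : iIndep (Sum.elim m₁ m₂) μ :=
    iIndep_sumElim ((iIndepFun_iff_iIndep _ _ _).1 r.indep_σ₁)
      ((iIndepFun_iff_iIndep _ _ _).1 r.indep_σ₂) hcross
  have e : ∀ S₁ S₂, r.noise S₁ S₂
      = ⨆ j ∈ (Sum.inl '' S₁ ∪ Sum.inr '' S₂ : Set (_ ⊕ _)), Sum.elim m₁ m₂ j := fun S₁ S₂ => by
    rw [iSup_union, iSup_image, iSup_image]
    rfl
  rw [e, e]
  refine indep_iSup_of_disjoint ?_ hind ?_
  · rintro (i | i)
    · exact (r.measurable_σ₁ _ _ _).comap_le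
    · exact (r.measurable_σ₂ _ _ _).comap_le
  · rw [Set.disjoint_left] at *
    rintro _ (⟨i, hi, rfl⟩ | ⟨i, hi, rfl⟩) (⟨j, hj, hij⟩ | ⟨j, hj, hij⟩)
    · exact h₁ hi (Sum.inl.inj hij ▸ hj)
    · cases hij
    · cases hij
    · exact h₂ hi (Sum.inr.inj hij ▸ hj)

theorem aemeasurableFor_σ₁ (r : OFTPLGameRun f P₁ P₂ m T μ) (b : Bool) (t : Fin T) (j : Fin m) :
    AEMeasurableFor (r.noise {i | i.1 = b ∧ i.2.1 = t} ∅) μ (r.σ₁ b t j) := by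
  refine ⟨r.σ₁ b t j, ?_, Filter.EventuallyEq.rfl⟩
  refine (comap_measurable (r.σ₁ b t j)).mono ?_ le_rfl
  refine le_sup_of_le_left ?_
  exact le_biSup (fun i : Bool × Fin T × Fin m =>
    MeasurableSpace.comap (r.σ₁ i.1 i.2.1 i.2.2) inferInstance)
    (show ((b, t, j) : Bool × Fin T × Fin m) ∈ {i : Bool × Fin T × Fin m | i.1 = b ∧ i.2.1 = t} from
      ⟨rfl, rfl⟩)

theorem map_σ₁ [IsProbabilityMeasure μ] (r : OFTPLGameRun f P₁ P₂ m T μ) (b : Bool) (t : Fin T) :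
    μ.map (fun ω j => r.σ₁ b t j ω) = Measure.pi fun _ => P₁ := by
  have hinj : Function.Injective fun j : Fin m => ((b, t, j) : Bool × Fin T × Fin m) :=
    fun j j' h => (Prod.mk.inj (Prod.mk.inj h).2).2
  have := r.indep_σ₁.precomp hinj
  rw [(iIndepFun_iff_map_fun_eq_pi_map fun j => (r.measurable_σ₁ b t j).aemeasurable).1 this]
  simp only [r.law_σ₁]

end Noise

variable [CompactSpace X] [Nonempty X] [CompactSpace Y] [Nonempty Y]
  [IsProbabilityMeasure P₁] [IsProbabilityMeasure P₂] [HasUniqueMin P₁] [HasUniqueMin P₂]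
  [NeZero m] [IsProbabilityMeasure μ]

/-- The cumulative loss `∑_{i<t} f(·, Q_i)` of the first player before round `t`. -/
noncomputable def cumLoss (r : OFTPLGameRun f P₁ P₂ m T μ) (h : SmoothGame N X Y f G L) (t : Fin T)
    (ω : Ω) : LipClass N X :=
  ∑ i ∈ Finset.Iio t, h.loss (empirical fun k => r.y i k ω)

/-- The cumulative loss of the first player before round `t` with the guess for round `t`. -/
noncomputable def optLoss (r : OFTPLGameRun f P₁ P₂ m T μ) (h : SmoothGame N X Y f G L) (t : Fin T)
    (ω : Ω) : LipClass N X :=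
  r.cumLoss h t ω + h.loss (empirical fun k => r.yg t k ω)

section

variable (r : OFTPLGameRun f P₁ P₂ m T μ) (h : SmoothGame N X Y f G L)

omit [CompactSpace X] [Nonempty X] [Nonempty Y] [IsProbabilityMeasure P₁] [IsProbabilityMeasure P₂]
  [HasUniqueMin P₁] [HasUniqueMin P₂] [IsProbabilityMeasure μ]

theorem measurable_cumLoss (t : Fin T) : Measurable (r.cumLoss h t) :=
  measurable_lipClass_sum _ fun i _ =>
    h.measurable_loss_empirical.comp (measurable_pi_lambda _ fun k => r.measurable_y i k)

theorem measurable_optLoss (t : Fin T) : Measurable (r.optLoss h t) :=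
  measurable_lipClass_add.comp ((r.measurable_cumLoss h t).prodMk
    (h.measurable_loss_empirical.comp (measurable_pi_lambda _ fun k => r.measurable_yg t k)))

theorem cumLoss_apply (t : Fin T) (ω : Ω) (u : X) : (r.cumLoss h t ω).1 u
    = ∑ i ∈ Finset.Iio t, ∫ v : Y, f u v ∂(empirical fun k => r.y i k ω) := by
  rw [cumLoss, Submodule.coe_sum, Finset.sum_apply]
  rfl

theorem aemeasurableFor_cumLoss {S₁ S₂ : Set (Bool × Fin T × Fin m)} {t : Fin T}
    (hy : ∀ i < t, ∀ k, AEMeasurableFor (r.noise S₁ S₂) μ (r.y i k)) :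
    AEMeasurableFor (r.noise S₁ S₂) μ (r.cumLoss h t) :=
  AEMeasurableFor.sum _ fun i hi =>
    (AEMeasurableFor.pi (hy i (Finset.mem_Iio.1 hi))).comp h.measurable_loss_empirical

theorem aemeasurableFor_optLoss {S₁ S₂ : Set (Bool × Fin T × Fin m)} {t : Fin T}
    (hy : ∀ i < t, ∀ k, AEMeasurableFor (r.noise S₁ S₂) μ (r.y i k))
    (hyg : ∀ k, AEMeasurableFor (r.noise S₁ S₂) μ (r.yg t k)) :
    AEMeasurableFor (r.noise S₁ S₂) μ (r.optLoss h t) :=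
  ((r.aemeasurableFor_cumLoss h hy).prodMk
    ((AEMeasurableFor.pi hyg).comp h.measurable_loss_empirical)).comp
    (F := fun p : LipClass N X × LipClass N X => p.1 + p.2) measurable_lipClass_add

end

/-- The indices of the perturbations drawn before round `t`. -/
def past (m : ℕ) (t : Fin T) : Set (Bool × Fin T × Fin m) := {i | i.2.1 < t}

/-- The indices of the perturbations drawn before the actions of round `t`. -/
def pastGuess (m : ℕ) (t : Fin T) : Set (Bool × Fin T × Fin m) :=
  {i | i.2.1 < t ∨ i.1 = false ∧ i.2.1 = t}

/-- The indices of the perturbations drawn up to round `t`. -/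
def upTo (m : ℕ) (t : Fin T) : Set (Bool × Fin T × Fin m) := {i | i.2.1 ≤ t}

omit [NeZero m] in
theorem past_subset_pastGuess (t : Fin T) : past m t ⊆ pastGuess m t := fun _ h => Or.inl h

omit [NeZero m] in
theorem pastGuess_subset_upTo (t : Fin T) : pastGuess m t ⊆ upTo m t := by
  rintro i (h | h)
  · exact le_of_lt h
  · exact h.2.le

omit [NeZero m] in
theorem guess_subset_pastGuess (t : Fin T) :
    {i : Bool × Fin T × Fin m | i.1 = false ∧ i.2.1 = t} ⊆ pastGuess m t := fun _ h => Or.inr h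

omit [NeZero m] in
theorem play_subset_upTo (t : Fin T) :
    {i : Bool × Fin T × Fin m | i.1 = true ∧ i.2.1 = t} ⊆ upTo m t := fun _ h => h.2.le

omit [NeZero m] in
theorem upTo_subset_past {i t : Fin T} (hi : i < t) : upTo m i ⊆ past m t :=
  fun _ h => lt_of_le_of_lt h hi

omit [NeZero m] in
theorem disjoint_past (t : Fin T) (b : Bool) :
    Disjoint (past m t) {i : Bool × Fin T × Fin m | i.1 = b ∧ i.2.1 = t} :=
  Set.disjoint_left.2 fun _ h h' => (ne_of_lt h) h'.2

omit [NeZero m] in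
theorem disjoint_pastGuess (t : Fin T) :
    Disjoint (pastGuess m t) {i : Bool × Fin T × Fin m | i.1 = true ∧ i.2.1 = t} := by
  refine Set.disjoint_left.2 ?_
  rintro i (h | h) h'
  · exact (ne_of_lt h) h'.2
  · exact Bool.false_ne_true (h.1.symm.trans h'.1)

variable (r : OFTPLGameRun f P₁ P₂ m T μ) (h : SmoothGame N X Y f G L)

section Step

omit [Nonempty Y] [IsProbabilityMeasure P₂] [HasUniqueMin P₂]

/-- The measurability of the opponent's earlier actions is a hypothesis here because this lemma
serves in the induction that establishes it. -/
theorem xg_ae_eq_of_past {t : Fin T}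
    (hy : ∀ i < t, ∀ k, AEMeasurableFor (r.noise (past m t) (past m t)) μ (r.y i k)) (j : Fin m) :
    r.xg t j =ᵐ[μ] fun ω => argminSel (r.cumLoss h t ω - r.σ₁ false t j ω) := by
  refine ae_eq_argminSel inferInstance (r.measurable_cumLoss h t) (r.measurable_σ₁ _ _ _)
    (r.law_σ₁ _ _ _) ((r.aemeasurableFor_cumLoss h hy).indepFun
      (r.indep_noise (disjoint_past t false) disjoint_bot_right) (r.aemeasurableFor_σ₁ _ _ _)) ?_
  filter_upwards [r.guess_x t j] with ω hω
  have e : (r.cumLoss h t ω).1 = _ := funext (r.cumLoss_apply h t ω)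
  rwa [e]

include h in
theorem aemeasurableFor_xg_of_past {t : Fin T}
    (hy : ∀ i < t, ∀ k, AEMeasurableFor (r.noise (past m t) (past m t)) μ (r.y i k)) (j : Fin m) :
    AEMeasurableFor (r.noise (pastGuess m t) (past m t)) μ (r.xg t j) :=
  ((((r.aemeasurableFor_cumLoss h hy).mono
    (r.noise_mono (past_subset_pastGuess t) subset_rfl)).prodMk
      ((r.aemeasurableFor_σ₁ false t j).mono
        (r.noise_mono (guess_subset_pastGuess t) (Set.empty_subset _)))).comp
      (measurable_argminSel.comp measurable_lipClass_sub)).congr (r.xg_ae_eq_of_past h hy j)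

variable {t : Fin T}
  (hy : ∀ i < t, ∀ k, AEMeasurableFor (r.noise (past m t) (past m t)) μ (r.y i k))
  (hyg : ∀ k, AEMeasurableFor (r.noise (past m t) (pastGuess m t)) μ (r.yg t k))

include hy hyg

omit [CompactSpace X] [Nonempty X] [HasUniqueMin P₁] [IsProbabilityMeasure P₁]
  [IsProbabilityMeasure μ] in
theorem aemeasurableFor_optLoss_of_past :
    AEMeasurableFor (r.noise (pastGuess m t) (pastGuess m t)) μ (r.optLoss h t) :=
  r.aemeasurableFor_optLoss h
    (fun i hi k => (hy i hi k).mono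
      (r.noise_mono (past_subset_pastGuess t) (past_subset_pastGuess t)))
    fun k => (hyg k).mono (r.noise_mono (past_subset_pastGuess t) subset_rfl)

theorem x_ae_eq_of_past (j : Fin m) :
    r.x t j =ᵐ[μ] fun ω => argminSel (r.optLoss h t ω - r.σ₁ true t j ω) := by
  refine ae_eq_argminSel inferInstance (r.measurable_optLoss h t) (r.measurable_σ₁ _ _ _)
    (r.law_σ₁ _ _ _) ((r.aemeasurableFor_optLoss_of_past h hy hyg).indepFun
      (r.indep_noise (disjoint_pastGuess t) disjoint_bot_right) (r.aemeasurableFor_σ₁ _ _ _)) ?_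
  filter_upwards [r.play_x t j] with ω hω
  have e : (r.optLoss h t ω).1 = fun u : X =>
      (∑ i ∈ Finset.Iio t, ∫ v : Y, f u v ∂(empirical fun k => r.y i k ω))
        + ∫ v : Y, f u v ∂(empirical fun k => r.yg t k ω) := by
    funext u
    rw [← r.cumLoss_apply h]
    rfl
  rwa [e]

include h in
theorem aemeasurableFor_x_of_past (j : Fin m) :
    AEMeasurableFor (r.noise (upTo m t) (pastGuess m t)) μ (r.x t j) :=
  ((((r.aemeasurableFor_optLoss_of_past h hy hyg).mono
    (r.noise_mono (pastGuess_subset_upTo t) subset_rfl)).prodMk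
      ((r.aemeasurableFor_σ₁ true t j).mono
        (r.noise_mono (play_subset_upTo t) (Set.empty_subset _)))).comp
      (measurable_argminSel.comp measurable_lipClass_sub)).congr (r.x_ae_eq_of_past h hy hyg j)

end Step

include h in
-- Strong induction on the round. Earlier actions determine both guesses, and these together with
-- earlier actions determine both losses faced in the round; fresh noise then determines the
-- actions. The exchange of players turns each statement about x into one about y.
theorem aemeasurableFor_upTo (t : Fin T) :
    (∀ j, AEMeasurableFor (r.noise (upTo m t) (upTo m t)) μ (r.x t j)) ∧
      ∀ j, AEMeasurableFor (r.noise (upTo m t) (upTo m t)) μ (r.y t j) := by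
  induction t using WellFoundedLT.induction with
  | ind t ih =>
    have hx : ∀ i < t, ∀ k, AEMeasurableFor (r.swap.noise (past m t) (past m t)) μ (r.swap.y i k) :=
      fun i hi k => (((ih i hi).1 k).mono
        (r.noise_mono (upTo_subset_past hi) (upTo_subset_past hi))).mono (r.noise_swap _ _).ge
    have hy : ∀ i < t, ∀ k, AEMeasurableFor (r.noise (past m t) (past m t)) μ (r.y i k) :=
      fun i hi k => ((ih i hi).2 k).mono (r.noise_mono (upTo_subset_past hi) (upTo_subset_past hi))
    have hxg : ∀ k, AEMeasurableFor (r.swap.noise (past m t) (pastGuess m t)) μ (r.swap.yg t k) :=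
      fun k => (r.aemeasurableFor_xg_of_past h hy k).mono (r.noise_swap _ _).ge
    have hyg : ∀ k, AEMeasurableFor (r.noise (past m t) (pastGuess m t)) μ (r.yg t k) :=
      fun k => (r.swap.aemeasurableFor_xg_of_past h.swap hx k).mono (r.noise_swap _ _).le
    refine ⟨fun j => (r.aemeasurableFor_x_of_past h hy hyg j).mono
      (r.noise_mono subset_rfl (pastGuess_subset_upTo t)), fun j => ?_⟩
    refine (r.swap.aemeasurableFor_x_of_past h.swap hx hxg j).mono ?_
    rw [r.noise_swap]
    exact r.noise_mono (pastGuess_subset_upTo t) subset_rfl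

include h in
theorem aemeasurableFor_past {t i : Fin T} (hi : i < t) (k : Fin m) :
    AEMeasurableFor (r.noise (past m t) (past m t)) μ (r.y i k) :=
  ((r.aemeasurableFor_upTo h i).2 k).mono
    (r.noise_mono (upTo_subset_past hi) (upTo_subset_past hi))

include h in
theorem aemeasurableFor_yg (t : Fin T) (k : Fin m) :
    AEMeasurableFor (r.noise (past m t) (pastGuess m t)) μ (r.yg t k) :=
  (r.swap.aemeasurableFor_xg_of_past h.swap
    (fun _ hi k => r.swap.aemeasurableFor_past h.swap hi k) k).mono (r.noise_swap _ _).le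

include h in
-- The first index set is the essential point: the second player's action does not involve the first
-- player's action noise of the same round.
theorem aemeasurableFor_y (t : Fin T) (k : Fin m) :
    AEMeasurableFor (r.noise (pastGuess m t) (upTo m t)) μ (r.y t k) :=
  (r.swap.aemeasurableFor_x_of_past h.swap
    (fun _ hi k => r.swap.aemeasurableFor_past h.swap hi k)
    (fun k => r.swap.aemeasurableFor_yg h.swap t k) k).mono (r.noise_swap _ _).le

theorem xg_ae_eq (t : Fin T) (j : Fin m) :
    r.xg t j =ᵐ[μ] fun ω => argminSel (r.cumLoss h t ω - r.σ₁ false t j ω) :=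
  r.xg_ae_eq_of_past h (fun _ hi k => r.aemeasurableFor_past h hi k) j

theorem x_ae_eq (t : Fin T) (j : Fin m) :
    r.x t j =ᵐ[μ] fun ω => argminSel (r.optLoss h t ω - r.σ₁ true t j ω) :=
  r.x_ae_eq_of_past h (fun _ hi k => r.aemeasurableFor_past h hi k) (r.aemeasurableFor_yg h t) j

theorem indepFun_cumLoss (t : Fin T) :
    IndepFun (r.cumLoss h t) (fun ω j => r.σ₁ false t j ω) μ :=
  (r.aemeasurableFor_cumLoss h (fun _ hi k => r.aemeasurableFor_past h hi k)).indepFun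
    (r.indep_noise (disjoint_past t false) disjoint_bot_right)
    (AEMeasurableFor.pi fun j => r.aemeasurableFor_σ₁ false t j)

/-- The opponent's current action is included, since the player's loss in this round depends on it;
its independence of the fresh noise makes the empirical play unbiased. -/
theorem indepFun_optLoss (t : Fin T) :
    IndepFun (fun ω => (r.optLoss h t ω, fun k => r.y t k ω)) (fun ω j => r.σ₁ true t j ω) μ :=
  (((r.aemeasurableFor_optLoss_of_past h (fun _ hi k => r.aemeasurableFor_past h hi k)
    (r.aemeasurableFor_yg h t)).mono
      (r.noise_mono subset_rfl (pastGuess_subset_upTo t))).prodMk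
    (AEMeasurableFor.pi (r.aemeasurableFor_y h t))).indepFun
    (r.indep_noise (disjoint_pastGuess t) disjoint_bot_right)
    (AEMeasurableFor.pi fun j => r.aemeasurableFor_σ₁ true t j)

end OFTPLGameRun

/-! ### Regrets and duality gap of a run -/

namespace OFTPLGameRun

variable {d : ℕ} {N : Seminorm ℝ (Vec d)} {X Y : Set (Vec d)} {f : Vec d → Vec d → ℝ} {G L : ℝ}
  {P₁ : Measure (LipClass N X)} {P₂ : Measure (LipClass N Y)} {m T : ℕ}
  {Ω : Type*} [MeasurableSpace Ω] {μ : Measure Ω}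
  [CompactSpace X] [Nonempty X] [CompactSpace Y] [Nonempty Y]
  [IsProbabilityMeasure P₁] [IsProbabilityMeasure P₂] [HasUniqueMin P₁] [HasUniqueMin P₂]
  [NeZero m] [IsProbabilityMeasure μ]
  (r : OFTPLGameRun f P₁ P₂ m T μ) (h : SmoothGame N X Y f G L)

/-- The loss `f(·, Q_t)` of the first player in round `t`. -/
noncomputable def roundLoss (t : Fin T) (ω : Ω) : LipClass N X :=
  h.loss (empirical fun k => r.y t k ω)

omit [CompactSpace X] [Nonempty X] [Nonempty Y] [IsProbabilityMeasure P₁] [IsProbabilityMeasure P₂]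
  [HasUniqueMin P₁] [HasUniqueMin P₂] [IsProbabilityMeasure μ] in
theorem measurable_roundLoss (t : Fin T) : Measurable (r.roundLoss h t) :=
  h.measurable_loss_empirical.comp (measurable_pi_lambda _ fun k => r.measurable_y t k)

omit [Nonempty X] [Nonempty Y] [CompactSpace X] [NeZero m] in
theorem _root_.SmoothGame.abs_loss_le (h : SmoothGame N X Y f G L) {R : ℝ}
    (hR : ∀ (x : X) (y : Y), |f x y| ≤ R)
    (Q : Measure Y) [IsProbabilityMeasure Q] (u : X) : |(h.loss Q).1 u| ≤ R := by
  have := norm_integral_le_of_norm_le_const (μ := Q) (f := fun v : Y => f u v)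
    (Filter.Eventually.of_forall (hR u))
  simpa [SmoothGame.loss_apply] using this

omit [IsProbabilityMeasure P₁] [IsProbabilityMeasure P₂] [HasUniqueMin P₁] [HasUniqueMin P₂] in
theorem integrable_roundLoss (t : Fin T) {z : Ω → X} (hz : Measurable z) :
    Integrable (fun ω => (r.roundLoss h t ω).1 (z ω)) μ := by
  obtain ⟨R, hR⟩ := h.exists_bound
  exact Integrable.of_bound (measurable_lipClass_eval₂.comp
    ((r.measurable_roundLoss h t).prodMk hz)).aestronglyMeasurable R
    (Filter.Eventually.of_forall fun ω => h.abs_loss_le hR _ _)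

/-- Given the past and the action of the second player, an action of the first player is
distributed as the perturbed best response. -/
theorem integral_roundLoss_x (t : Fin T) (j : Fin m) :
    Integrable (fun ω => ∫ u, (r.roundLoss h t ω).1 u ∂minLaw P₁ (r.optLoss h t ω)) μ ∧
      ∫ ω, (r.roundLoss h t ω).1 (r.x t j ω) ∂μ
        = ∫ ω, ∫ u, (r.roundLoss h t ω).1 u ∂minLaw P₁ (r.optLoss h t ω) ∂μ := by
  obtain ⟨R, hR⟩ := h.exists_bound
  let H : (LipClass N X × (Fin m → Y)) × LipClass N X → ℝ := fun p =>
    (h.loss (empirical p.1.2)).1 (argminSel (p.1.1 - p.2))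
  have hH : Measurable H := measurable_lipClass_eval₂.comp
    ((h.measurable_loss_empirical.comp (measurable_snd.comp measurable_fst)).prodMk
      (measurable_argminSel.comp (measurable_lipClass_sub.comp
        ((measurable_fst.comp measurable_fst).prodMk measurable_snd))))
  obtain ⟨h1, h2⟩ := integral_eq_of_indepFun (μ := μ) (ν := P₁)
    (v := fun ω => (r.optLoss h t ω, fun k => r.y t k ω)) (σ := r.σ₁ true t j)
    ((r.measurable_optLoss h t).prodMk (measurable_pi_lambda _ fun k => r.measurable_y t k))
    (r.measurable_σ₁ true t j) (r.law_σ₁ true t j)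
    ((r.indepFun_optLoss h t).comp measurable_id (measurable_pi_apply j)) hH (R := R)
    fun p => h.abs_loss_le hR _ _
  have e : ∀ ω, ∫ s, H ((r.optLoss h t ω, fun k => r.y t k ω), s) ∂P₁
      = ∫ u, (r.roundLoss h t ω).1 u ∂minLaw P₁ (r.optLoss h t ω) := fun ω =>
    (integral_minLaw inferInstance (r.optLoss h t ω) (continuous_lipClass (r.roundLoss h t ω))).symm
  simp only [e] at h1 h2
  refine ⟨h1, h2 ▸ integral_congr_ae ?_⟩
  filter_upwards [r.x_ae_eq h t j] with ω hω
  rw [hω]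
  rfl

/-- The expected regret is the expected regret of the perturbed best responses. -/
theorem integral_regret_eq (x : X) :
    Integrable (fun ω => ∑ t, (∫ u, (r.roundLoss h t ω).1 u ∂(empirical fun j => r.x t j ω)
        - (r.roundLoss h t ω).1 x)) μ ∧
      Integrable (fun ω => ∑ t, (∫ u, (r.roundLoss h t ω).1 u ∂minLaw P₁ (r.optLoss h t ω)
        - (r.roundLoss h t ω).1 x)) μ ∧
      ∫ ω, ∑ t, (∫ u, (r.roundLoss h t ω).1 u ∂(empirical fun j => r.x t j ω)
        - (r.roundLoss h t ω).1 x) ∂μ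
        = ∫ ω, ∑ t, (∫ u, (r.roundLoss h t ω).1 u ∂minLaw P₁ (r.optLoss h t ω)
          - (r.roundLoss h t ω).1 x) ∂μ := by
  have hm : (m : ℝ) ≠ 0 := Nat.cast_ne_zero.2 (NeZero.ne m)
  have i1 := fun t => r.integrable_roundLoss h t (measurable_const (a := x))
  have i2 := fun t (j : Fin m) => r.integrable_roundLoss h t (r.measurable_x t j)
  have i3 := fun t => (r.integral_roundLoss_x h t ⟨0, Nat.pos_of_ne_zero (NeZero.ne m)⟩).1
  have i4 : ∀ t, Integrable
      (fun ω => ∫ u, (r.roundLoss h t ω).1 u ∂(empirical fun j => r.x t j ω)) μ := fun t => by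
    simp only [integral_empirical]
    exact (integrable_finsetSum _ fun j _ => i2 t j).div_const _
  have i5 : ∀ t, Integrable (fun ω => ∫ u, (r.roundLoss h t ω).1 u ∂(empirical fun j => r.x t j ω)
      - (r.roundLoss h t ω).1 x) μ := fun t => (i4 t).sub (i1 t)
  have i6 : ∀ t, Integrable (fun ω => ∫ u, (r.roundLoss h t ω).1 u ∂minLaw P₁ (r.optLoss h t ω)
      - (r.roundLoss h t ω).1 x) μ := fun t => (i3 t).sub (i1 t)
  refine ⟨integrable_finsetSum _ fun t _ => i5 t, integrable_finsetSum _ fun t _ => i6 t, ?_⟩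
  rw [integral_finsetSum _ fun t _ => i5 t, integral_finsetSum _ fun t _ => i6 t]
  refine Finset.sum_congr rfl fun t _ => ?_
  -- The comparator's terms agree; each of the `m` samples has the expected loss of the
  -- best-response law, and so has their average.
  rw [integral_sub (i4 t) (i1 t), integral_sub (i3 t) (i1 t)]
  congr 1
  simp only [integral_empirical]
  rw [integral_div, integral_finsetSum _ fun j _ => i2 t j,
    Finset.sum_congr rfl fun j _ => (r.integral_roundLoss_x h t j).2, Finset.sum_const,
    Finset.card_univ, Fintype.card_fin, nsmul_eq_mul, mul_div_cancel_left₀ _ hm]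

omit [IsProbabilityMeasure P₂] [HasUniqueMin P₂] [Nonempty Y] [IsProbabilityMeasure μ] in
/-- The regret of the perturbed best responses, in terms of arbitrary approximations `R t` and
`R' t` of the actions and of the predicted actions of the second player. -/
theorem regret_le (hL : 0 ≤ L) {β : ℝ} (hβ : 0 ≤ β) (hβL : 3 * (β * L) ^ 2 ≤ 1)
    (hint : Integrable (fun σ : LipClass N X => lipConst N σ.1) P₁)
    (hstab : IsStablePrediction N (minLaw P₁) β) (x : X) (ω : Ω) (R R' : Fin T → Measure Y)
    [∀ t, IsProbabilityMeasure (R t)] [∀ t, IsProbabilityMeasure (R' t)] :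
    ∑ t, (∫ u, (r.roundLoss h t ω).1 u ∂minLaw P₁ (r.optLoss h t ω) - (r.roundLoss h t ω).1 x)
      ≤ (∫ σ : LipClass N X, lipConst N σ.1 ∂P₁) * ipmDiam N X
        + (6 * β * ∑ t, (lipConst N (r.roundLoss h t ω - h.loss (R t)).1 ^ 2
            + lipConst N (h.loss (empirical fun k => r.yg t k ω) - h.loss (R' t)).1 ^ 2)
          + (∑ t, ipm N (R t) (R' t) ^ 2 / (3 * β)
            - ∑ t, ipm N (minLaw P₁ (r.optLoss h t ω)) (minLaw P₁ (r.cumLoss h t ω)) ^ 2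
                / (3 * β))) := by
  rw [Finset.mul_sum, ← Finset.sum_sub_distrib, ← Finset.sum_add_distrib]
  refine (sum_integral_minLaw_sub_le hβ inferInstance hint hstab x (fun t => r.roundLoss h t ω)
    fun t => h.loss (empirical fun k => r.yg t k ω)).trans ?_
  refine add_le_add_right (Finset.sum_le_sum fun t _ => ?_) _
  rw [← add_sub_assoc]
  refine sub_le_sub_right ?_ _
  set F := r.roundLoss h t ω
  set F' := h.loss (empirical fun k => r.yg t k ω)
  set a := lipConst N (F - h.loss (R t)).1
  set a' := lipConst N (F' - h.loss (R' t)).1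
  set b := ipm N (R t) (R' t)
  have ha : 0 ≤ a := lipConst_nonneg _
  have ha' : 0 ≤ a' := lipConst_nonneg _
  have hb : 0 ≤ b := ipm_nonneg _ _
  have hlip : lipConst N (F - F').1 ≤ L * b + (a + a') := by
    have e : (F - F').1 = (F - h.loss (R t)).1 + ((h.loss (R t) - h.loss (R' t)).1
        + -(F' - h.loss (R' t)).1) := by
      have : F - F' = (F - h.loss (R t)) + ((h.loss (R t) - h.loss (R' t))
        + -(F' - h.loss (R' t))) := by abel
      exact congrArg Subtype.val this
    rw [e]
    have hneg : -(F' - h.loss (R' t)).1 ∈ LipClass N X :=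
      (LipClass N X).neg_mem (F' - h.loss (R' t)).2
    have h1 := lipConst_add_le (F - h.loss (R t)).2
      ((LipClass N X).add_mem (h.loss (R t) - h.loss (R' t)).2 hneg)
    have h2 := lipConst_add_le (h.loss (R t) - h.loss (R' t)).2 hneg
    have h3 := h.lipConst_loss_sub_le_ipm hL (R t) (R' t)
    rw [lipConst_neg] at h2
    linarith
  have hsq := pow_le_pow_left₀ (lipConst_nonneg _) hlip 2
  -- With u = L·b and v = a + a', this is ¾(u + v)² ≤ u² + 3v², followed by v² ≤ 2(a² + a'²).
  have hyoung : 3 / 4 * (L * b + (a + a')) ^ 2 ≤ (L * b) ^ 2 + 6 * (a ^ 2 + a' ^ 2) := by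
    nlinarith [sq_nonneg (L * b - 3 * (a + a')), sq_nonneg (a - a')]
  -- This is where η > √3·CL enters: the movement of the opponent costs no more than the negative
  -- term in the opponent's own regret.
  have hquad : β * (L * b) ^ 2 ≤ b ^ 2 / (3 * β) := by
    rcases hβ.eq_or_lt with rfl | hβ
    · simp
    rw [le_div_iff₀ (by positivity)]
    calc β * (L * b) ^ 2 * (3 * β) = 3 * (β * L) ^ 2 * b ^ 2 := by ring
      _ ≤ 1 * b ^ 2 := mul_le_mul_of_nonneg_right hβL (sq_nonneg _)
      _ = b ^ 2 := one_mul _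
  calc 3 / 4 * β * lipConst N (F - F').1 ^ 2 ≤ 3 / 4 * β * (L * b + (a + a')) ^ 2 :=
        mul_le_mul_of_nonneg_left hsq (by positivity)
    _ = β * (3 / 4 * (L * b + (a + a')) ^ 2) := by ring
    _ ≤ β * ((L * b) ^ 2 + 6 * (a ^ 2 + a' ^ 2)) := mul_le_mul_of_nonneg_left hyoung hβ
    _ = 6 * β * (a ^ 2 + a' ^ 2) + β * (L * b) ^ 2 := by ring
    _ ≤ _ := by gcongr

/-- The sampling errors in a round, for the actions and the predicted actions of the second
player. -/
theorem exists_bound_round_error (hN : ∀ z, N z = 0 → z = 0) (hd : 1 ≤ d) (hG : 0 ≤ G)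
    (hL : 0 ≤ L) {D : ℝ} (hX : ipmDiam N X ≤ D) (hY : ipmDiam N Y ≤ D) (t : Fin T) :
    ∃ B : Ω → ℝ, Integrable B μ ∧
      (∀ᵐ ω ∂μ,
        lipConst N (r.roundLoss h t ω - h.loss (minLaw P₂ (r.swap.optLoss h.swap t ω))).1 ^ 2
        + lipConst N (h.loss (empirical fun k => r.yg t k ω)
          - h.loss (minLaw P₂ (r.swap.cumLoss h.swap t ω))).1 ^ 2 ≤ B ω) ∧
      ∫ ω, B ω ∂μ ≤ 2 * min (D ^ 2 * L ^ 2)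
        (72 * (D ^ 2 * L ^ 2 / m) + 40 * (d * G ^ 2 * Real.log (2 * m) / m)) := by
  obtain ⟨B, hB, hle, hint⟩ := h.exists_bound_sampling_error (μ := μ) hN hd hG hL hX hY (P := P₂)
    (r.swap.measurable_optLoss h.swap t) (σ := r.σ₂ true t) (r.measurable_σ₂ true t)
    (r.swap.map_σ₁ true t) ((r.swap.indepFun_optLoss h.swap t).comp measurable_fst measurable_id)
    (y := r.y t) (r.swap.x_ae_eq h.swap t)
  obtain ⟨B', hB', hle', hint'⟩ := h.exists_bound_sampling_error (μ := μ) hN hd hG hL hX hY (P := P₂)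
    (r.swap.measurable_cumLoss h.swap t) (σ := r.σ₂ false t) (r.measurable_σ₂ false t)
    (r.swap.map_σ₁ false t) (r.swap.indepFun_cumLoss h.swap t)
    (y := r.yg t) (r.swap.xg_ae_eq h.swap t)
  refine ⟨fun ω => B ω + B' ω, hB.add hB', ?_, ?_⟩
  · filter_upwards [hle, hle'] with ω h1 h2
    exact add_le_add h1 h2
  · rw [integral_add hB hB']
    linarith

omit [Nonempty X] [Nonempty Y] [IsProbabilityMeasure P₁] [IsProbabilityMeasure P₂]
  [HasUniqueMin P₁] [HasUniqueMin P₂] [IsProbabilityMeasure μ] in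
/-- The gap is the sum of the average regrets of the two players. -/
theorem gap_eq (x : X) (y : Y) (ω : Ω) : r.gap x y ω
    = (∑ t, (∫ u, (r.roundLoss h t ω).1 u ∂(empirical fun j => r.x t j ω) - (r.roundLoss h t ω).1 x)
      + ∑ t, (∫ v, (r.swap.roundLoss h.swap t ω).1 v ∂(empirical fun j => r.y t j ω)
        - (r.swap.roundLoss h.swap t ω).1 y)) / T := by
  have c1 := (h.continuous_left y).integrable_of_compactSpace
  have c2 := (h.continuous_right x).integrable_of_compactSpace
  have e : ∀ t, ∫ v, (r.swap.roundLoss h.swap t ω).1 v ∂(empirical fun j => r.y t j ω)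
      = - ∫ u, (r.roundLoss h t ω).1 u ∂(empirical fun j => r.x t j ω) := fun t => by
    rw [integral_empirical, integral_empirical, ← neg_div, ← Finset.sum_neg_distrib]
    simp only [roundLoss, SmoothGame.loss_apply, integral_empirical, ← neg_div,
      ← Finset.sum_neg_distrib, ← Finset.sum_div]
    rw [Finset.sum_comm]
    rfl
  have e2 : ∀ t, (r.swap.roundLoss h.swap t ω).1 y
      = - ∫ u : X, f u y ∂(empirical fun j => r.x t j ω) := fun t => integral_neg _
  have e3 : ∀ t, (r.roundLoss h t ω).1 x = ∫ v : Y, f x v ∂(empirical fun j => r.y t j ω) :=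
    fun t => rfl
  change ∫ u : X, f u y ∂(mixture fun t => empirical fun j => r.x t j ω)
    - ∫ v : Y, f x v ∂(mixture fun t => empirical fun j => r.y t j ω) = _
  rw [integral_mixture fun t => c1 (empirical fun j => r.x t j ω),
    integral_mixture fun t => c2 (empirical fun j => r.y t j ω), ← sub_div,
    ← Finset.sum_sub_distrib, ← Finset.sum_add_distrib]
  congr 1
  refine Finset.sum_congr rfl fun t _ => ?_
  -- The payoffs f(P_t, Q_t) enter the two regrets with opposite signs and cancel.
  rw [e, e2, e3]
  ring

omit [CompactSpace X] [Nonempty X] [Nonempty Y] [IsProbabilityMeasure P₁]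
  [IsProbabilityMeasure P₂] [HasUniqueMin P₁] [HasUniqueMin P₂] [IsProbabilityMeasure μ] in
theorem cumLoss_swap_swap (t : Fin T) (ω : Ω) :
    r.swap.swap.cumLoss h.swap.swap t ω = r.cumLoss h t ω := by
  refine Subtype.ext (funext fun u => ?_)
  rw [cumLoss_apply, cumLoss_apply]
  simp only [neg_neg]
  rfl

omit [CompactSpace X] [Nonempty X] [Nonempty Y] [IsProbabilityMeasure P₁]
  [IsProbabilityMeasure P₂] [HasUniqueMin P₁] [HasUniqueMin P₂] [IsProbabilityMeasure μ] in
theorem optLoss_swap_swap (t : Fin T) (ω : Ω) :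
    r.swap.swap.optLoss h.swap.swap t ω = r.optLoss h t ω := by
  rw [optLoss, optLoss, r.cumLoss_swap_swap h]
  congr 1
  refine Subtype.ext (funext fun u => ?_)
  rw [SmoothGame.loss_apply, SmoothGame.loss_apply]
  simp only [neg_neg]
  rfl

include h in
-- `regret_le` is applied to each player with the best-response laws of the other as approximations,
-- so the positive movement term of each regret is the negative one of the other. The cancellation
-- is pathwise; expectations are needed only for the sampling errors and for replacing empirical
-- play by its law.
theorem integral_gap_le (hN : ∀ z, N z = 0 → z = 0) (hd : 1 ≤ d) (hG : 0 ≤ G) (hL : 0 ≤ L)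
    {D η β : ℝ} (hX : ipmDiam N X ≤ D) (hY : ipmDiam N Y ≤ D) (hη : 0 ≤ η) (hβ : 0 ≤ β)
    (hβL : 3 * (β * L) ^ 2 ≤ 1) (hT : 1 ≤ T)
    (hint₁ : Integrable (fun σ : LipClass N X => lipConst N σ.1) P₁)
    (hint₂ : Integrable (fun σ : LipClass N Y => lipConst N σ.1) P₂)
    (hη₁ : ∫ σ : LipClass N X, lipConst N σ.1 ∂P₁ = η)
    (hη₂ : ∫ σ : LipClass N Y, lipConst N σ.1 ∂P₂ = η)
    (hstab₁ : IsStablePrediction N (minLaw P₁) β) (hstab₂ : IsStablePrediction N (minLaw P₂) β)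
    (x : X) (y : Y) :
    Integrable (r.gap x y) μ ∧ ∫ ω, r.gap x y ω ∂μ ≤ 2 * (η * D / T) + 24 * (β * min (D ^ 2 * L ^ 2)
        (72 * (D ^ 2 * L ^ 2 / m) + 40 * (d * G ^ 2 * Real.log (2 * m) / m))) := by
  set E := min (D ^ 2 * L ^ 2)
        (72 * (D ^ 2 * L ^ 2 / m) + 40 * (d * G ^ 2 * Real.log (2 * m) / m))
  have hT' : (0 : ℝ) < T := by exact_mod_cast hT
  obtain ⟨i1, i1', e1⟩ := r.integral_regret_eq h x
  obtain ⟨i2, i2', e2⟩ := r.swap.integral_regret_eq h.swap y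
  have hgap : r.gap x y = _ := funext (r.gap_eq h x y)
  have hi : Integrable (r.gap x y) μ := by
    rw [hgap]
    exact (i1.add i2).div_const _
  refine ⟨hi, ?_⟩
  choose B hB hle hBint using r.exists_bound_round_error h hN hd hG hL hX hY
  choose B' hB' hle' hBint' using r.swap.exists_bound_round_error h.swap hN hd hG hL hY hX
  have iB := integrable_finsetSum Finset.univ fun t _ => hB t
  have iB' := integrable_finsetSum Finset.univ fun t _ => hB' t
  -- the pathwise bound on the sum of the two regrets
  have hpath : ∀ᵐ ω ∂μ,
      ∑ t, (∫ u, (r.roundLoss h t ω).1 u ∂minLaw P₁ (r.optLoss h t ω) - (r.roundLoss h t ω).1 x)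
      + ∑ t, (∫ v, (r.swap.roundLoss h.swap t ω).1 v ∂minLaw P₂ (r.swap.optLoss h.swap t ω)
        - (r.swap.roundLoss h.swap t ω).1 y)
      ≤ 2 * (η * D) + (6 * β * ∑ t, B t ω + 6 * β * ∑ t, B' t ω) := by
    filter_upwards [ae_all_iff.2 hle, ae_all_iff.2 hle'] with ω hω hω'
    have h1 := r.regret_le h hL hβ hβL hint₁ hstab₁ x ω
      (fun t => minLaw P₂ (r.swap.optLoss h.swap t ω))
      (fun t => minLaw P₂ (r.swap.cumLoss h.swap t ω))
    have h2 := r.swap.regret_le h.swap hL hβ hβL hint₂ hstab₂ y ω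
      (fun t => minLaw P₁ (r.optLoss h t ω)) (fun t => minLaw P₁ (r.cumLoss h t ω))
    rw [hη₁] at h1
    rw [hη₂] at h2
    have a1 := mul_le_mul_of_nonneg_left hX hη
    have a2 := mul_le_mul_of_nonneg_left hY hη
    have a3 := mul_le_mul_of_nonneg_left
      (Finset.sum_le_sum fun t (_ : t ∈ Finset.univ) => hω t) (by positivity : 0 ≤ 6 * β)
    have a4 := mul_le_mul_of_nonneg_left
      (Finset.sum_le_sum fun t (_ : t ∈ Finset.univ) => hω' t) (by positivity : 0 ≤ 6 * β)
    -- Exchanging the players twice replaces f by −(−f); the laws in the error bound must be brought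
    -- to the form used in the regret bound.
    simp only [r.cumLoss_swap_swap h, r.optLoss_swap_swap h] at a4
    have a5 : ∀ t k, r.swap.yg t k ω = r.xg t k ω := fun _ _ => rfl
    simp only [a5] at a4 h2
    linarith
  have hmain := integral_mono_ae (i1'.add i2') ((integrable_const (2 * (η * D))).add
    ((iB.const_mul (6 * β)).add (iB'.const_mul (6 * β)))) hpath
  rw [integral_add' i1' i2', ← e1, ← e2] at hmain
  have hB_int : ∫ ω, (2 * (η * D) + (6 * β * ∑ t, B t ω + 6 * β * ∑ t, B' t ω)) ∂μ
      = 2 * (η * D) + (6 * β * ∑ t, ∫ ω, B t ω ∂μ + 6 * β * ∑ t, ∫ ω, B' t ω ∂μ) := by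
    have iC : Integrable (fun ω => 6 * β * ∑ t, B t ω + 6 * β * ∑ t, B' t ω) μ :=
      (iB.const_mul (6 * β)).add (iB'.const_mul (6 * β))
    rw [integral_add (integrable_const _) iC,
      integral_add (iB.const_mul (6 * β)) (iB'.const_mul (6 * β)), integral_const,
      integral_const_mul, integral_const_mul, integral_finsetSum _ fun t _ => hB t,
      integral_finsetSum _ fun t _ => hB' t, probReal_univ, one_smul]
  -- Each round has two sampling errors, one for the action and one for the guess; the two players
  -- together therefore give the factor 24.
  have hsum : ∀ b : Fin T → ℝ, (∀ t, b t ≤ 2 * E) → 6 * β * ∑ t, b t ≤ 12 * β * (T * E) := by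
    intro b hb
    have := Finset.sum_le_sum fun t (_ : t ∈ Finset.univ) => hb t
    rw [Finset.sum_const, Finset.card_univ, Fintype.card_fin, nsmul_eq_mul] at this
    have := mul_le_mul_of_nonneg_left this (by positivity : 0 ≤ 6 * β)
    linarith
  have s1 := hsum _ hBint
  have s2 := hsum _ hBint'
  have e3 : ∫ ω, r.gap x y ω ∂μ = _ := integral_congr_ae (Filter.Eventually.of_forall
    (r.gap_eq h x y))
  rw [e3, integral_div]
  have e4 := integral_add i1 i2
  have e5 : 2 * (η * D / T) + 24 * (β * E) = (2 * (η * D) + 24 * β * (T * E)) / T := by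
    field_simp
  rw [e5]
  refine div_le_div_of_nonneg_right ?_ hT'.le
  refine (le_of_eq e4).trans (hmain.trans ((le_of_eq hB_int).trans ?_))
  linarith

end OFTPLGameRun

/-! ### From the hypotheses on the game to the symmetric setting, and the final bound -/

section Assumptions

variable {d : ℕ} {N : Seminorm ℝ (Vec d)} {X Y : Set (Vec d)}

theorem smoothGame_of_hasLipPartialGradient (hN : ∀ z, N z = 0 → z = 0) {f : Vec d → Vec d → ℝ}
    {G L : ℝ} (hL : 0 ≤ L)
    (h₁ : ∀ y : Y, (fun x : X => f x y) ∈ LipClass N X ∧ lipConst N (fun x : X => f x y) ≤ G)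
    (h₂ : ∀ x : X, (fun y : Y => f x y) ∈ LipClass N Y ∧ lipConst N (fun y : Y => f x y) ≤ G)
    (hf₁ : HasLipPartialGradient N (convexHull ℝ X) Y L f)
    (hf₂ : HasLipPartialGradient N (convexHull ℝ Y) X L (fun y x => f x y)) :
    SmoothGame N X Y f G L where
  lip₁ x x' y := (abs_sub_le_lipConst (h₁ y).1 x x').trans
    (mul_le_mul_of_nonneg_right (h₁ y).2 (apply_nonneg _ _))
  lip₂ x y y' := (abs_sub_le_lipConst (h₂ x).1 y y').trans
    (mul_le_mul_of_nonneg_right (h₂ x).2 (apply_nonneg _ _))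
  mixed x x' y y' := abs_mixed_difference_le hN hf₁ x.2 x'.2 y.2 y'.2
  quot₁ x x' z z' y y' _ h h' :=
    abs_diffQuot_sub_le hN hL hf₁ x.2 x'.2 z.2 z'.2 y.2 y'.2 h h'
  quot₂ x x' z z' y y' _ h h' := by
    have e : ∀ a a' b : Vec d, diffQuot N (fun b a => -f a b) a a' b
        = -diffQuot N (fun b a => f a b) a a' b := fun a a' b => by
      rw [diffQuot, diffQuot]; ring
    have := abs_diffQuot_sub_le hN hL hf₂ x.2 x'.2 z.2 z'.2 y.2 y'.2 h h'
    rw [← abs_neg] at this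
    simp only [e]
    convert this using 2
    ring

theorem hasUniqueMin_of_min [CompactSpace X] [Nonempty X] {P : Measure (LipClass N X)}
    (hP : ∀ g : LipClass N X, ∀ᵐ σ ∂P, ∃! x, IsPerturbedMin g.1 σ.1 x) : HasUniqueMin P :=
  ⟨fun g => (hP g).mono fun _ h => sub_mem_uniqueMin h⟩

theorem isPerturbedMax_iff_neg (g σ : LipClass N X) :
    IsPerturbedMax g.1 σ.1 = IsPerturbedMin (-g).1 σ.1 := by
  funext x
  refine propext (forall_congr' fun x' => ?_)
  change _ ↔ -g.1 x - σ.1 x ≤ -g.1 x' - σ.1 x'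
  constructor <;> intro h <;> linarith

theorem hasUniqueMin_of_max [CompactSpace X] [Nonempty X] {P : Measure (LipClass N X)}
    (hP : ∀ g : LipClass N X, ∀ᵐ σ ∂P, ∃! x, IsPerturbedMax g.1 σ.1 x) : HasUniqueMin P :=
  ⟨fun g => (hP (-g)).mono fun σ h => by
    rw [isPerturbedMax_iff_neg, neg_neg] at h
    exact sub_mem_uniqueMin h⟩

/-- Maximising g + σ is minimising −g − σ with the same σ, and the Lipschitz constant ignores the
sign. The second player thus becomes a minimizer too. -/
theorem isStablePrediction_minLaw_of_maxLaw [Nonempty X] {P : Measure (LipClass N X)} {β : ℝ}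
    (h : IsStablePrediction N (maxLaw P) β) : IsStablePrediction N (minLaw P) β := by
  have e : ∀ g, maxLaw P (-g) = minLaw P g := fun g => by
    simp only [maxLaw, minLaw, isPerturbedMax_iff_neg, neg_neg]
  intro g g'
  have := h (-g) (-g')
  rw [e, e] at this
  have e' : (-g - -g').1 = -(g - g').1 := by
    have : -g - -g' = -(g - g') := by abel
    exact congrArg Subtype.val this
  rwa [e', lipConst_neg] at this

end Assumptions

theorem mainTheorem7 :
    ∃ K : ℝ, 0 < K ∧
      ∀ (d : ℕ) (N : Seminorm ℝ (Vec d)) (_ : ∀ z, N z = 0 → z = 0)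
        (X Y : Set (Vec d)) [Nonempty X] [Nonempty Y] (_ : IsCompact X) (_ : IsCompact Y)
        (f : Vec d → Vec d → ℝ) (G L C η D : ℝ) (_ : 0 ≤ L) (_ : 0 ≤ C)
        -- `f` is `G`-Lipschitz in each variable
        (_ : ∀ y : Y, (fun x : X => f x y) ∈ LipClass N X ∧ lipConst N (fun x : X => f x y) ≤ G)
        (_ : ∀ x : X, (fun y : Y => f x y) ∈ LipClass N Y ∧ lipConst N (fun y : Y => f x y) ≤ G)
        -- `f` is `L`-smooth
        (_ : HasLipPartialGradient N (convexHull ℝ X) Y L f)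
        (_ : HasLipPartialGradient N (convexHull ℝ Y) X L (fun y x => f x y))
        (_ : D = max (ipmDiam N X) (ipmDiam N Y))
        -- the perturbation distributions of the two players
        (P₁ : Measure (LipClass N X)) (P₂ : Measure (LipClass N Y))
        [IsProbabilityMeasure P₁] [IsProbabilityMeasure P₂]
        (_ : ∀ g : LipClass N X, ∀ᵐ σ ∂P₁, ∃! x, IsPerturbedMin g.1 σ.1 x)
        (_ : ∀ g : LipClass N Y, ∀ᵐ σ ∂P₂, ∃! y, IsPerturbedMax g.1 σ.1 y)
        (_ : Integrable (fun σ : LipClass N X => lipConst N σ.1) P₁)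
        (_ : Integrable (fun σ : LipClass N Y => lipConst N σ.1) P₂)
        (_ : ∫ σ, lipConst N σ.1 ∂P₁ = η) (_ : ∫ σ, lipConst N σ.1 ∂P₂ = η)
        (_ : IsStablePrediction N (minLaw P₁) (C * η⁻¹)) (_ : IsStablePrediction N (maxLaw P₂) (C * η⁻¹))
        (_ : √3 * C * L < η)
        (m T : ℕ) (_ : 1 ≤ m) (_ : 1 ≤ T)
        {Ω : Type*} [MeasurableSpace Ω] (μ : Measure Ω) [IsProbabilityMeasure μ]
        (r : OFTPLGameRun f P₁ P₂ m T μ) (x : X) (y : Y),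
        Integrable (r.gap x y) μ ∧
        ∫ ω, r.gap x y ω ∂μ ≤
          K * (η * D / T + C * D ^ 2 * L ^ 2 / (η * m)
            + min (d * C * compatConst₁ N ^ 2 * compatConst₂ N ^ 2 * G ^ 2 * Real.log (2 * m)
                    / (η * m))
                (C * D ^ 2 * L ^ 2 / η)) := by
  -- 1728 = 24·72, the largest coefficient that occurs.
  refine ⟨1728, by norm_num, ?_⟩
  intro d N hN X Y _ _ hXc hYc f G L C η D hL hC h₁ h₂ hf₁ hf₂ hD P₁ P₂ _ _ hmin hmax hint₁ hint₂ hη₁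
    hη₂ hstab₁ hstab₂ hη m T hm hT Ω _ μ _ r x y
  have : CompactSpace X := isCompact_iff_compactSpace.1 hXc
  have : CompactSpace Y := isCompact_iff_compactSpace.1 hYc
  have : NeZero m := ⟨by omega⟩
  have : NeZero T := ⟨by omega⟩
  have := hasUniqueMin_of_min hmin
  have := hasUniqueMin_of_max hmax
  have hG : 0 ≤ G := (lipConst_nonneg _).trans (h₁ y).2
  have h := smoothGame_of_hasLipPartialGradient hN hL h₁ h₂ hf₁ hf₂
  have hX : ipmDiam N X ≤ D := hD ▸ le_max_left _ _
  have hY : ipmDiam N Y ≤ D := hD ▸ le_max_right _ _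
  have hD0 : 0 ≤ D := ipmDiam_nonneg.trans hX
  have hη0 : 0 < η := lt_of_le_of_lt (by positivity) hη
  have hm' : (1 : ℝ) ≤ m := by exact_mod_cast hm
  have hlog : 0 ≤ Real.log (2 * m) := Real.log_nonneg (by linarith)
  set A := η * D / T
  set B := C * D ^ 2 * L ^ 2 / (η * m)
  set B₁ := d * C * compatConst₁ N ^ 2 * compatConst₂ N ^ 2 * G ^ 2 * Real.log (2 * m) / (η * m)
  set B₂ := C * D ^ 2 * L ^ 2 / η
  have hA : 0 ≤ A := by positivity
  have hB : 0 ≤ B := by positivity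
  have hB₁ : 0 ≤ B₁ := by positivity
  have hB₂ : 0 ≤ B₂ := by positivity
  -- In dimension 0 both sets are single points and the gap vanishes; the compatibility constants
  -- are then 0 and cannot be used.
  rcases Nat.eq_zero_or_pos d with rfl | hd
  · have hgap : r.gap x y = fun _ => 0 := by
      funext ω
      have e₁ : ∀ u : X, f u y = f x y := fun u => by rw [Subsingleton.elim u x]
      have e₂ : ∀ v : Y, f x v = f x y := fun v => by rw [Subsingleton.elim v y]
      change ∫ u : X, f u y ∂(mixture fun t => empirical fun j => r.x t j ω)
        - ∫ v : Y, f x v ∂(mixture fun t => empirical fun j => r.y t j ω) = _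
      simp only [e₁, e₂, integral_const, probReal_univ, sub_self]
    rw [hgap]
    refine ⟨integrable_const _, ?_⟩
    rw [integral_zero]
    positivity
  have hβL : 3 * (C * η⁻¹ * L) ^ 2 ≤ 1 := by
    have h1 : (√3 * C * L) ^ 2 ≤ η ^ 2 := pow_le_pow_left₀ (by positivity) hη.le 2
    have h2 : (√3 * C * L) ^ 2 = 3 * (C * L) ^ 2 := by
      rw [mul_assoc, mul_pow, Real.sq_sqrt (by norm_num)]
    have h3 : 3 * (C * η⁻¹ * L) ^ 2 = 3 * (C * L) ^ 2 / η ^ 2 := by field_simp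
    rw [h3, div_le_one (by positivity), ← h2]
    exact h1
  obtain ⟨hi, hle⟩ := r.integral_gap_le h hN hd hG hL hX hY hη0.le (by positivity) hβL hT hint₁ hint₂
    hη₁ hη₂ hstab₁ (isStablePrediction_minLaw_of_maxLaw hstab₂) x y
  refine ⟨hi, hle.trans ?_⟩
  have hβ : 0 ≤ C * η⁻¹ := by positivity
  have c₂ : C * η⁻¹ * (D ^ 2 * L ^ 2) = B₂ := by simp only [B₂]; ring
  have c₁ : C * η⁻¹ * (72 * (D ^ 2 * L ^ 2 / m) + 40 * (d * G ^ 2 * Real.log (2 * m) / m))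
      ≤ 72 * B + 40 * B₁ := by
    -- Inserting the factor Ψ₁²Ψ₂² ≥ 1 only weakens the sampling bound.
    have hΨ : (1 : ℝ) ≤ (compatConst₁ N * compatConst₂ N) ^ 2 :=
      one_le_pow₀ (one_le_compatConst_mul hN hd)
    have e₁ : C * η⁻¹ * (72 * (D ^ 2 * L ^ 2 / m)) = 72 * B := by
      simp only [B]; field_simp
    have e₂ : B₁ = C * η⁻¹ * (d * G ^ 2 * Real.log (2 * m) / m)
        * (compatConst₁ N * compatConst₂ N) ^ 2 := by
      simp only [B₁]; field_simp
    have := le_mul_of_one_le_right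
      (by positivity : 0 ≤ C * η⁻¹ * (d * G ^ 2 * Real.log (2 * m) / m)) hΨ
    rw [← e₂] at this
    rw [mul_add, e₁]
    linarith
  have hmin₁ := mul_le_mul_of_nonneg_left (min_le_left (D ^ 2 * L ^ 2)
    (72 * (D ^ 2 * L ^ 2 / m) + 40 * (d * G ^ 2 * Real.log (2 * m) / m))) hβ
  have hmin₂ := mul_le_mul_of_nonneg_left (min_le_right (D ^ 2 * L ^ 2)
    (72 * (D ^ 2 * L ^ 2 / m) + 40 * (d * G ^ 2 * Real.log (2 * m) / m))) hβ
  rcases min_cases B₁ B₂ with ⟨hm, -⟩ | ⟨hm, -⟩ <;> rw [hm] <;> linarith
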